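/- Let $\mathcal H$ be a separable complex Hilbert space (inner product linear in the second variable), $\sigma(f,g)=\operatorname{Im}\langle f,g\rangle$, and let $H$ be a positive self-adjoint operator on $\mathcal H$ with $\ker H=0$. Let $\mathcal D\subseteq D(H)\cap D(H^{-1})$ be a complex linear subspace, dense in $\mathcal H$, with $H\mathcal D\subseteq\mathcal D$ and $e^{itH}\mathcal D\subseteq\mathcal D$ for all $t\in\mathbb R$, which consists of vectors of bounded spectral support (for every $f\in\mathcal D$ there are $C,b$ with $\|H^nf\|\le Cb^n$ for all $n\ge 0$, i.e. $f=P^{(H)}([0,b])f$ for some $b$; in particular $f$ is an analytic vector) and contains the time averages of its elements: $\int_0^te^{isH}f\,ds\in\mathcal D$ for $f\in\mathcal D$, $t\in\mathbb R$. (For instance $\mathcal D=\{P^{(H)}((a,b])\psi:\psi\in\mathcal H,\ 0<a<b<\infty\}$.) Let $\mathcal W(\mathcal D,0)$ be the commutative Weyl $C^*$-algebra, the sup-norm closure of $\Delta(\mathcal D,0)=\operatorname{span}\{W^0(f):f\in\mathcal D\}$, $W^0(f)[g]=e^{i\operatorname{Re}\langle f,g\rangle}$ $(g\in\mathcal H)$,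 with the Poisson bracket on $\Delta(\mathcal D,0)$ given by $\{W^0(f),W^0(g)\}=\sigma(g,f)W^0(f+g)$. Let $\beta\in\mathbb R$, and let $\omega$ be a state on $\mathcal W(\mathcal D,0)$ with GNS triple $(\pi_\omega,\mathcal H_\omega,\Omega_\omega)$. Suppose that $\omega$ is a $(\delta_0,\beta)$-weak KMS state, where $\delta_0(W^0(f))=i\Phi_0(iHf)W^0(f)$. That is: the unitary groups $t\mapsto\pi_\omega(W^0(tf))$ are strongly continuous and $\Omega_\omega$ lies in the domain of their generators ($f\in\mathcal D$), and $$\omega(\{a,b\})=\beta\,\omega(b\,\delta_0(a)),\qquad a,b\in\Delta(\mathcal D,0),$$ where $\omega(\Phi_0(h)W^0(k)):=-i\frac{d}{dt}\omega(W^0(th+k))|_{t=0}$. Then $\omega$ is a $(\delta_0^\omega,\beta)$-classical KMS state in its GNS representation. That is, with $\mathfrak M=\pi_\omega(\mathcal W(\mathcal D,0))''$, which is commutative: 1. There is a $\sigma$-weakly continuous one-parameter group $(\tau^\omega_t)_{t\in\mathbb R}$ of ($\sigma$-weakly continuous) $^*$-automorphisms of $\mathfrak M$ with $\tau^\omega_t(\pi_\omega(W^0(f)))=\pi_\omega(W^0(e^{itH}f))$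 for $f\in\mathcal D$, $t\in\mathbb R$. 2. For $n\ge1$ let $\mathcal A_n$ be the set of real-valued functions on $\mathbb R^n$ that are Fourier transforms of functions in $C_c^\infty(\mathbb R^n)$. For all $f=(f_1,\dots,f_n)\in\mathcal D^n$ and $\chi\in\mathcal A_n$ the $\sigma$-weak integral $A(f,\chi)=\int_{\mathbb R^n}\pi_\omega\big(W^0(\sum_ie^{it_iH}f_i)\big)\chi(t)\,d^nt$ exists in $\mathfrak M$. The linear hull $\mathcal W(\mathcal A)$ of these elements is a $\sigma$-weakly dense, $\tau^\omega$-invariant $^*$-subalgebra of $\mathfrak M$ consisting of entire analytic elements for $\tau^\omega$. 3. $\mathcal W(\mathcal A)$ carries a Poisson bracket (bilinear, antisymmetric, satisfying the Leibniz rule and the Jacobi identity, and compatible with $^*$) with values in $\mathcal W(\mathcal A)$ such that, for $n,m\ge 1$, $f\in\mathcal D^n$, $\chi_1\in\mathcal A_n$, $g\in\mathcal D^m$, $\chi_2\in\mathcal A_m$, with $F(t)=\sum_ie^{it_iH}f_i$ and $G(s)=\sum_je^{is_jH}g_j$, $$\{A(f,\chi_1),A(g,\chi_2)\}=\int_{\mathbb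 R^{n}\times\mathbb R^m}\pi_\omega\big(W^0(F(t)+G(s))\big)\,\chi_1(t)\chi_2(s)\,\sigma(G(s),F(t))\,d^nt\,d^ms .$$ 4. For $b\in\mathcal W(\mathcal A)$ the limit $\delta_0^\omega(b)=\lim_{t\to0}\frac1t(\tau^\omega_t(b)-b)$ exists $\sigma$-weakly in $\mathfrak M$, and the normal state $\omega(A)=\langle\Omega_\omega,A\Omega_\omega\rangle$ of $\mathfrak M$ satisfies $$\beta\,\omega(a\,\delta_0^\omega(b))=\omega(\{b,a\}),\qquad a,b\in\mathcal W(\mathcal A).$$ -/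

import Mathlib

open scoped InnerProductSpace FourierTransform Topology ComplexOrder
open MeasureTheory Filter

noncomputable section

namespace ClassicalKMS

universe u v

/-! ### The one-particle space -/

section OneParticle

variable {𝓗 : Type u} [NormedAddCommGroup 𝓗] [InnerProductSpace ℂ 𝓗]

/-- The symplectic form `σ(f, g) = Im ⟨f, g⟩` (inner product linear in the second slot). -/
def symp (f g : 𝓗) : ℝ := (⟪f, g⟫_ℂ).im

open Classical in
/-- The operator `H` as a map on all of `𝓗`, with value `0` off its domain; it is only ever
used on vectors of the domain. -/
def opApply (H : 𝓗 →ₗ.[ℂ] 𝓗) (f : 𝓗) : 𝓗 :=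
  if h : f ∈ H.domain then H ⟨f, h⟩ else 0

/-- `e^{itH} f`, by the exponential series. It is only used on vectors with
`‖Hⁿ f‖ ≤ C bⁿ` for all `n`, where the series converges in norm and its sum is the value at `f`
of the unitary operator `e^{itH}` of the functional calculus. -/
def expI (H : 𝓗 →ₗ.[ℂ] 𝓗) (t : ℝ) (f : 𝓗) : 𝓗 :=
  ∑' n : ℕ, (((t : ℂ) * Complex.I) ^ n / (n.factorial : ℂ)) • (opApply H)^[n] f

/-- The standing assumptions on the space `D` of test functions. -/
structure IsTestSpace (H : 𝓗 →ₗ.[ℂ] 𝓗) (D : Submodule ℂ 𝓗) : Prop where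
  dense : Dense (D : Set 𝓗)
  le_domain : D ≤ H.domain
  /-- `D ⊆ D(H⁻¹)`, the domain of `H⁻¹` being the range of `H`. -/
  le_domain_inverse : D ≤ H.inverse.domain
  /-- `H D ⊆ D`, so that the field functions `Φ₀(iHf)`, `f ∈ D`, belong to the fields over `D`. -/
  map_mem : ∀ f ∈ D, opApply H f ∈ D
  /-- For a positive self-adjoint `H` this says that `f` has bounded spectral support,
  `f = P([0, b]) f` for some `b`. In particular `f` is an analytic vector. -/
  expType : ∀ f ∈ D, ∃ C b : ℝ, ∀ n : ℕ, ‖(opApply H)^[n] f‖ ≤ C * b ^ n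
  exp_mem : ∀ (t : ℝ), ∀ f ∈ D, expI H t f ∈ D
  /-- `D` contains the time integrals of its orbits. -/
  integral_mem : ∀ (t : ℝ), ∀ f ∈ D, (∫ s in (0 : ℝ)..t, expI H s f) ∈ D

variable {H : 𝓗 →ₗ.[ℂ] 𝓗} {D : Submodule ℂ 𝓗}

/-- `iHf` as a vector of `D`. -/
def IsTestSpace.iH (hD : IsTestSpace H D) (f : D) : D :=
  Complex.I • ⟨opApply H f, hD.map_mem f f.2⟩

/-- `e^{itH} f` as a vector of `D`. -/
def IsTestSpace.evol (hD : IsTestSpace H D) (t : ℝ) (f : D) : D :=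
  ⟨expI H t f, hD.exp_mem t f f.2⟩

/-- `∑ᵢ e^{i tᵢ H} fᵢ`. -/
def IsTestSpace.multiEvol (hD : IsTestSpace H D) {n : ℕ} (f : Fin n → D)
    (t : EuclideanSpace ℝ (Fin n)) : D :=
  ∑ i, hD.evol (t i) (f i)

end OneParticle

/-! ### The classical Weyl algebra, its states and the weak KMS condition -/

section Weyl

variable {𝓗 : Type u} [NormedAddCommGroup 𝓗] [InnerProductSpace ℂ 𝓗]

/-- The almost periodic function `g ↦ exp (i Re ⟨f, g⟩)`. -/
def weylFun (f : 𝓗) : BoundedContinuousFunction 𝓗 ℂ :=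
  BoundedContinuousFunction.ofNormedAddCommGroup
    (fun g => Complex.exp (((⟪f, g⟫_ℂ).re : ℂ) * Complex.I)) (by fun_prop) 1
    (fun g => (Complex.norm_exp_ofReal_mul_I _).le)

/-- The commutative Weyl C⋆-algebra `W(D, 0)`, realised as the algebra of almost periodic
functions: the sup-norm closure of the ⋆-algebra generated by the functions
`exp (i Re ⟨f, ·⟩)`, `f ∈ D`, on `𝓗`, which is the norm dual of the dense subspace `D`. -/
def weylAlgebra (D : Submodule ℂ 𝓗) : StarSubalgebra ℂ (BoundedContinuousFunction 𝓗 ℂ) :=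
  (StarAlgebra.adjoin ℂ (weylFun '' (D : Set 𝓗))).topologicalClosure

/-- The Weyl element `W⁰(f)`. -/
def weyl {D : Submodule ℂ 𝓗} (f : D) : weylAlgebra D :=
  ⟨weylFun (f : 𝓗), StarSubalgebra.le_topologicalClosure _
    (StarAlgebra.subset_adjoin ℂ _ ⟨f, f.2, rfl⟩)⟩

/-- A state on `W(D, 0)`. -/
structure WeylState (D : Submodule ℂ 𝓗) where
  toLin : weylAlgebra D →ₗ[ℂ] ℂ
  nonneg : ∀ a : weylAlgebra D, 0 ≤ toLin (star a * a)
  map_one : toLin 1 = 1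

/-- A GNS triple `(K, π, Ω)` of the state `ω` (unique up to unitary equivalence). -/
structure GNSTriple {D : Submodule ℂ 𝓗} (ω : WeylState D) (K : Type v)
    [NormedAddCommGroup K] [InnerProductSpace ℂ K] [CompleteSpace K] where
  π : weylAlgebra D →⋆ₐ[ℂ] (K →L[ℂ] K)
  Ω : K
  inner_eq : ∀ a, ω.toLin a = ⟪Ω, π a Ω⟫_ℂ
  cyclic : Dense (Set.range fun a => π a Ω)

variable {D : Submodule ℂ 𝓗} {ω : WeylState D} {K : Type v}
  [NormedAddCommGroup K] [InnerProductSpace ℂ K] [CompleteSpace K]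

/-- `ω` is a `C²` state: its GNS representation is regular and the cyclic vector belongs to the
domain of every field operator, the generator of `t ↦ π(W⁰(tf))`. -/
structure GNSTriple.IsC2 (G : GNSTriple ω K) : Prop where
  regular : ∀ (f : D) (ξ : K), Continuous fun t : ℝ => G.π (weyl ((t : ℂ) • f)) ξ
  mem_domain : ∀ f : D, DifferentiableAt ℝ (fun t : ℝ => G.π (weyl ((t : ℂ) • f)) G.Ω) 0

/-- `ω(Φ₀(h) W⁰(k)) = -i d/dt ω(W⁰(th) W⁰(k))` at `t = 0`. -/
def WeylState.field (ω : WeylState D) (h k : D) : ℂ :=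
  -Complex.I * deriv (fun t : ℝ => ω.toLin (weyl ((t : ℂ) • h) * weyl k)) 0

/-- The Poisson bracket of `∑ a_f W⁰(f)` and `∑ b_g W⁰(g)` in the span `Δ(D, 0)` of the (linearly
independent) Weyl elements: the bilinear extension of `{W⁰(f), W⁰(g)} = σ(g, f) W⁰(f + g)`. -/
def weylBracket (a b : D →₀ ℂ) : weylAlgebra D :=
  a.sum fun f x => b.sum fun g y => (x * y * (symp (g : 𝓗) (f : 𝓗) : ℂ)) • weyl (f + g)

variable {H : 𝓗 →ₗ.[ℂ] 𝓗}

/-- `ω(b δ₀(a))` for `a = ∑ a_f W⁰(f)` and `b = ∑ b_g W⁰(g)`, where `δ₀` is the weak derivation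
`δ₀(W⁰(f)) = i Φ₀(iHf) W⁰(f)`. -/
def WeylState.mulDeriv (ω : WeylState D) (hD : IsTestSpace H D) (b a : D →₀ ℂ) : ℂ :=
  a.sum fun f x => b.sum fun g y => x * y * (Complex.I * ω.field (hD.iH f) (f + g))

/-- `ω` is a `(δ₀, β)`-weak KMS state on `W(D, 0)`: it is `C²` and
`ω({a, b}) = β ω(b δ₀(a))` for all `a, b ∈ Δ(D, 0)`. (The `C²` property does not depend on the
GNS triple through which it is expressed.) -/
structure IsWeakKMS (hD : IsTestSpace H D) (β : ℝ) (ω : WeylState D) (G : GNSTriple ω K) :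
    Prop where
  isC2 : G.IsC2
  kms : ∀ a b : D →₀ ℂ, ω.toLin (weylBracket a b) = (β : ℂ) * ω.mulDeriv hD b a

end Weyl

/-! ### Von Neumann algebras, the σ-weak topology and classical KMS states -/

section VonNeumann

variable {K : Type v} [NormedAddCommGroup K] [InnerProductSpace ℂ K] [CompleteSpace K]

/-- Pairs of square-summable sequences of vectors; they give the normal functionals. -/
abbrev NormalPair (K : Type v) [NormedAddCommGroup K] : Type v :=
  {p : (ℕ → K) × (ℕ → K) //
    (Summable fun n => ‖p.1 n‖ ^ 2) ∧ (Summable fun n => ‖p.2 n‖ ^ 2)}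

/-- The normal functional `A ↦ ∑ₙ ⟨ξₙ, A ηₙ⟩`. -/
def NormalPair.eval (p : NormalPair K) (A : K →L[ℂ] K) : ℂ :=
  ∑' n, ⟪p.1.1 n, A (p.1.2 n)⟫_ℂ

/-- The σ-weak topology on `B(K)`. -/
abbrev sigmaWeak (K : Type v) [NormedAddCommGroup K] [InnerProductSpace ℂ K] :
    TopologicalSpace (K →L[ℂ] K) :=
  TopologicalSpace.induced (fun A (p : NormalPair K) => p.eval A) inferInstance

/-- The set of elements of a von Neumann algebra, as a type. -/
abbrev Elt (M : VonNeumannAlgebra K) : Type v := M.toStarSubalgebra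

/-- The σ-weak topology on a von Neumann algebra. -/
abbrev sigmaWeakOn (M : VonNeumannAlgebra K) : TopologicalSpace (Elt M) :=
  TopologicalSpace.induced (fun A : Elt M => (A : K →L[ℂ] K)) (sigmaWeak K)

/-- `A = ∫ F(x) dx` in the σ-weak topology. -/
def HasSigmaWeakIntegral {X : Type*} [MeasureSpace X] (F : X → (K →L[ℂ] K)) (A : K →L[ℂ] K) :
    Prop :=
  ∀ p : NormalPair K, Integrable (fun x => p.eval (F x)) ∧ ∫ x, p.eval (F x) = p.eval A

/-- A W⋆-dynamical system over `ℝ`: a σ-weakly continuous one-parameter group of σ-weakly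
continuous ⋆-automorphisms of `M`. -/
structure WStarDynamics (M : VonNeumannAlgebra K) where
  τ : ℝ → (Elt M ≃⋆ₐ[ℂ] Elt M)
  map_zero : ∀ A, τ 0 A = A
  map_add : ∀ s t A, τ (s + t) A = τ s (τ t A)
  normal : ∀ t, @Continuous _ _ (sigmaWeakOn M) (sigmaWeakOn M) (τ t)
  continuous_orbit : ∀ A, @Continuous _ _ _ (sigmaWeakOn M) fun t => τ t A

variable {M : VonNeumannAlgebra K}

/-- `A` is (entire) analytic for the dynamics: its orbit extends to a σ-weakly entire map. -/
def WStarDynamics.IsAnalytic (α : WStarDynamics M) (A : Elt M) : Prop :=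
  ∃ F : ℂ → Elt M, (∀ t : ℝ, F t = α.τ t A) ∧
    ∀ p : NormalPair K, Differentiable ℂ fun z => p.eval (F z : K →L[ℂ] K)

/-- `B = δ(A)`, the σ-weak limit of `(τ_t(A) - A) / t` as `t → 0`. -/
def WStarDynamics.HasDerivation (α : WStarDynamics M) (A B : Elt M) : Prop :=
  Tendsto (fun t : ℝ => ((t : ℂ)⁻¹) • (α.τ t A - A)) (𝓝[≠] 0) (@nhds _ (sigmaWeakOn M) B)

/-- A σ-weakly dense, `τ`-invariant Poisson ⋆-subalgebra of the `τ`-analytic elements. -/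
structure PoissonStructure (α : WStarDynamics M) where
  carrier : NonUnitalStarSubalgebra ℂ (Elt M)
  dense : ∀ A, A ∈ @closure _ (sigmaWeakOn M) (carrier : Set (Elt M))
  invariant : ∀ t, ∀ A ∈ carrier, α.τ t A ∈ carrier
  analytic : ∀ A ∈ carrier, α.IsAnalytic A
  bracket : carrier →ₗ[ℂ] carrier →ₗ[ℂ] carrier
  skew : ∀ a b, bracket a b = -bracket b a
  leibniz : ∀ a b c, bracket a (b * c) = bracket a b * c + b * bracket a c
  jacobi : ∀ a b c,
    bracket a (bracket b c) + bracket b (bracket c a) + bracket c (bracket a b) = 0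
  bracket_star : ∀ a b, bracket (star a) (star b) = star (bracket a b)

/-- `φ` is a `(δ, β)`-classical KMS state of the commutative W⋆-dynamical system `(M, α)` with
Poisson structure `P`; the derivation `δ` of the dynamics is part of the assertion. -/
structure IsClassicalKMS (α : WStarDynamics M) (P : PoissonStructure α) (β : ℝ)
    (φ : Elt M →ₗ[ℂ] ℂ) : Prop where
  commutative : ∀ a b : Elt M, a * b = b * a
  nonneg : ∀ a : Elt M, 0 ≤ φ (star a * a)
  map_one : φ 1 = 1
  normal : ∃ p : NormalPair K, ∀ a : Elt M, φ a = p.eval (a : K →L[ℂ] K)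
  kms : ∀ a b : P.carrier, ∃ d : Elt M, α.HasDerivation b d ∧
    (β : ℂ) * φ ((a : Elt M) * d) = φ (P.bracket b a : Elt M)

/-- The vector functional `A ↦ ⟨Ω, A Ω⟩`. -/
def vectorFunctional (M : VonNeumannAlgebra K) (Ω : K) : Elt M →ₗ[ℂ] ℂ where
  toFun A := ⟪Ω, (A : K →L[ℂ] K) Ω⟫_ℂ
  map_add' A B := by simp
  map_smul' c A := by simp

/-- The von Neumann algebra `S''` generated by a ⋆-subalgebra `S` of `B(K)`. -/
def bicommutant (S : StarSubalgebra ℂ (K →L[ℂ] K)) : VonNeumannAlgebra K where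
  toStarSubalgebra :=
    StarSubalgebra.centralizer ℂ
      (StarSubalgebra.centralizer ℂ (S : Set (K →L[ℂ] K)) : Set (K →L[ℂ] K))
  centralizer_centralizer' := by simp

theorem coe_bicommutant (S : StarSubalgebra ℂ (K →L[ℂ] K)) :
    (bicommutant S : Set (K →L[ℂ] K)) =
      Set.centralizer (Set.centralizer (S : Set (K →L[ℂ] K))) := by
  change ((StarSubalgebra.centralizer ℂ
      (StarSubalgebra.centralizer ℂ (S : Set (K →L[ℂ] K)) : Set (K →L[ℂ] K)) :
        StarSubalgebra ℂ (K →L[ℂ] K)) : Set (K →L[ℂ] K)) = _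
  have h : ∀ N : StarSubalgebra ℂ (K →L[ℂ] K),
      star (N : Set (K →L[ℂ] K)) = (N : Set (K →L[ℂ] K)) := by
    intro N
    ext x
    simp
  rw [StarSubalgebra.coe_centralizer, h, Set.union_self, StarSubalgebra.coe_centralizer, h,
    Set.union_self]

theorem subset_bicommutant (S : StarSubalgebra ℂ (K →L[ℂ] K)) {A : K →L[ℂ] K} (hA : A ∈ S) :
    A ∈ (bicommutant S).toStarSubalgebra := by
  change A ∈ (bicommutant S : Set (K →L[ℂ] K))
  rw [coe_bicommutant]
  exact Set.subset_centralizer_centralizer hA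

end VonNeumann

/-! ### The GNS von Neumann algebra and the smeared Weyl elements -/

section Smeared

variable {𝓗 : Type u} [NormedAddCommGroup 𝓗] [InnerProductSpace ℂ 𝓗]
  {D : Submodule ℂ 𝓗} {ω : WeylState D} {K : Type v}
  [NormedAddCommGroup K] [InnerProductSpace ℂ K] [CompleteSpace K]

/-- `π_ω(W(D, 0))''`. -/
def GNSTriple.vN (G : GNSTriple ω K) : VonNeumannAlgebra K := bicommutant G.π.range

/-- `π_ω(a)` as an element of `π_ω(W(D, 0))''`. -/
def GNSTriple.rep (G : GNSTriple ω K) (a : weylAlgebra D) : Elt G.vN :=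
  ⟨G.π a, subset_bicommutant _ ⟨a, rfl⟩⟩

/-- The class `𝓐ₙ` of real-valued functions on `ℝⁿ` that are Fourier transforms of smooth
compactly supported functions. -/
def smearClass (n : ℕ) : Set (EuclideanSpace ℝ (Fin n) → ℝ) :=
  {χ | ∃ ψ : EuclideanSpace ℝ (Fin n) → ℂ, ContDiff ℝ (⊤ : ℕ∞) ψ ∧ HasCompactSupport ψ ∧
    ∀ t, (χ t : ℂ) = 𝓕 ψ t}

variable {H : 𝓗 →ₗ.[ℂ] 𝓗}

/-- `A = ∫ π_ω(W⁰(∑ᵢ e^{i tᵢ H} fᵢ)) χ(t) dⁿt` in the σ-weak topology. -/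
def GNSTriple.IsSmeared (G : GNSTriple ω K) (hD : IsTestSpace H D) {n : ℕ} (f : Fin n → D)
    (χ : EuclideanSpace ℝ (Fin n) → ℝ) (A : Elt G.vN) : Prop :=
  HasSigmaWeakIntegral (fun t => (χ t : ℂ) • G.π (weyl (hD.multiEvol f t))) (A : K →L[ℂ] K)

/-- The linear hull `W(𝓐)` of the smeared Weyl elements. -/
def GNSTriple.smearedSpan (G : GNSTriple ω K) (hD : IsTestSpace H D) :
    Submodule ℂ (Elt G.vN) :=
  Submodule.span ℂ {A | ∃ (n : ℕ) (_ : 0 < n) (f : Fin n → D), ∃ χ ∈ smearClass n,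
    G.IsSmeared hD f χ A}

/-- `C = ∫∫ π_ω(W⁰(F(t) + G(s))) χ₁(t) χ₂(s) σ(G(s), F(t)) dt ds` with
`F(t) = ∑ᵢ e^{i tᵢ H} fᵢ` and `G(s) = ∑ⱼ e^{i sⱼ H} gⱼ`: the bracket of two smeared elements. -/
def GNSTriple.IsSmearedBracket (G : GNSTriple ω K) (hD : IsTestSpace H D) {n m : ℕ}
    (f : Fin n → D) (χ₁ : EuclideanSpace ℝ (Fin n) → ℝ)
    (g : Fin m → D) (χ₂ : EuclideanSpace ℝ (Fin m) → ℝ) (C : Elt G.vN) : Prop :=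
  HasSigmaWeakIntegral
    (fun x : EuclideanSpace ℝ (Fin n) × EuclideanSpace ℝ (Fin m) =>
      ((χ₁ x.1 * χ₂ x.2 *
          symp (hD.multiEvol g x.2 : 𝓗) (hD.multiEvol f x.1 : 𝓗) : ℝ) : ℂ) •
        G.π (weyl (hD.multiEvol f x.1 + hD.multiEvol g x.2)))
    (C : K →L[ℂ] K)

end Smeared

end ClassicalKMS

end

open scoped InnerProductSpace FourierTransform Topology ComplexOrder
open MeasureTheory Filter

noncomputable section

namespace ClassicalKMS

universe u v

/-! ### Bounded self-adjoint models of a symmetric operator on vectors of exponential type. -/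

section BoundedModel

variable {𝓗 : Type u} [NormedAddCommGroup 𝓗] [InnerProductSpace ℂ 𝓗]

/-! Write φ(f) = ω(W⁰(f)). On Weyl elements the weak KMS condition reads σ(h, f) φ(h) = β ∂φ(h),
where ∂ is the derivative in the direction iHf. Along the line h + s·iHf this is a linear
first-order equation with affine coefficient, so φ(h + iHf) = φ(h) exp(β⁻¹(σ(h, f) + σ(iHf, f)/2))
(`genFun_add_iH`). For β = 0 the condition forces D = 0, so dividing by β costs nothing.

The formula is applied to k = ∫₀ᵗ e^{isH}f ds, a test vector with iHk = e^{itH}f − f. It gives three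
things. The exponent vanishes for h = f and the increment e^{itH}f − f, hence φ is invariant under
the flow (`genFun_evol`) and W(f)Ω ↦ W(e^{itH}f)Ω extends to unitaries implementing τ. Since ‖iHk‖ ≤
2‖f‖ and ‖k‖ ≤ |t|‖f‖, Weyl operators are strongly continuous along the flow
(`continuous_W_multiEvol`), although H is unbounded and φ need not be continuous in other
directions. Finally β d/dt φ(g + e^{itH}f) at t = 0 is σ(g, f) φ(g + f), which after integration is
the classical KMS condition (`tendsto_inner_evolve_mul`).

The delicate point is that the bracket is well defined: an element A may have many integral
representations. The weak KMS condition turns ω({A, W(g)} W(k)) into a normal functional of A alone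
(`integral_symp_mul_genFun`). As Ω is cyclic and the algebra commutative, such moments determine an
element, so the bracket respects all linear relations (`sum_smul_op_bracket`). The Poisson laws are
then pointwise identities for σ under the integral sign. They are proved for integrals over
arbitrary parameter spaces (`Smearing`), where products and brackets are formed without coordinates.

That the bracket stays in the span rests on the spectral theorem: t ↦ ⟨g, e^{itH}f⟩ is a combination
of transforms of finite measures of compact support, and multiplying χ by it convolves the inverse
transform of χ with such measures (`bracketWeight_mem_fourierClass`). Analyticity comes from
expanding the translates of χ, density from approximate identities and von Neumann's theorem. -/

/-- A symmetric operator is bounded by `b` on vectors of exponential type `b`. -/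
theorem norm_apply_le_of_expType {E : Type*} [NormedAddCommGroup E] [InnerProductSpace ℂ E]
    (A : E →ₗ[ℂ] E) (hA : ∀ x y, ⟪A x, y⟫_ℂ = ⟪x, A y⟫_ℂ) {b C : ℝ} (hb : 0 ≤ b) (f : E)
    (hf : ∀ n : ℕ, ‖(A ^ n) f‖ ≤ C * b ^ n) : ‖A f‖ ≤ b * ‖f‖ := by
  have hC : ‖f‖ ≤ C := by simpa using hf 0
  rcases eq_or_ne f 0 with rfl | hf0
  · simp
  have hpos : 0 < ‖f‖ := norm_pos_iff.2 hf0
  have hsucc : ∀ n x, (A ^ (n + 1)) x = A ((A ^ n) x) := fun n x => by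
    rw [pow_succ']; rfl
  -- Log-convexity of the norms of the iterates, from symmetry and Cauchy–Schwarz. Hence their
  -- successive ratios increase from the first one, r = ‖A f‖/‖f‖, and growth at most bⁿ forces r ≤
  -- b.
  have hlc : ∀ n : ℕ, ‖(A ^ (n + 1)) f‖ ^ 2 ≤ ‖(A ^ n) f‖ * ‖(A ^ (n + 2)) f‖ := by
    intro n
    have h1 : ⟪(A ^ (n + 1)) f, (A ^ (n + 1)) f⟫_ℂ = ⟪(A ^ n) f, (A ^ (n + 2)) f⟫_ℂ := by
      rw [hsucc (n + 1), ← hA, hsucc n]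
    have h2 : ‖(A ^ (n + 1)) f‖ ^ 2 = ‖⟪(A ^ (n + 1)) f, (A ^ (n + 1)) f⟫_ℂ‖ := by
      rw [inner_self_eq_norm_sq_to_K]; simp
    rw [h2, h1]
    exact norm_inner_le_norm _ _
  have hstep : ∀ n : ℕ, ‖(A ^ n) f‖ * ‖A f‖ ≤ ‖(A ^ (n + 1)) f‖ * ‖f‖ := by
    intro n
    induction n with
    | zero => simp [mul_comm]
    | succ n ih =>
      by_cases h0 : ‖(A ^ (n + 1)) f‖ = 0
      · rw [h0]; simp; positivity
      have hp : 0 < ‖(A ^ (n + 1)) f‖ := lt_of_le_of_ne (norm_nonneg _) (Ne.symm h0)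
      have h3 := hlc n
      have hn : 0 < ‖(A ^ n) f‖ := by
        by_contra hneg
        have : ‖(A ^ n) f‖ = 0 := le_antisymm (not_lt.1 hneg) (norm_nonneg _)
        rw [this] at h3
        nlinarith
      have h4 : ‖(A ^ n) f‖ * (‖(A ^ (n + 1)) f‖ * ‖A f‖)
          ≤ ‖(A ^ n) f‖ * (‖(A ^ (n + 2)) f‖ * ‖f‖) := by
        calc _ = ‖(A ^ (n + 1)) f‖ * (‖(A ^ n) f‖ * ‖A f‖) := by ring
          _ ≤ ‖(A ^ (n + 1)) f‖ * (‖(A ^ (n + 1)) f‖ * ‖f‖) := by gcongr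
          _ = ‖(A ^ (n + 1)) f‖ ^ 2 * ‖f‖ := by ring
          _ ≤ (‖(A ^ n) f‖ * ‖(A ^ (n + 2)) f‖) * ‖f‖ := by gcongr
          _ = _ := by ring
      exact le_of_mul_le_mul_left h4 hn
  set r := ‖A f‖ / ‖f‖ with hr
  have hgrow : ∀ n : ℕ, ‖f‖ * r ^ n ≤ ‖(A ^ n) f‖ := by
    intro n
    induction n with
    | zero => simp
    | succ n ih =>
      have := hstep n
      calc ‖f‖ * r ^ (n + 1) = (‖f‖ * r ^ n) * r := by ring
        _ ≤ ‖(A ^ n) f‖ * r := by gcongr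
        _ = ‖(A ^ n) f‖ * ‖A f‖ / ‖f‖ := by rw [hr]; ring
        _ ≤ _ := by rw [div_le_iff₀ hpos]; exact this
  have hrb : r ≤ b := by
    by_contra hlt
    push Not at hlt
    rcases hb.eq_or_lt with hb0 | hb0
    · have h1 := (hgrow 1).trans (hf 1)
      rw [← hb0] at h1 hlt
      simp at h1
      have : 0 < ‖f‖ * r := by positivity
      linarith
    · have hq : 1 < r / b := by rw [lt_div_iff₀ hb0]; linarith
      obtain ⟨n, hn⟩ := pow_unbounded_of_one_lt (C / ‖f‖) hq
      have h1 := (hgrow n).trans (hf n)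
      rw [div_lt_iff₀ hpos, div_pow, div_mul_eq_mul_div, lt_div_iff₀ (by positivity)] at hn
      nlinarith
  rw [hr, div_le_iff₀ hpos] at hrb
  exact hrb

/-- A symmetric operator agrees on the vectors of exponential type `b` with a bounded self-adjoint
operator. -/
theorem exists_bounded_selfAdjoint [CompleteSpace 𝓗] (D : Submodule ℂ 𝓗) (A : D →ₗ[ℂ] D)
    (hA : ∀ x y, ⟪A x, y⟫_ℂ = ⟪x, A y⟫_ℂ) {b : ℝ} (hb : 0 ≤ b) :
    ∃ T : 𝓗 →L[ℂ] 𝓗, IsSelfAdjoint T ∧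
      ∀ f : D, (∃ C : ℝ, ∀ n : ℕ, ‖(A ^ n) f‖ ≤ C * b ^ n) → (A f : 𝓗) = T f := by
  -- The vectors of type `b` form an `A`-invariant subspace on which `A` has norm at most `b`. So
  -- `A` extends to the closure of that subspace, and composing with the orthogonal projection
  -- extends it by zero to the complement.
  let S : Submodule ℂ D :=
    { carrier := {f | ∃ C : ℝ, ∀ n : ℕ, ‖(A ^ n) f‖ ≤ C * b ^ n}
      add_mem' := by
        rintro f g ⟨C, hC⟩ ⟨C', hC'⟩
        refine ⟨C + C', fun n => ?_⟩
        rw [map_add, add_mul]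
        exact (norm_add_le _ _).trans (add_le_add (hC n) (hC' n))
      zero_mem' := ⟨0, fun n => by simp⟩
      smul_mem' := by
        rintro c f ⟨C, hC⟩
        refine ⟨‖c‖ * C, fun n => ?_⟩
        rw [map_smul, norm_smul, mul_assoc]
        exact mul_le_mul_of_nonneg_left (hC n) (norm_nonneg _) }
  have hAS : ∀ f ∈ S, A f ∈ S := by
    rintro f ⟨C, hC⟩
    refine ⟨C * b, fun n => ?_⟩
    have : (A ^ n) (A f) = (A ^ (n + 1)) f := by rw [pow_succ]; rfl
    rw [this]
    refine (hC (n + 1)).trans (le_of_eq ?_)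
    ring
  let S' : Submodule ℂ 𝓗 := S.map D.subtype
  let E : Submodule ℂ 𝓗 := S'.topologicalClosure
  have hE : IsClosed (E : Set 𝓗) := S'.isClosed_topologicalClosure
  have : CompleteSpace E := hE.completeSpace_coe
  have hmem : ∀ f : S, ((f : D) : 𝓗) ∈ E := fun f =>
    S'.le_topologicalClosure ⟨f, f.2, rfl⟩
  let e : S →ₗ[ℂ] E := (D.subtype ∘ₗ S.subtype).codRestrict E hmem
  let a : S →ₗ[ℂ] E := ((D.subtype ∘ₗ A) ∘ₗ S.subtype).codRestrict E
    (fun f => hmem ⟨A f, hAS f f.2⟩)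
  have hdense : DenseRange e := by
    intro x
    rw [Metric.mem_closure_iff]
    intro ε hε
    have hx : (x : 𝓗) ∈ closure (S' : Set 𝓗) := x.2
    obtain ⟨y, ⟨f, hf, rfl⟩, hy⟩ := Metric.mem_closure_iff.1 hx ε hε
    exact ⟨e ⟨f, hf⟩, ⟨_, rfl⟩, hy⟩
  have hbound : ∃ C, ∀ x, ‖a x‖ ≤ C * ‖e x‖ := by
    refine ⟨b, fun x => ?_⟩
    obtain ⟨C, hC⟩ := x.2
    exact norm_apply_le_of_expType A hA hb _ hC
  let T₀ : E →L[ℂ] E := a.extendOfNorm e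
  have hT₀ : ∀ f, T₀ (e f) = a f := fun f => LinearMap.extendOfNorm_eq hdense hbound f
  have hsym : ∀ x y : E, ⟪T₀ x, y⟫_ℂ = ⟪x, T₀ y⟫_ℂ := by
    intro x y
    refine hdense.induction_on (p := fun x => ⟪T₀ x, y⟫_ℂ = ⟪x, T₀ y⟫_ℂ) x
      (isClosed_eq (by fun_prop) (by fun_prop)) fun f => ?_
    refine hdense.induction_on (p := fun y => ⟪T₀ (e f), y⟫_ℂ = ⟪e f, T₀ y⟫_ℂ) y
      (isClosed_eq (by fun_prop) (by fun_prop)) fun g => ?_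
    rw [hT₀, hT₀]
    exact hA f g
  refine ⟨E.subtypeL ∘L T₀ ∘L E.orthogonalProjectionOnto, ?_, ?_⟩
  · rw [ContinuousLinearMap.isSelfAdjoint_iff_isSymmetric]
    intro x y
    change ⟪((T₀ (E.orthogonalProjectionOnto x) : E) : 𝓗), y⟫_ℂ =
      ⟪x, ((T₀ (E.orthogonalProjectionOnto y) : E) : 𝓗)⟫_ℂ
    rw [← Submodule.inner_orthogonalProjectionOnto_eq_of_mem_left,
      ← Submodule.inner_orthogonalProjectionOnto_eq_of_mem_right]
    exact hsym _ _
  · intro f hf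
    have h1 : E.orthogonalProjectionOnto (f : 𝓗) = e ⟨f, hf⟩ :=
      Submodule.orthogonalProjectionOnto_mem_subspace_eq_self (K := E) (e ⟨f, hf⟩)
    change _ = ((T₀ (E.orthogonalProjectionOnto (f : 𝓗)) : E) : 𝓗)
    rw [h1, hT₀]
    rfl

end BoundedModel

/-! ### The one-particle flow on the test space. -/

section OneParticleFlow

variable {𝓗 : Type u} [NormedAddCommGroup 𝓗] [InnerProductSpace ℂ 𝓗]
  {H : 𝓗 →ₗ.[ℂ] 𝓗} {D : Submodule ℂ 𝓗}

/-- `H` as a linear map of the test space into itself. -/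
def IsTestSpace.op (hD : IsTestSpace H D) : D →ₗ[ℂ] D where
  toFun f := ⟨opApply H f, hD.map_mem f f.2⟩
  map_add' f g := by
    ext
    have hf := hD.le_domain f.2
    have hg := hD.le_domain g.2
    have hfg := H.domain.add_mem hf hg
    simp only [opApply, Submodule.coe_add, hf, hg, hfg, dif_pos]
    exact H.map_add ⟨f, hf⟩ ⟨g, hg⟩
  map_smul' c f := by
    ext
    have hf := hD.le_domain f.2
    have hcf := H.domain.smul_mem c hf
    simp only [opApply, Submodule.coe_smul, hf, hcf, dif_pos, RingHom.id_apply]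
    exact H.map_smul c ⟨f, hf⟩

theorem IsTestSpace.iH_eq (hD : IsTestSpace H D) (f : D) : hD.iH f = Complex.I • hD.op f := rfl

theorem IsTestSpace.coe_op_pow (hD : IsTestSpace H D) (n : ℕ) (f : D) :
    ((hD.op ^ n) f : 𝓗) = (opApply H)^[n] f := by
  induction n with
  | zero => rfl
  | succ n ih =>
    rw [pow_succ', Function.iterate_succ_apply', ← ih]; rfl

theorem IsTestSpace.op_symm [CompleteSpace 𝓗] (hD : IsTestSpace H D) (hsa : IsSelfAdjoint H)
    (f g : D) : ⟪hD.op f, g⟫_ℂ = ⟪f, hD.op g⟫_ℂ := by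
  have hf := hD.le_domain f.2
  have hg := hD.le_domain g.2
  have h := LinearPMap.adjoint_isFormalAdjoint hsa.dense_domain
  rw [LinearPMap.isSelfAdjoint_def.1 hsa] at h
  have := h ⟨f, hf⟩ ⟨g, hg⟩
  change ⟪opApply H f, (g : 𝓗)⟫_ℂ = ⟪(f : 𝓗), opApply H g⟫_ℂ
  simp only [opApply, hf, hg, dif_pos]
  exact this

/-- On finitely many test vectors `H` acts like a bounded self-adjoint operator. -/
theorem IsTestSpace.exists_model [CompleteSpace 𝓗] (hD : IsTestSpace H D)
    (hsa : IsSelfAdjoint H) (s : Finset D) :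
    ∃ T : 𝓗 →L[ℂ] 𝓗, IsSelfAdjoint T ∧
      ∀ f ∈ s, ∀ n : ℕ, (opApply H)^[n] (f : 𝓗) = (T ^ n) (f : 𝓗) := by
  choose C b hCb using fun f : D => hD.expType f f.2
  -- A common exponential type for the finitely many vectors; it dominates each |b f|.
  set B : ℝ := ∑ f ∈ s, |b f| with hB
  have hB0 : 0 ≤ B := Finset.sum_nonneg fun _ _ => abs_nonneg _
  obtain ⟨T, hT, hTA⟩ := exists_bounded_selfAdjoint D hD.op (hD.op_symm hsa) hB0
  refine ⟨T, hT, fun f hf => ?_⟩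
  have hbd : ∀ n : ℕ, ‖(hD.op ^ n) f‖ ≤ |C f| * B ^ n := by
    intro n
    have h1 : ‖(hD.op ^ n) f‖ ≤ C f * b f ^ n := by
      rw [← Submodule.norm_coe, hD.coe_op_pow]
      exact hCb f n
    refine h1.trans ((le_abs_self _).trans ?_)
    rw [abs_mul, abs_pow]
    have := Finset.single_le_sum (f := fun f => |b f|) (fun _ _ => abs_nonneg _) hf
    gcongr
  intro n
  rw [← hD.coe_op_pow]
  induction n with
  | zero => rfl
  | succ n ih =>
    have h2 : ((hD.op ^ (n + 1)) f : 𝓗) = (hD.op ((hD.op ^ n) f) : 𝓗) := by rw [pow_succ']; rfl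
    rw [h2, hTA _ ⟨|C f| * B ^ n, fun m => ?_⟩, ih, pow_succ']
    · rfl
    · have h3 : (hD.op ^ m) ((hD.op ^ n) f) = (hD.op ^ (n + m)) f := by
        rw [add_comm, pow_add]; rfl
      rw [h3, mul_assoc, ← pow_add]
      exact hbd _

/-- `e^{itT}` for a bounded operator `T`. -/
def flow (T : 𝓗 →L[ℂ] 𝓗) (t : ℝ) : 𝓗 →L[ℂ] 𝓗 := NormedSpace.exp (((t : ℂ) * Complex.I) • T)

theorem flow_zero (T : 𝓗 →L[ℂ] 𝓗) : flow T 0 = 1 := by simp [flow]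

variable [CompleteSpace 𝓗]

theorem hasSum_flow (T : 𝓗 →L[ℂ] 𝓗) (t : ℝ) (f : 𝓗) :
    HasSum (fun n : ℕ => (((t : ℂ) * Complex.I) ^ n / (n.factorial : ℂ)) • (T ^ n) f)
      (flow T t f) := by
  have h := NormedSpace.exp_series_hasSum_exp' (𝕂 := ℂ) (((t : ℂ) * Complex.I) • T)
  have h2 := (ContinuousLinearMap.apply ℂ 𝓗 f).hasSum h
  have h3 : HasSum _ (flow T t f) := h2
  convert h3 using 2 with n
  simp [smul_pow, smul_smul, div_eq_mul_inv, mul_comm]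

theorem flow_add (T : 𝓗 →L[ℂ] 𝓗) (s t : ℝ) : flow T (s + t) = flow T s * flow T t := by
  let _ : NormedAlgebra ℚ (𝓗 →L[ℂ] 𝓗) := NormedAlgebra.restrictScalars ℚ ℂ _
  rw [flow, flow, flow, ← NormedSpace.exp_add_of_commute]
  · congr 1
    push_cast
    module
  · exact ((Commute.refl T).smul_left _).smul_right _

theorem inner_flow {T : 𝓗 →L[ℂ] 𝓗} (hT : IsSelfAdjoint T) (t : ℝ) (f g : 𝓗) :
    ⟪flow T t f, flow T t g⟫_ℂ = ⟪f, g⟫_ℂ := by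
  have hstar : star (flow T t) = flow T (-t) := by
    rw [flow, flow, NormedSpace.star_exp, star_smul, hT.star_eq]
    simp
  rw [← ContinuousLinearMap.adjoint_inner_right, ← ContinuousLinearMap.star_eq_adjoint, hstar,
    ← mul_apply_eq_comp, ← flow_add, neg_add_cancel, flow_zero]
  rfl

theorem hasDerivAt_flow (T : 𝓗 →L[ℂ] 𝓗) (t : ℝ) (f : 𝓗) :
    HasDerivAt (fun t => flow T t f) (Complex.I • T (flow T t f)) t := by
  have h := hasDerivAt_exp_smul_const' (𝕂 := ℝ) (Complex.I • T) t
  have h2 := ((ContinuousLinearMap.apply ℂ 𝓗 f).restrictScalars ℝ).hasFDerivAt.comp_hasDerivAt t h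
  have e : ∀ t : ℝ, flow T t = NormedSpace.exp (t • (Complex.I • T)) := by
    intro t
    rw [flow, mul_smul]
    rfl
  simp only [e]
  exact h2

theorem expI_eq_flow {T : 𝓗 →L[ℂ] 𝓗} {f : 𝓗} (hf : ∀ n : ℕ, (opApply H)^[n] f = (T ^ n) f)
    (t : ℝ) : expI H t f = flow T t f := by
  rw [expI, ← (hasSum_flow T t f).tsum_eq]
  exact tsum_congr fun n => by rw [hf]

namespace IsTestSpace

variable (hD : IsTestSpace H D) (hsa : IsSelfAdjoint H)
include hsa

theorem evol_zero (f : D) : hD.evol 0 f = f := by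
  classical
  obtain ⟨T, hT, h⟩ := hD.exists_model hsa {f}
  ext
  change expI H 0 f = f
  rw [expI_eq_flow (h f (by simp)), flow_zero]
  rfl

theorem evol_add_time (s t : ℝ) (f : D) : hD.evol (s + t) f = hD.evol s (hD.evol t f) := by
  classical
  -- The outer exponential series is taken at e^{itH}f, so this vector must be covered by the same
  -- model; being a test vector it has an exponential type of its own.
  obtain ⟨T, hT, h⟩ := hD.exists_model hsa {f, hD.evol t f}
  ext
  change expI H (s + t) f = expI H s (hD.evol t f : 𝓗)
  rw [expI_eq_flow (h f (by simp)), expI_eq_flow (h (hD.evol t f) (by simp)), flow_add]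
  change _ = flow T s (expI H t f)
  rw [expI_eq_flow (h f (by simp))]
  rfl

theorem evol_add (t : ℝ) (f g : D) : hD.evol t (f + g) = hD.evol t f + hD.evol t g := by
  classical
  obtain ⟨T, hT, h⟩ := hD.exists_model hsa {f, g, f + g}
  ext
  change expI H t (f + g : D) = expI H t f + expI H t g
  rw [expI_eq_flow (h f (by simp)), expI_eq_flow (h g (by simp)),
    expI_eq_flow (h (f + g) (by simp))]
  exact map_add _ _ _

theorem evol_smul (t : ℝ) (c : ℂ) (f : D) : hD.evol t (c • f) = c • hD.evol t f := by
  classical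
  obtain ⟨T, hT, h⟩ := hD.exists_model hsa {f, c • f}
  ext
  change expI H t (c • f : D) = c • expI H t f
  rw [expI_eq_flow (h f (by simp)), expI_eq_flow (h (c • f) (by simp))]
  exact map_smul _ _ _

theorem inner_evol (t : ℝ) (f g : D) : ⟪hD.evol t f, hD.evol t g⟫_ℂ = ⟪f, g⟫_ℂ := by
  classical
  obtain ⟨T, hT, h⟩ := hD.exists_model hsa {f, g}
  change ⟪expI H t f, expI H t g⟫_ℂ = ⟪(f : 𝓗), (g : 𝓗)⟫_ℂ
  rw [expI_eq_flow (h f (by simp)), expI_eq_flow (h g (by simp)), inner_flow hT]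

theorem norm_evol (t : ℝ) (f : D) : ‖hD.evol t f‖ = ‖f‖ := by
  rw [@norm_eq_sqrt_re_inner ℂ, hD.inner_evol hsa, ← @norm_eq_sqrt_re_inner ℂ]

theorem continuous_evol (f : D) : Continuous fun t => hD.evol t f := by
  classical
  obtain ⟨T, hT, h⟩ := hD.exists_model hsa {f}
  refine Continuous.subtype_mk ?_ _
  simp only [fun t => expI_eq_flow (h f (by simp)) t]
  exact continuous_iff_continuousAt.2 fun t => (hasDerivAt_flow T t f).continuousAt

omit hsa in
/-- The time integral `∫₀ᵗ e^{isH} f ds` as a vector of the test space. -/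
def timeIntegral (t : ℝ) (f : D) : D := ⟨∫ s in (0 : ℝ)..t, expI H s f, hD.integral_mem t f f.2⟩

/-- Increments of orbits lie in the range of iH on the test space, which are exactly the directions
controlled by the weak KMS condition. The reason is the fundamental theorem of calculus for the
bounded model. -/
theorem iH_timeIntegral (t : ℝ) (f : D) :
    hD.iH (hD.timeIntegral t f) = hD.evol t f - f := by
  classical
  obtain ⟨T, hT, h⟩ := hD.exists_model hsa {f, hD.timeIntegral t f}
  ext
  change Complex.I • opApply H (hD.timeIntegral t f : 𝓗) = expI H t f - f
  have h1 := h (hD.timeIntegral t f) (by simp) 1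
  simp only [Function.iterate_one, pow_one] at h1
  rw [h1]
  change Complex.I • T (∫ s in (0 : ℝ)..t, expI H s f) = _
  simp only [fun t => expI_eq_flow (h f (by simp)) t]
  have hc : Continuous fun t => flow T t (f : 𝓗) :=
    continuous_iff_continuousAt.2 fun t => (hasDerivAt_flow T t f).continuousAt
  rw [← ContinuousLinearMap.intervalIntegral_comp_comm _ (hc.intervalIntegrable _ _),
    ← intervalIntegral.integral_smul,
    intervalIntegral.integral_eq_sub_of_hasDerivAt (f := fun t => flow T t (f : 𝓗))
      (fun s _ => hasDerivAt_flow T s f)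
      (Continuous.intervalIntegrable (by fun_prop) _ _), flow_zero]
  rfl

theorem norm_timeIntegral_le (t : ℝ) (f : D) : ‖hD.timeIntegral t f‖ ≤ |t| * ‖f‖ := by
  have := intervalIntegral.norm_integral_le_of_norm_le_const (a := 0) (b := t) (C := ‖f‖)
    (f := fun s => expI H s f) (fun s _ => (hD.norm_evol hsa s f).le)
  rw [sub_zero, mul_comm] at this
  exact this

/-- The bound does not involve the size of H on `f`: the increment is a difference of two vectors of
norm ‖f‖. -/
theorem norm_iH_timeIntegral_le (t : ℝ) (f : D) : ‖hD.iH (hD.timeIntegral t f)‖ ≤ 2 * ‖f‖ := by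
  rw [hD.iH_timeIntegral hsa, two_mul]
  exact (norm_sub_le _ _).trans (by rw [hD.norm_evol hsa])

end IsTestSpace

end OneParticleFlow

/-! ### Spectral measures of bounded self-adjoint operators. -/

section Spectral
variable {𝓗 : Type u} [NormedAddCommGroup 𝓗] [InnerProductSpace ℂ 𝓗] [CompleteSpace 𝓗]
open scoped CompactlySupported

/-- The positive functional `u ↦ ⟨f, u(T) f⟩` on the continuous functions on the spectrum. -/
def spectralFunctional {T : 𝓗 →L[ℂ] 𝓗} (hT : IsSelfAdjoint T) (f : 𝓗) :
    C_c(spectrum ℝ T, ℝ) →ₚ[ℝ] ℝ :=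
  PositiveLinearMap.mk₀
    { toFun := fun u => (⟪f, cfcHom (R := ℝ) hT u.toContinuousMap f⟫_ℂ).re
      map_add' := fun u v => by
        have : (u + v).toContinuousMap = u.toContinuousMap + v.toContinuousMap := rfl
        rw [this, map_add]
        simp
      map_smul' := fun c u => by
        have : (c • u).toContinuousMap = c • u.toContinuousMap := rfl
        rw [this, map_smul]
        simp [inner_smul_right_eq_smul] }
    (fun u hu => by
      change 0 ≤ (⟪f, cfcHom (R := ℝ) hT u.toContinuousMap f⟫_ℂ).re
      -- Positivity: a nonnegative u is v²; then ⟨f, u(T) f⟩ = ‖v(T) f‖².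
      let v : C(spectrum ℝ T, ℝ) := ⟨fun x => Real.sqrt (u x), by fun_prop⟩
      have huv : u.toContinuousMap = star v * v := by
        ext x
        exact (Real.mul_self_sqrt (hu x)).symm
      rw [huv, map_mul, map_star, ContinuousLinearMap.star_eq_adjoint, mul_apply_eq_comp,
        ContinuousLinearMap.adjoint_inner_right]
      exact inner_self_nonneg (𝕜 := ℂ))

/-- The spectral measure of a bounded self-adjoint operator in a vector state. -/
theorem exists_spectral_measure {T : 𝓗 →L[ℂ] 𝓗} (hT : IsSelfAdjoint T) (f : 𝓗) :
    ∃ μ : Measure ℝ, IsFiniteMeasure μ ∧ (∃ R : ℝ, ∀ᵐ x ∂μ, |x| ≤ R) ∧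
      ∀ n : ℕ, ⟪f, (T ^ n) f⟫_ℂ = ∫ x, (x : ℂ) ^ n ∂μ := by
  -- The measure is supplied by the Riesz–Markov–Kakutani theorem on the compact spectrum, then
  -- pushed forward to ℝ.
  let Λ := spectralFunctional hT f
  let ν := RealRMK.rieszMeasure Λ
  have hν : IsFiniteMeasure ν := inferInstance
  refine ⟨ν.map Subtype.val, inferInstance, ⟨‖T‖ * ‖(1 : 𝓗 →L[ℂ] 𝓗)‖, ?_⟩, fun n => ?_⟩
  · rw [ae_map_iff (by fun_prop) (measurableSet_le (by fun_prop) (by fun_prop))]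
    exact ae_of_all _ fun x => spectrum.norm_le_norm_mul_of_mem x.2
  · rw [integral_map (by fun_prop) (by fun_prop)]
    let u : C_c(spectrum ℝ T, ℝ) := ⟨((ContinuousMap.id ℝ).restrict (spectrum ℝ T)) ^ n,
      HasCompactSupport.of_compactSpace _⟩
    have h1 := RealRMK.integral_rieszMeasure Λ u
    have h2 : Λ u = (⟪f, (T ^ n) f⟫_ℂ).re := by
      change (⟪f, cfcHom (R := ℝ) hT (((ContinuousMap.id ℝ).restrict (spectrum ℝ T)) ^ n) f⟫_ℂ).re = _
      rw [map_pow, cfcHom_id]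
    have h3 : (⟪f, (T ^ n) f⟫_ℂ).im = 0 := by
      have := (ContinuousLinearMap.isSelfAdjoint_iff_isSymmetric.1 (hT.pow n))
      exact this.im_inner_self_apply f
    have h4 : (∫ x : spectrum ℝ T, ((x : ℝ) : ℂ) ^ n ∂ν) = ((∫ x, u x ∂ν : ℝ) : ℂ) := by
      rw [← integral_complex_ofReal]
      congr 1
      ext x
      have hu : u x = (x : ℝ) ^ n := rfl
      rw [hu]
      push_cast
      rfl
    rw [h4, h1, h2]
    exact Complex.ext (by simp) (by simpa using h3)

theorem hasSum_cexp (z : ℂ) : HasSum (fun n : ℕ => z ^ n / (n.factorial : ℂ)) (Complex.exp z) := by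
  rw [Complex.exp_eq_exp_ℂ]
  exact NormedSpace.expSeries_div_hasSum_exp z

/-- Both sides are expanded in powers of s and compared moment by moment; the bounded support gives
the dominating series (|s| R)ⁿ/n!, which permits summing under the integral. -/
theorem inner_flow_eq_integral {T : 𝓗 →L[ℂ] 𝓗} {f : 𝓗} {μ : Measure ℝ} [IsFiniteMeasure μ]
    {R : ℝ} (hR : ∀ᵐ x ∂μ, |x| ≤ R) (hμ : ∀ n : ℕ, ⟪f, (T ^ n) f⟫_ℂ = ∫ x, (x : ℂ) ^ n ∂μ)
    (s : ℝ) : ⟪f, flow T s f⟫_ℂ = ∫ x : ℝ, Complex.exp ((s * x : ℝ) * Complex.I) ∂μ := by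
  have h1 : HasSum (fun n : ℕ => ⟪f, (((s : ℂ) * Complex.I) ^ n / (n.factorial : ℂ)) • (T ^ n) f⟫_ℂ)
      ⟪f, flow T s f⟫_ℂ := by
    simpa only [innerSL_apply_apply] using (hasSum_flow T s f).mapL (innerSL ℂ f)
  have hbd : ∀ n : ℕ, ∀ᵐ x : ℝ ∂μ, ‖(((s * x : ℝ) : ℂ) * Complex.I) ^ n / (n.factorial : ℂ)‖ ≤
      (|s| * R) ^ n / n.factorial := by
    intro n
    filter_upwards [hR] with x hx
    simp only [norm_div, norm_pow, norm_mul, Complex.norm_I, mul_one, Complex.norm_natCast,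
      Complex.norm_real, Real.norm_eq_abs]

    gcongr
  have hmeas : ∀ n : ℕ, AEStronglyMeasurable
      (fun x : ℝ => (((s * x : ℝ) : ℂ) * Complex.I) ^ n / (n.factorial : ℂ)) μ := fun n =>
    Continuous.aestronglyMeasurable (by fun_prop)
  have hsum : ∀ᵐ x : ℝ ∂μ, Summable fun n : ℕ => (|s| * R) ^ n / (n.factorial : ℝ) :=
    ae_of_all _ fun _ => Real.summable_pow_div_factorial _
  have hint : Integrable (fun _ : ℝ => ∑' n : ℕ, (|s| * R) ^ n / (n.factorial : ℝ)) μ :=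
    integrable_const _
  have hlim : ∀ᵐ x : ℝ ∂μ, HasSum
      (fun n : ℕ => (((s * x : ℝ) : ℂ) * Complex.I) ^ n / (n.factorial : ℂ))
      (Complex.exp ((s * x : ℝ) * Complex.I)) := ae_of_all _ fun x => hasSum_cexp _
  have h2 := hasSum_integral_of_dominated_convergence
    (F := fun (n : ℕ) (x : ℝ) => (((s * x : ℝ) : ℂ) * Complex.I) ^ n / (n.factorial : ℂ))
    (f := fun x : ℝ => Complex.exp ((s * x : ℝ) * Complex.I))
    (bound := fun (n : ℕ) (_ : ℝ) => (|s| * R) ^ n / (n.factorial : ℝ)) hmeas hbd hsum hint hlim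
  have h3 : (fun n : ℕ => ⟪f, (((s : ℂ) * Complex.I) ^ n / (n.factorial : ℂ)) • (T ^ n) f⟫_ℂ) =
      fun n => ∫ x : ℝ, (((s * x : ℝ) : ℂ) * Complex.I) ^ n / (n.factorial : ℂ) ∂μ := by
    ext n
    rw [inner_smul_right, hμ, ← integral_const_mul]
    refine integral_congr_ae (ae_of_all _ fun x => ?_)
    push_cast
    ring
  rw [h3] at h1
  exact h1.unique h2

end Spectral

/-! ### Fourier transforms of test functions: products, scaling, L¹ bounds. -/

section FourierClass

/-- The Fourier transforms of complex test functions on `ℝⁿ`. -/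
def fourierClass (n : ℕ) : Submodule ℂ (EuclideanSpace ℝ (Fin n) → ℂ) where
  carrier := {χ | ∃ ψ : EuclideanSpace ℝ (Fin n) → ℂ, ContDiff ℝ (⊤ : ℕ∞) ψ ∧
    HasCompactSupport ψ ∧ χ = 𝓕 ψ}
  add_mem' := by
    rintro _ _ ⟨ψ, h1, h2, rfl⟩ ⟨ψ', h1', h2', rfl⟩
    refine ⟨ψ + ψ', h1.add h1', h2.add h2', ?_⟩
    exact (VectorFourier.fourierIntegral_add Real.continuous_fourierChar
      (by exact continuous_inner) (h1.continuous.integrable_of_hasCompactSupport h2)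
      (h1'.continuous.integrable_of_hasCompactSupport h2')).symm
  zero_mem' := ⟨0, contDiff_const, HasCompactSupport.zero, by
    ext t
    simp [Real.fourier_eq]⟩
  smul_mem' := by
    rintro c _ ⟨ψ, h1, h2, rfl⟩
    refine ⟨c • ψ, h1.const_smul c, h2.smul_left (f := fun _ => c), ?_⟩
    exact (VectorFourier.fourierIntegral_const_smul _ _ _ _ _).symm

variable {n m : ℕ}

theorem continuous_of_mem_fourierClass {χ : EuclideanSpace ℝ (Fin n) → ℂ}
    (h : χ ∈ fourierClass n) : Continuous χ := by
  obtain ⟨ψ, h1, h2, rfl⟩ := h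
  exact (𝓕 (h2.toSchwartzMap h1)).continuous

theorem integrable_of_mem_fourierClass {χ : EuclideanSpace ℝ (Fin n) → ℂ}
    (h : χ ∈ fourierClass n) : Integrable χ := by
  obtain ⟨ψ, h1, h2, rfl⟩ := h
  exact (𝓕 (h2.toSchwartzMap h1)).integrable

/-- Conjugating a transform amounts to replacing ψ(x) by the conjugate of ψ(−x). -/
theorem conj_mem_fourierClass {χ : EuclideanSpace ℝ (Fin n) → ℂ} (h : χ ∈ fourierClass n) :
    (fun t => starRingEnd ℂ (χ t)) ∈ fourierClass n := by
  obtain ⟨ψ, h1, h2, rfl⟩ := h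
  refine ⟨fun x => starRingEnd ℂ (ψ (-x)), ?_, ?_, ?_⟩
  · exact Complex.conjCLE.contDiff.comp (h1.comp contDiff_neg)
  · have := (h2.comp_homeomorph (Homeomorph.neg _)).comp_left (g := starRingEnd ℂ) (map_zero _)
    exact this
  · ext t
    rw [Real.fourier_eq', Real.fourier_eq', ← integral_conj, ← integral_neg_eq_self]
    refine integral_congr_ae (ae_of_all _ fun x => ?_)
    simp [← Complex.exp_conj, map_ofNat]

theorem mem_smearClass_iff {χ : EuclideanSpace ℝ (Fin n) → ℝ} :
    χ ∈ smearClass n ↔ (fun t => (χ t : ℂ)) ∈ fourierClass n := by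
  constructor
  · rintro ⟨ψ, h1, h2, h3⟩
    exact ⟨ψ, h1, h2, funext h3⟩
  · rintro ⟨ψ, h1, h2, h3⟩
    exact ⟨ψ, h1, h2, congrFun h3⟩

theorem re_mem_smearClass {χ : EuclideanSpace ℝ (Fin n) → ℂ} (h : χ ∈ fourierClass n) :
    (fun t => (χ t).re) ∈ smearClass n := by
  rw [mem_smearClass_iff]
  convert (fourierClass n).smul_mem (1 / 2 : ℂ)
    ((fourierClass n).add_mem h (conj_mem_fourierClass h)) using 1
  ext t
  rw [Complex.re_eq_add_conj]
  simp
  ring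

theorem im_mem_smearClass {χ : EuclideanSpace ℝ (Fin n) → ℂ} (h : χ ∈ fourierClass n) :
    (fun t => (χ t).im) ∈ smearClass n := by
  rw [mem_smearClass_iff]
  convert (fourierClass n).smul_mem (1 / (2 * Complex.I) : ℂ)
    ((fourierClass n).sub_mem h (conj_mem_fourierClass h)) using 1
  ext t
  rw [Complex.im_eq_sub_conj]
  simp
  field_simp
  rw [Complex.I_sq]
  ring

/-- The splitting `ℝⁿ⁺ᵐ = ℝⁿ × ℝᵐ`. -/
def splitEquiv (n m : ℕ) : EuclideanSpace ℝ (Fin (n + m)) ≃L[ℝ]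
    EuclideanSpace ℝ (Fin n) × EuclideanSpace ℝ (Fin m) := EuclideanSpace.finAddEquivProd

theorem inner_splitEquiv (x y : EuclideanSpace ℝ (Fin (n + m))) :
    inner ℝ x y = inner ℝ (splitEquiv n m x).1 (splitEquiv n m y).1 +
      inner ℝ (splitEquiv n m x).2 (splitEquiv n m y).2 := by
  simp only [PiLp.inner_apply, Fin.sum_univ_add]
  rfl

theorem splitEquiv_fst (x : EuclideanSpace ℝ (Fin (n + m))) (i : Fin n) :
    (splitEquiv n m x).1 i = x (Fin.castAdd m i) := rfl

theorem splitEquiv_snd (x : EuclideanSpace ℝ (Fin (n + m))) (i : Fin m) :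
    (splitEquiv n m x).2 i = x (Fin.natAdd n i) := rfl

/-- The splitting is an isometry onto the ℓ²-product, and that product carries the product measure.
-/
theorem measurePreserving_splitEquiv : MeasurePreserving (splitEquiv n m) := by
  let e : EuclideanSpace ℝ (Fin (n + m)) ≃ₗᵢ[ℝ]
      WithLp 2 (EuclideanSpace ℝ (Fin n) × EuclideanSpace ℝ (Fin m)) :=
    LinearEquiv.isometryOfInner
      ((splitEquiv n m).toLinearEquiv.trans (WithLp.linearEquiv 2 ℝ _).symm) fun x y =>
        (inner_splitEquiv x y).symm
  exact (WithLp.volume_preserving_ofLp _ _).comp e.measurePreserving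

theorem integral_splitEquiv {F : Type*} [NormedAddCommGroup F] [NormedSpace ℝ F]
    (u : EuclideanSpace ℝ (Fin n) × EuclideanSpace ℝ (Fin m) → F) :
    ∫ x, u (splitEquiv n m x) = ∫ y, u y :=
  measurePreserving_splitEquiv.integral_comp
    (splitEquiv n m).toHomeomorph.measurableEmbedding u

theorem prod_mem_fourierClass {χ₁ : EuclideanSpace ℝ (Fin n) → ℂ}
    {χ₂ : EuclideanSpace ℝ (Fin m) → ℂ} (h : χ₁ ∈ fourierClass n) (h' : χ₂ ∈ fourierClass m) :
    (fun x => χ₁ (splitEquiv n m x).1 * χ₂ (splitEquiv n m x).2) ∈ fourierClass (n + m) := by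
  obtain ⟨ψ, h1, h2, rfl⟩ := h
  obtain ⟨ψ', h1', h2', rfl⟩ := h'
  refine ⟨fun x => ψ (splitEquiv n m x).1 * ψ' (splitEquiv n m x).2, ?_, ?_, ?_⟩
  · exact (h1.comp (contDiff_fst.comp (splitEquiv n m).contDiff)).mul
      (h1'.comp (contDiff_snd.comp (splitEquiv n m).contDiff))
  · have hK : IsCompact ((splitEquiv n m) ⁻¹' (tsupport ψ ×ˢ tsupport ψ')) :=
      (splitEquiv n m).toHomeomorph.isCompact_preimage.2 (h2.isCompact.prod h2'.isCompact)
    refine HasCompactSupport.intro hK fun x hx => ?_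
    by_contra hne
    exact hx ⟨subset_tsupport _ (left_ne_zero_of_mul hne),
      subset_tsupport _ (right_ne_zero_of_mul hne)⟩
  · ext t
    rw [Real.fourier_eq', Real.fourier_eq', Real.fourier_eq', ← integral_prod_mul,
      ← Measure.volume_eq_prod, ← integral_splitEquiv]
    refine integral_congr_ae (ae_of_all _ fun x => ?_)
    simp only [inner_splitEquiv x t, smul_eq_mul]
    rw [mul_mul_mul_comm, ← Complex.exp_add]
    congr 2
    push_cast
    ring

/-- Multiplying 𝓕ψ by the characteristic function of `μ` convolves ψ with the image of `μ` on a
line. As `μ` has bounded support, the convolution is again smooth with compact support. -/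
theorem mul_charFun_mem_fourierClass {χ : EuclideanSpace ℝ (Fin n) → ℂ}
    (h : χ ∈ fourierClass n) (c : EuclideanSpace ℝ (Fin n)) {μ : Measure ℝ} [IsFiniteMeasure μ]
    {R : ℝ} (hR : ∀ᵐ x ∂μ, |x| ≤ R) :
    (fun t => χ t * ∫ x : ℝ, Complex.exp ((inner ℝ c t * x : ℝ) * Complex.I) ∂μ) ∈
      fourierClass n := by
  obtain ⟨ψ, h1, h2, rfl⟩ := h
  -- The factor converts e^{i⟨c,t⟩x} into the kernel e^{−2πi⟨xv,t⟩} of the Fourier transform.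
  set v : EuclideanSpace ℝ (Fin n) := (-(1 / (2 * Real.pi))) • c with hv
  let ν : Measure (EuclideanSpace ℝ (Fin n)) := μ.map fun x => x • v
  have hvm : Measurable fun x : ℝ => x • v := by fun_prop
  have hν : IsFiniteMeasure ν := inferInstance
  let one : EuclideanSpace ℝ (Fin n) → ℂ := fun _ => 1
  have hone : Integrable one ν := integrable_const _
  have hψint : Integrable ψ := h1.continuous.integrable_of_hasCompactSupport h2
  have hconv : ∀ x, convolution one ψ (ContinuousLinearMap.mul ℝ ℂ) ν x =
      ∫ s, ψ (x - s) ∂ν := fun x => by simp [convolution_def, one]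
  refine ⟨convolution one ψ (ContinuousLinearMap.mul ℝ ℂ) ν,
    h2.contDiff_convolution_right _ hone.locallyIntegrable h1, ?_, ?_⟩
  · obtain ⟨R', hR'⟩ := h2.isCompact.isBounded.subset_closedBall 0
    refine HasCompactSupport.intro (isCompact_closedBall 0 (R' + R * ‖v‖)) fun x hx => ?_
    rw [hconv, integral_map hvm.aemeasurable (by
      exact (h1.continuous.comp (by fun_prop)).aestronglyMeasurable)]
    refine integral_eq_zero_of_ae ?_
    filter_upwards [hR] with y hy
    by_contra hne
    apply hx
    have h3 := hR' (subset_tsupport ψ hne)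
    rw [mem_closedBall_zero_iff] at h3 ⊢
    calc ‖x‖ = ‖(x - y • v) + y • v‖ := by rw [sub_add_cancel]
      _ ≤ ‖x - y • v‖ + ‖y • v‖ := norm_add_le _ _
      _ ≤ R' + R * ‖v‖ := by
        rw [norm_smul]
        have : ‖y‖ ≤ R := hy
        gcongr
  · ext t
    have hint : Integrable (fun p : EuclideanSpace ℝ (Fin n) × EuclideanSpace ℝ (Fin n) =>
        Complex.exp ((-2 * Real.pi * inner ℝ p.1 t : ℝ) * Complex.I) * ψ (p.1 - p.2))
        (volume.prod ν) := by
      have h3 := hone.convolution_integrand (ContinuousLinearMap.mul ℝ ℂ) hψint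
      refine h3.mono ?_ (ae_of_all _ fun p => ?_)
      · exact (Continuous.mul (by fun_prop) (h1.continuous.comp (by fun_prop))).aestronglyMeasurable
      · rw [norm_mul, Complex.norm_exp_ofReal_mul_I]
        simp [one]
    calc 𝓕 ψ t * ∫ x : ℝ, Complex.exp ((inner ℝ c t * x : ℝ) * Complex.I) ∂μ
        = 𝓕 ψ t * ∫ s, Complex.exp ((-2 * Real.pi * inner ℝ s t : ℝ) * Complex.I) ∂ν := by
          rw [integral_map hvm.aemeasurable (by
            exact Continuous.aestronglyMeasurable (by fun_prop))]
          congr 1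
          refine integral_congr_ae (ae_of_all _ fun x => ?_)
          have : inner ℝ c t * x = -2 * Real.pi * inner ℝ (x • v) t := by
            rw [hv, inner_smul_left, inner_smul_left]
            simp only [conj_trivial]
            field_simp
          simp only [this]
      _ = ∫ s, (∫ x, Complex.exp ((-2 * Real.pi * inner ℝ x t : ℝ) * Complex.I) *
            ψ (x - s)) ∂ν := by
          rw [← integral_const_mul]
          refine integral_congr_ae (ae_of_all _ fun s => ?_)
          simp only
          rw [Real.fourier_eq', ← integral_mul_const, ← integral_sub_right_eq_self _ s]
          refine integral_congr_ae (ae_of_all _ fun x => ?_)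
          simp only [smul_eq_mul, inner_sub_left]
          rw [mul_right_comm, ← Complex.exp_add]
          congr 2
          push_cast
          ring
      _ = ∫ x, (∫ s, Complex.exp ((-2 * Real.pi * inner ℝ x t : ℝ) * Complex.I) *
            ψ (x - s) ∂ν) := (integral_integral_swap hint).symm
      _ = _ := by
          rw [Real.fourier_eq']
          refine integral_congr_ae (ae_of_all _ fun x => ?_)
          simp only [integral_const_mul, hconv, smul_eq_mul]

-- Submultiplicativity of the Wiener norm: the transform of a product is a convolution of the
-- transforms, and ‖u ∗ v‖₁ ≤ ‖u‖₁‖v‖₁. Passing to inverse transforms changes no L¹ norm.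
open SchwartzMap in
theorem integral_norm_fourier_mul_le {V : Type*} [NormedAddCommGroup V] [InnerProductSpace ℝ V]
    [FiniteDimensional ℝ V] [MeasurableSpace V] [BorelSpace V] (g φ : 𝓢(V, ℂ)) :
    ∫ x, ‖𝓕 (fun x => g x * φ x) x‖ ≤ (∫ x, ‖𝓕 (g : V → ℂ) x‖) * ∫ x, ‖𝓕 (φ : V → ℂ) x‖ := by
  have hinv : ∀ f : V → ℂ, ∫ x, ‖𝓕 f x‖ = ∫ x, ‖𝓕⁻ f x‖ := fun f => by
    rw [← integral_neg_eq_self]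
    simp only [Real.fourierInv_eq_fourier_neg]
  simp only [hinv]
  let B := ContinuousLinearMap.mul ℂ ℂ
  have h1 : ∀ x, 𝓕⁻ (fun x => g x * φ x) x =
      convolution (𝓕⁻ g : 𝓢(V, ℂ)) (𝓕⁻ φ : 𝓢(V, ℂ)) B volume x := by
    intro x
    rw [← SchwartzMap.convolution_apply]
    change _ = (𝓕⁻ (pairing B (𝓕 (𝓕⁻ g)) (𝓕 (𝓕⁻ φ))) : 𝓢(V, ℂ)) x
    rw [FourierTransform.fourier_fourierInv_eq, FourierTransform.fourier_fourierInv_eq,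
      fourierInv_coe]
    rfl
  have hg : Integrable (𝓕⁻ g : 𝓢(V, ℂ)) := SchwartzMap.integrable _
  have hφ : Integrable (𝓕⁻ φ : 𝓢(V, ℂ)) := SchwartzMap.integrable _
  have h2 := integral_convolution (ContinuousLinearMap.mul ℝ ℝ) hg.norm hφ.norm
  have h3 := hg.norm.integrable_convolution (ContinuousLinearMap.mul ℝ ℝ) hφ.norm
  rw [← fourierInv_coe, ← fourierInv_coe]
  refine le_trans (integral_mono_of_nonneg (ae_of_all _ fun _ => norm_nonneg _) h3
    (ae_of_all _ fun x => ?_)) h2.le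
  simp only [h1, convolution_def]
  refine (norm_integral_le_integral_norm _).trans (le_of_eq ?_)
  simp [B]

/-- The `L¹`-norms of the Fourier transforms of `pᵏ ψ` grow at most exponentially. -/
theorem exists_integral_norm_fourier_pow_le {ψ p : EuclideanSpace ℝ (Fin n) → ℂ}
    (hψ : ContDiff ℝ (⊤ : ℕ∞) ψ) (hc : HasCompactSupport ψ) (hp : ContDiff ℝ (⊤ : ℕ∞) p) :
    ∃ C B : ℝ, 0 ≤ B ∧ ∀ k : ℕ, ∫ t, ‖𝓕 (fun x => p x ^ k * ψ x) t‖ ≤ C * B ^ k := by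
  obtain ⟨R, hR⟩ := hc.isCompact.isBounded.subset_closedBall 0
  -- The cutoff equals 1 on the support of ψ, so p may be replaced by the compactly supported g =
  -- θp. Each further factor p then costs one factor ‖𝓕g‖₁. The maximum with 1 only keeps the radius
  -- positive.
  let θ : ContDiffBump (0 : EuclideanSpace ℝ (Fin n)) := ⟨max R 1, max R 1 + 1, by positivity, by simp⟩
  let g : EuclideanSpace ℝ (Fin n) → ℂ := fun x => (θ x : ℂ) * p x
  have hg : ContDiff ℝ (⊤ : ℕ∞) g := (Complex.ofRealCLM.contDiff.comp θ.contDiff).mul hp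
  have hgc : HasCompactSupport g :=
    HasCompactSupport.mul_right (θ.hasCompactSupport.comp_left Complex.ofReal_zero)
  have hψk : ∀ k : ℕ, ContDiff ℝ (⊤ : ℕ∞) (fun x => p x ^ k * ψ x) := fun k => (hp.pow k).mul hψ
  have hck : ∀ k : ℕ, HasCompactSupport (fun x => p x ^ k * ψ x) := fun k => hc.mul_left
  refine ⟨∫ t, ‖𝓕 ψ t‖, ∫ t, ‖𝓕 g t‖, integral_nonneg fun _ => norm_nonneg _, fun k => ?_⟩
  induction k with
  | zero => simp
  | succ k ih =>
    have h1 := integral_norm_fourier_mul_le (hgc.toSchwartzMap hg)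
      ((hck k).toSchwartzMap (hψk k))
    have h2 : (fun x => p x ^ (k + 1) * ψ x) = fun x => g x * (p x ^ k * ψ x) := by
      ext x
      by_cases hx : ψ x = 0
      · simp [hx]
      · have h3 : x ∈ Metric.closedBall (0 : EuclideanSpace ℝ (Fin n)) (max R 1) :=
          Metric.closedBall_subset_closedBall (le_max_left _ _) (hR (subset_tsupport ψ hx))
        have h4 : θ x = 1 := θ.one_of_mem_closedBall h3
        simp only [g, h4]
        push_cast
        ring
    rw [h2]
    refine h1.trans ?_
    rw [pow_succ]
    calc (∫ t, ‖𝓕 g t‖) * ∫ t, ‖𝓕 (fun x => p x ^ k * ψ x) t‖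
        ≤ (∫ t, ‖𝓕 g t‖) * ((∫ t, ‖𝓕 ψ t‖) * (∫ t, ‖𝓕 g t‖) ^ k) := by
          gcongr
      _ = _ := by ring

/-- The Fourier class contains approximate identities. -/
theorem exists_approxIdentity : ∃ χ ∈ fourierClass 1, ∫ t, χ t = 1 ∧ ∀ ε : ℝ, 0 < ε →
    (fun t => ((ε⁻¹ : ℝ) : ℂ) * χ (ε⁻¹ • t)) ∈ fourierClass 1 := by
  let θ : ContDiffBump (0 : EuclideanSpace ℝ (Fin 1)) := ⟨1, 2, by norm_num, by norm_num⟩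
  let ψ : EuclideanSpace ℝ (Fin 1) → ℂ := fun x => (θ x : ℂ)
  have h1 : ContDiff ℝ (⊤ : ℕ∞) ψ := Complex.ofRealCLM.contDiff.comp θ.contDiff
  have h2 : HasCompactSupport ψ := θ.hasCompactSupport.comp_left Complex.ofReal_zero
  refine ⟨𝓕 ψ, ⟨ψ, h1, h2, rfl⟩, ?_, fun ε hε => ⟨fun x => ψ (ε • x), ?_, ?_, ?_⟩⟩
  -- Fourier inversion at the origin: the integral of 𝓕ψ is ψ(0) = 1.
  · have h3 := congrFun (h1.continuous.fourierInv_fourier_eq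
      (h1.continuous.integrable_of_hasCompactSupport h2)
      (𝓕 (h2.toSchwartzMap h1)).integrable) 0
    rw [Real.fourierInv_eq'] at h3
    have h4 : ψ 0 = 1 := by
      simp only [ψ, θ.one_of_mem_closedBall (Metric.mem_closedBall_self zero_le_one), Complex.ofReal_one]
    simpa [h4] using h3
  · exact h1.comp (contDiff_const_smul ε)
  · exact h2.comp_smul hε.ne'
  · ext t
    have h3 := Measure.integral_comp_smul (volume : Measure (EuclideanSpace ℝ (Fin 1)))
      (fun x => Complex.exp ((-2 * Real.pi * inner ℝ x (ε⁻¹ • t) : ℝ) * Complex.I) • ψ x) ε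
    rw [Real.fourier_eq', Real.fourier_eq']
    simp only [finrank_euclideanSpace, Fintype.card_fin, pow_one, abs_of_pos (inv_pos.2 hε),
      inner_smul_left, inner_smul_right, conj_trivial, inv_mul_cancel_left₀ hε.ne',
      Complex.real_smul] at h3
    simp only [inner_smul_right]
    exact h3.symm

end FourierClass

/-! ### Amplifications and von Neumann's density theorem. -/

section Amplification

variable {K : Type v} [NormedAddCommGroup K] [InnerProductSpace ℂ K]
  {ι : Type*}

theorem amplify_memℓp (B : K →L[ℂ] K) (f : lp (fun _ : ι => K) 2) :
    Memℓp (fun i => B (f i)) 2 := by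
  refine memℓp_gen ?_
  have h := (lp.memℓp f).summable (by simp)
  refine Summable.of_nonneg_of_le (fun i => by positivity) (fun i => ?_)
    (h.mul_left (‖B‖ ^ (2 : ENNReal).toReal))
  rw [← Real.mul_rpow (norm_nonneg _) (norm_nonneg _)]
  exact Real.rpow_le_rpow (norm_nonneg _) (B.le_opNorm _) (by simp)

/-- The diagonal action `(f i) ↦ (B (f i))` on `⨁ᵢ K`. -/
def amplify (ι : Type*) (B : K →L[ℂ] K) :
    lp (fun _ : ι => K) 2 →L[ℂ] lp (fun _ : ι => K) 2 :=
  LinearMap.mkContinuous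
    { toFun := fun f => ⟨fun i => B (f i), amplify_memℓp B f⟩
      map_add' := fun f g => by ext i; exact map_add B _ _
      map_smul' := fun c f => by ext i; exact map_smul B _ _ }
    ‖B‖ (fun f => by
      have h2 : (0 : ℝ) < (2 : ENNReal).toReal := by simp
      refine lp.norm_le_of_tsum_le h2 (by positivity) ?_
      have h := (lp.memℓp f).summable h2
      rw [Real.mul_rpow (norm_nonneg _) (norm_nonneg _), lp.norm_rpow_eq_tsum h2, ← tsum_mul_left]
      refine Summable.tsum_le_tsum (fun i => ?_) ((amplify_memℓp B f).summable h2) (h.mul_left _)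
      rw [← Real.mul_rpow (norm_nonneg _) (norm_nonneg _)]
      exact Real.rpow_le_rpow (norm_nonneg _) (B.le_opNorm _) h2.le)

theorem amplify_apply (B : K →L[ℂ] K) (f : lp (fun _ : ι => K) 2) (i : ι) :
    amplify ι B f i = B (f i) := rfl

theorem amplify_single [DecidableEq ι] (B : K →L[ℂ] K) (i : ι) (x : K) :
    amplify ι B (lp.single 2 i x) = lp.single 2 i (B x) := by
  ext j
  rw [amplify_apply]
  by_cases h : j = i
  · subst h; simp
  · rw [lp.single_apply_ne _ _ _ h, lp.single_apply_ne _ _ _ h, map_zero]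

variable [CompleteSpace K]

theorem inner_amplify (B : K →L[ℂ] K) (f g : lp (fun _ : ι => K) 2) :
    ⟪amplify ι B f, g⟫_ℂ = ⟪f, amplify ι (star B) g⟫_ℂ := by
  rw [lp.inner_eq_tsum, lp.inner_eq_tsum]
  refine tsum_congr fun i => ?_
  rw [amplify_apply, amplify_apply, ContinuousLinearMap.star_eq_adjoint,
    ContinuousLinearMap.adjoint_inner_right]

theorem mem_bicommutant_iff {S : StarSubalgebra ℂ (K →L[ℂ] K)} {A : K →L[ℂ] K} :
    A ∈ (bicommutant S).toStarSubalgebra ↔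
      ∀ X : K →L[ℂ] K, (∀ B ∈ S, B * X = X * B) → X * A = A * X := by
  change A ∈ (bicommutant S : Set (K →L[ℂ] K)) ↔ _
  rw [coe_bicommutant]
  rfl

/-- Von Neumann's density theorem for the ultrastrong topology. -/
theorem exists_norm_amplify_sub_lt {S : StarSubalgebra ℂ (K →L[ℂ] K)} {A : K →L[ℂ] K}
    (hA : A ∈ (bicommutant S).toStarSubalgebra) (v : lp (fun _ : ι => K) 2) {ε : ℝ} (hε : 0 < ε) :
    ∃ B ∈ S, ‖amplify ι (A - B) v‖ < ε := by
  classical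
  -- The claim is that the amplified `A` maps `v` into the closure N of this space. N reduces the
  -- amplified `S`, so its projection P commutes with it.
  let N₀ : Submodule ℂ (lp (fun _ : ι => K) 2) :=
    { carrier := {x | ∃ B ∈ S, x = amplify ι B v}
      add_mem' := by
        rintro _ _ ⟨B, hB, rfl⟩ ⟨C, hC, rfl⟩
        exact ⟨B + C, add_mem hB hC, by ext i; rfl⟩
      zero_mem' := ⟨0, zero_mem _, by ext i; rfl⟩
      smul_mem' := by
        rintro c _ ⟨B, hB, rfl⟩
        exact ⟨c • B, S.smul_mem hB c, by ext i; rfl⟩ }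
  let N := N₀.topologicalClosure
  have : CompleteSpace N := N₀.isClosed_topologicalClosure.completeSpace_coe
  have hN : ∀ B ∈ S, ∀ x ∈ N, amplify ι B x ∈ N := by
    intro B hB x hx
    have h1 : Set.MapsTo (amplify ι B) (N₀ : Set (lp (fun _ : ι => K) 2)) N₀ := by
      rintro _ ⟨C, hC, rfl⟩
      exact ⟨B * C, mul_mem hB hC, by ext i; rfl⟩
    exact h1.closure (amplify ι B).continuous hx
  have hN' : ∀ B ∈ S, ∀ x ∈ Nᗮ, amplify ι B x ∈ Nᗮ := by
    intro B hB x hx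
    rw [Submodule.mem_orthogonal] at hx ⊢
    intro u hu
    have h2 := inner_amplify (star B) u x
    rw [star_star] at h2
    rw [← h2]
    exact hx _ (hN _ (star_mem hB) u hu)
  let P := N.starProjection
  have hcomm : ∀ B ∈ S, ∀ x, P (amplify ι B x) = amplify ι B (P x) := by
    intro B hB x
    refine Submodule.eq_starProjection_of_mem_of_inner_eq_zero
      (hN B hB _ (N.starProjection_apply_mem x)) fun w hw => ?_
    rw [← map_sub]
    have h3 := hN' B hB _ (N.sub_starProjection_mem_orthogonal x)
    rw [Submodule.mem_orthogonal'] at h3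
    exact h3 w hw
  -- Each matrix entry of P lies in the commutant of `S`, hence commutes with `A`; therefore P
  -- commutes with the amplified `A`.
  have hmat : ∀ (i j : ι) (x : K), (P (lp.single 2 j (A x))) i = A ((P (lp.single 2 j x)) i) := by
    intro i j
    let X : K →L[ℂ] K := (lp.evalCLM ℂ (fun _ : ι => K) 2 i) ∘L P ∘L
      (lp.singleContinuousLinearMap ℂ (fun _ : ι => K) 2 j)
    have hX : ∀ B ∈ S, B * X = X * B := by
      intro B hB
      ext x
      change B ((P (lp.single 2 j x)) i) = (P (lp.single 2 j (B x))) i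
      rw [← amplify_single, hcomm B hB]
      rfl
    exact fun x => congrArg (fun T : K →L[ℂ] K => T x) (mem_bicommutant_iff.1 hA X hX)
  have hPA : P ∘L amplify ι A = amplify ι A ∘L P := by
    refine lp.ext_continuousLinearMap ENNReal.ofNat_ne_top fun j => ?_
    ext x i
    change (P (amplify ι A (lp.single 2 j x))) i = A ((P (lp.single 2 j x)) i)
    rw [amplify_single, hmat]
  -- Here unitality of `S` enters.
  have hv : v ∈ N := N₀.le_topologicalClosure ⟨1, one_mem _, by ext i; rfl⟩
  have hAv : amplify ι A v ∈ N := by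
    have h4 : P (amplify ι A v) = amplify ι A (P v) := congrArg (fun T => T v) hPA
    rw [Submodule.starProjection_eq_self_iff.2 hv] at h4
    rw [← h4]
    exact N.starProjection_apply_mem _
  obtain ⟨_, ⟨B, hB, rfl⟩, hlt⟩ := Metric.mem_closure_iff.1 hAv ε hε
  refine ⟨B, hB, ?_⟩
  rw [dist_eq_norm] at hlt
  exact hlt

end Amplification

/-! ### Normal functionals and the σ-weak topology. -/

section SigmaWeak

variable {K : Type v} [NormedAddCommGroup K] [InnerProductSpace ℂ K]

namespace NormalPair

theorem norm_term_le (p : NormalPair K) (A : K →L[ℂ] K) (n : ℕ) :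
    ‖⟪p.1.1 n, A (p.1.2 n)⟫_ℂ‖ ≤ ‖A‖ * (‖p.1.1 n‖ ^ 2 + ‖p.1.2 n‖ ^ 2) := by
  calc _ ≤ ‖p.1.1 n‖ * ‖A (p.1.2 n)‖ := norm_inner_le_norm _ _
    _ ≤ ‖p.1.1 n‖ * (‖A‖ * ‖p.1.2 n‖) := by gcongr; exact A.le_opNorm _
    _ = ‖A‖ * (‖p.1.1 n‖ * ‖p.1.2 n‖) := by ring
    _ ≤ _ := by
      gcongr
      nlinarith [sq_nonneg (‖p.1.1 n‖ - ‖p.1.2 n‖), sq_nonneg (‖p.1.1 n‖ + ‖p.1.2 n‖)]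

omit [InnerProductSpace ℂ K] in
theorem summable_bound (p : NormalPair K) :
    Summable fun n => ‖p.1.1 n‖ ^ 2 + ‖p.1.2 n‖ ^ 2 := p.2.1.add p.2.2

theorem summable_term (p : NormalPair K) (A : K →L[ℂ] K) :
    Summable fun n => ⟪p.1.1 n, A (p.1.2 n)⟫_ℂ :=
  Summable.of_norm_bounded (p.summable_bound.mul_left _) (p.norm_term_le A)

/-- The normal functional of a pair of sequences, as a bounded functional. -/
def evalCLM (p : NormalPair K) : (K →L[ℂ] K) →L[ℂ] ℂ :=
  LinearMap.mkContinuous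
    { toFun := p.eval
      map_add' := fun A B => by
        simp only [eval, add_apply, inner_add_right]
        exact (p.summable_term A).tsum_add (p.summable_term B)
      map_smul' := fun c A => by
        simp only [eval, smul_apply, inner_smul_right, tsum_mul_left,
          RingHom.id_apply, smul_eq_mul] }
    (∑' n, (‖p.1.1 n‖ ^ 2 + ‖p.1.2 n‖ ^ 2)) (fun A => by
      rw [mul_comm, ← tsum_mul_left]
      exact tsum_of_norm_bounded (p.summable_bound.mul_left _).hasSum (p.norm_term_le A))

open Classical in
/-- The pair giving the functional `A ↦ ⟨ξ, A η⟩`. -/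
def single (ξ η : K) : NormalPair K :=
  ⟨(Pi.single 0 ξ, Pi.single 0 η), by
    constructor
    all_goals
      refine summable_of_ne_finset_zero (s := {0}) fun n hn => ?_
      rw [Finset.mem_singleton] at hn
      simp [hn]⟩

theorem eval_single (ξ η : K) (A : K →L[ℂ] K) : (single ξ η).eval A = ⟪ξ, A η⟫_ℂ := by
  rw [eval, tsum_eq_single 0]
  · simp [single]
  · intro n hn
    simp [single, hn]

end NormalPair

variable [CompleteSpace K] {M : VonNeumannAlgebra K}

theorem sigmaWeakOn_eq (M : VonNeumannAlgebra K) : sigmaWeakOn M = TopologicalSpace.induced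
    (fun (A : Elt M) (p : NormalPair K) => p.eval (A : K →L[ℂ] K)) inferInstance :=
  induced_compose

theorem tendsto_sigmaWeakOn {X : Type*} {l : Filter X} {u : X → Elt M} {A : Elt M} :
    Tendsto u l (@nhds _ (sigmaWeakOn M) A) ↔
      ∀ p : NormalPair K, Tendsto (fun x => p.eval (u x : K →L[ℂ] K)) l (𝓝 (p.eval A)) := by
  rw [sigmaWeakOn_eq, nhds_induced, tendsto_comap_iff, tendsto_pi_nhds]
  rfl

theorem continuous_sigmaWeakOn {X : Type*} [TopologicalSpace X] {u : X → Elt M} :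
    @Continuous _ _ _ (sigmaWeakOn M) u ↔
      ∀ p : NormalPair K, Continuous fun x => p.eval (u x : K →L[ℂ] K) := by
  rw [sigmaWeakOn_eq, continuous_induced_rng, continuous_pi_iff]
  rfl

theorem mem_closure_sigmaWeakOn_of_tendsto {X : Type*} {l : Filter X} [l.NeBot] {s : Set (Elt M)}
    {u : X → Elt M} {A : Elt M} (hs : ∀ᶠ x in l, u x ∈ s)
    (h : ∀ p : NormalPair K, Tendsto (fun x => p.eval (u x : K →L[ℂ] K)) l (𝓝 (p.eval A))) :
    A ∈ @closure _ (sigmaWeakOn M) s :=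
  let _ : TopologicalSpace (Elt M) := sigmaWeakOn M
  mem_closure_of_tendsto (tendsto_sigmaWeakOn.2 h) hs

theorem mem_closure_sigmaWeakOn {s : Set (Elt M)} {A : Elt M}
    (h : ∀ (I : Finset (NormalPair K)) (ε : ℝ), 0 < ε → ∃ B ∈ s, ∀ p ∈ I,
      ‖p.eval ((A : K →L[ℂ] K) - B)‖ < ε) : A ∈ @closure _ (sigmaWeakOn M) s := by
  rw [sigmaWeakOn_eq, closure_induced, mem_closure_iff]
  intro o ho hAo
  obtain ⟨I, w, hw, hsub⟩ := isOpen_pi_iff.1 ho _ hAo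
  have h1 : ∀ p ∈ I, ∃ ε > 0, Metric.ball (p.eval (A : K →L[ℂ] K)) ε ⊆ w p := fun p hp =>
    Metric.isOpen_iff.1 (hw p hp).1 _ (hw p hp).2
  choose! e he hball using h1
  obtain ⟨ε, hε, hle⟩ : ∃ ε > 0, ∀ p ∈ I, ε ≤ e p := by
    rcases I.eq_empty_or_nonempty with rfl | hI
    · exact ⟨1, one_pos, by simp⟩
    · exact ⟨I.inf' hI e, (Finset.lt_inf'_iff hI).2 he, fun p hp => Finset.inf'_le e hp⟩
  obtain ⟨B, hB, hlt⟩ := h I ε hε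
  refine ⟨fun p => p.eval (B : K →L[ℂ] K), hsub fun p hp => hball p hp ?_, ⟨B, hB, rfl⟩⟩
  change p.evalCLM B ∈ Metric.ball (p.evalCLM A) (e p)
  rw [Metric.mem_ball, dist_comm, dist_eq_norm, ← map_sub]
  exact (hlt p hp).trans_le (hle p hp)

/-- Von Neumann's density theorem for the σ-weak topology. -/
theorem mem_closure_bicommutant (S : StarSubalgebra ℂ (K →L[ℂ] K)) (A : Elt (bicommutant S)) :
    A ∈ @closure _ (sigmaWeakOn (bicommutant S)) {B | (B : K →L[ℂ] K) ∈ S} := by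
  classical
  refine mem_closure_sigmaWeakOn fun I ε hε => ?_
  -- All second sequences of the pairs in `I` are packed into a single ℓ² vector `v`, and the first
  -- sequence of `p` into `x p`, supported in the block of `p`. One ultrastrong approximation at `v`
  -- then controls all the functionals at once.
  let ι := I × ℕ
  have hmem : ∀ c : NormalPair K → ℕ → K, (∀ p, Summable fun n => ‖c p n‖ ^ 2) →
      Memℓp (fun i : ι => c i.1 i.2) 2 := by
    intro c hc
    refine memℓp_gen ?_
    simp only [ENNReal.toReal_ofNat, Real.rpow_ofNat]
    rw [summable_prod_of_nonneg (fun _ => by positivity)]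
    exact ⟨fun p => hc p, Summable.of_finite⟩
  let v : lp (fun _ : ι => K) 2 := ⟨_, hmem (fun p => p.1.2) fun p => p.2.2⟩
  let x : NormalPair K → lp (fun _ : ι => K) 2 := fun p =>
    ⟨_, hmem (fun q => if q = p then p.1.1 else 0) fun q => by
      by_cases h : q = p
      · simpa [h] using p.2.1
      · simp [h]⟩
  obtain ⟨δ, hδ, hle⟩ : ∃ δ > 0, ∀ p ∈ I, ‖x p‖ * δ < ε := by
    refine ⟨ε / (1 + ∑ p ∈ I, ‖x p‖), by positivity, fun p hp => ?_⟩
    have h1 := Finset.single_le_sum (f := fun p => ‖x p‖) (fun _ _ => norm_nonneg _) hp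
    rw [← mul_div_assoc, div_lt_iff₀ (by positivity)]
    nlinarith
  obtain ⟨B, hB, hlt⟩ := exists_norm_amplify_sub_lt A.2 v hδ
  refine ⟨⟨B, subset_bicommutant S hB⟩, hB, fun p hp => ?_⟩
  have h2 : p.eval ((A : K →L[ℂ] K) - B) = ⟪x p, amplify ι ((A : K →L[ℂ] K) - B) v⟫_ℂ := by
    rw [lp.inner_eq_tsum, NormalPair.eval]
    have hinj : Function.Injective fun n : ℕ => ((⟨p, hp⟩, n) : ι) := fun _ _ h =>
      (Prod.mk.inj h).2
    rw [← hinj.tsum_eq]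
    · refine tsum_congr fun n => ?_
      change _ = ⟪(if p = p then p.1.1 else 0) n, ((A : K →L[ℂ] K) - B) (p.1.2 n)⟫_ℂ
      rw [if_pos rfl]
    · rintro ⟨q, n⟩ hq
      by_contra hne
      apply hq
      have : (q : NormalPair K) ≠ p := fun h => hne ⟨n, by simp [← h]⟩
      change ⟪(if (q : NormalPair K) = p then p.1.1 else 0) n, _⟫_ℂ = 0
      rw [if_neg this]
      simp
  change ‖p.eval ((A : K →L[ℂ] K) - B)‖ < ε
  rw [h2]
  calc _ ≤ ‖x p‖ * ‖amplify ι ((A : K →L[ℂ] K) - B) v‖ := norm_inner_le_norm _ _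
    _ ≤ ‖x p‖ * δ := by gcongr
    _ < ε := hle p hp

end SigmaWeak

/-! ### The symplectic form, and Weyl elements as functions. -/

section Symplectic

variable {𝓗 : Type u} [NormedAddCommGroup 𝓗] [InnerProductSpace ℂ 𝓗]

theorem symp_swap (f g : 𝓗) : symp g f = -symp f g := by
  rw [symp, symp, ← inner_conj_symm, Complex.conj_im]

theorem symp_self (f : 𝓗) : symp f f = 0 := by
  have := symp_swap f f
  linarith

theorem symp_add_left (f g h : 𝓗) : symp (f + g) h = symp f h + symp g h := by
  simp [symp]

theorem symp_sub_left (f g h : 𝓗) : symp (f - g) h = symp f h - symp g h := by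
  simp [symp]

theorem symp_neg_left (f g : 𝓗) : symp (-f) g = -symp f g := by
  simp [symp, inner_neg_left]

theorem symp_neg_right (f g : 𝓗) : symp f (-g) = -symp f g := by
  simp [symp, inner_neg_right]

theorem symp_real_smul_left (t : ℝ) (f g : 𝓗) : symp ((t : ℂ) • f) g = t * symp f g := by
  simp [symp]

theorem abs_symp_le (f g : 𝓗) : |symp f g| ≤ ‖f‖ * ‖g‖ :=
  (Complex.abs_im_le_norm _).trans (norm_inner_le_norm _ _)

end Symplectic

section WeylElements

variable {𝓗 : Type u} [NormedAddCommGroup 𝓗] [InnerProductSpace ℂ 𝓗] {D : Submodule ℂ 𝓗}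

theorem weylFun_add (f g : 𝓗) : weylFun (f + g) = weylFun f * weylFun g := by
  ext x
  change Complex.exp _ = Complex.exp _ * Complex.exp _
  rw [← Complex.exp_add, inner_add_left]
  congr 1
  push_cast [Complex.add_re]
  ring

theorem weylFun_zero : weylFun (0 : 𝓗) = 1 := by
  ext x
  change Complex.exp _ = 1
  simp

theorem star_weylFun (f : 𝓗) : star (weylFun f) = weylFun (-f) := by
  ext x
  change starRingEnd ℂ (Complex.exp _) = Complex.exp _
  rw [← Complex.exp_conj]
  simp

theorem weyl_add (f g : D) : weyl (f + g) = weyl f * weyl g :=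
  Subtype.ext (weylFun_add (f : 𝓗) g)

theorem weyl_zero : weyl (0 : D) = 1 := Subtype.ext weylFun_zero

theorem star_weyl (f : D) : star (weyl f) = weyl (-f) := Subtype.ext (star_weylFun (f : 𝓗))

/-- Weyl functions are closed under products and conjugation and contain 1, so their linear span is
already a ⋆-algebra. -/
theorem adjoin_le_span_weylFun {x : BoundedContinuousFunction 𝓗 ℂ}
    (hx : x ∈ StarAlgebra.adjoin ℂ (weylFun '' (D : Set 𝓗))) :
    x ∈ Submodule.span ℂ (Set.range fun f : D => weylFun (f : 𝓗)) := by
  induction hx using StarAlgebra.adjoin_induction with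
  | mem x hx =>
    obtain ⟨f, hf, rfl⟩ := hx
    exact Submodule.subset_span ⟨⟨f, hf⟩, rfl⟩
  | algebraMap r =>
    rw [Algebra.algebraMap_eq_smul_one]
    exact Submodule.smul_mem _ _ (Submodule.subset_span ⟨0, weylFun_zero⟩)
  | add x y _ _ hx hy => exact add_mem hx hy
  | mul x y _ _ hx hy =>
    have h := Submodule.mul_mem_mul hx hy
    rw [Submodule.span_mul_span] at h
    refine Submodule.span_mono ?_ h
    rintro _ ⟨_, ⟨f, rfl⟩, _, ⟨g, rfl⟩, rfl⟩
    exact ⟨f + g, weylFun_add (f : 𝓗) g⟩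
  | star x hx' hx =>
    clear hx'
    induction hx using Submodule.span_induction with
    | mem x hx =>
      obtain ⟨f, rfl⟩ := hx
      exact Submodule.subset_span ⟨-f, (star_weylFun (f : 𝓗)).symm⟩
    | zero => rw [star_zero]; exact zero_mem _
    | add x y _ _ hx hy => rw [star_add]; exact add_mem hx hy
    | smul c x _ hx => rw [star_smul]; exact Submodule.smul_mem _ _ hx

/-- The linear combinations of Weyl elements are dense in the Weyl algebra. -/
theorem exists_norm_sub_linearCombination_weyl_lt (a : weylAlgebra D) {ε : ℝ} (hε : 0 < ε) :
    ∃ u : D →₀ ℂ, ‖a - Finsupp.linearCombination ℂ weyl u‖ < ε := by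
  have ha : (a : BoundedContinuousFunction 𝓗 ℂ) ∈
      closure (StarAlgebra.adjoin ℂ (weylFun '' (D : Set 𝓗)) :
        Set (BoundedContinuousFunction 𝓗 ℂ)) := a.2
  obtain ⟨x, hx, hlt⟩ := Metric.mem_closure_iff.1 ha ε hε
  obtain ⟨u, hu⟩ := Finsupp.mem_span_range_iff_exists_finsupp.1 (adjoin_le_span_weylFun hx)
  refine ⟨u, ?_⟩
  have h : ((Finsupp.linearCombination ℂ weyl u : weylAlgebra D) :
      BoundedContinuousFunction 𝓗 ℂ) = x := by
    rw [← hu, Finsupp.linearCombination_apply]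
    exact map_finsuppSum (weylAlgebra D).subtype _ _
  rw [dist_eq_norm, ← h] at hlt
  exact hlt

instance isClosed_weylAlgebra : IsClosed (weylAlgebra D : Set (BoundedContinuousFunction 𝓗 ℂ)) :=
  StarSubalgebra.isClosed_topologicalClosure _

end WeylElements

/-! ### Weyl operators in the GNS representation. -/

section GNS

variable {𝓗 : Type u} [NormedAddCommGroup 𝓗] [InnerProductSpace ℂ 𝓗] {D : Submodule ℂ 𝓗}
  {ω : WeylState D} {K : Type v} [NormedAddCommGroup K] [InnerProductSpace ℂ K] [CompleteSpace K]

namespace GNSTriple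

variable (G : GNSTriple ω K)

/-- The represented Weyl operator `π(W⁰(f))`. -/
def W (f : D) : K →L[ℂ] K := G.π (weyl f)

theorem W_add (f g : D) : G.W (f + g) = G.W f * G.W g := by
  rw [W, weyl_add, map_mul]; rfl

theorem W_zero : G.W 0 = 1 := by rw [W, weyl_zero, map_one]

theorem star_W (f : D) : star (G.W f) = G.W (-f) := by
  rw [W, W, ← map_star, star_weyl]

theorem W_comm (f g : D) : G.W f * G.W g = G.W g * G.W f := by
  rw [← W_add, ← W_add, add_comm]

theorem W_add_apply (f g : D) (ξ : K) : G.W (f + g) ξ = G.W f (G.W g ξ) := by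
  rw [W_add]; rfl

theorem inner_W_left (f : D) (ξ η : K) : ⟪G.W f ξ, η⟫_ℂ = ⟪ξ, G.W (-f) η⟫_ℂ := by
  rw [← star_W, ContinuousLinearMap.star_eq_adjoint, ContinuousLinearMap.adjoint_inner_right]

theorem norm_W_apply (f : D) (ξ : K) : ‖G.W f ξ‖ = ‖ξ‖ := by
  rw [@norm_eq_sqrt_re_inner ℂ, inner_W_left, ← W_add_apply, neg_add_cancel, W_zero,
    @norm_eq_sqrt_re_inner ℂ]
  rfl

theorem norm_π_le (a : weylAlgebra D) : ‖G.π a‖ ≤ ‖a‖ :=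
  NonUnitalStarAlgHom.norm_apply_le G.π a

theorem π_linearCombination (u : D →₀ ℂ) :
    G.π (Finsupp.linearCombination ℂ weyl u) = Finsupp.linearCombination ℂ G.W u := by
  rw [Finsupp.linearCombination_apply, Finsupp.linearCombination_apply, map_finsuppSum]
  simp only [map_smul]
  rfl

theorem exists_norm_π_sub_lt (a : weylAlgebra D) {ε : ℝ} (hε : 0 < ε) :
    ∃ u : D →₀ ℂ, ‖G.π a - Finsupp.linearCombination ℂ G.W u‖ < ε := by
  obtain ⟨u, hu⟩ := exists_norm_sub_linearCombination_weyl_lt a hε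
  refine ⟨u, ?_⟩
  rw [← π_linearCombination, ← map_sub]
  exact (G.norm_π_le _).trans_lt hu

/-- The vectors `∑ u_f W(f) Ω`. -/
def weylVec : (D →₀ ℂ) →ₗ[ℂ] K := Finsupp.linearCombination ℂ fun f => G.W f G.Ω

theorem weylVec_single (f : D) (c : ℂ) : G.weylVec (Finsupp.single f c) = c • G.W f G.Ω :=
  Finsupp.linearCombination_single _ _ _

theorem weylVec_eq (u : D →₀ ℂ) : G.weylVec u = Finsupp.linearCombination ℂ G.W u G.Ω := by
  rw [weylVec, Finsupp.linearCombination_apply, Finsupp.linearCombination_apply]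
  simp [Finsupp.sum]

theorem denseRange_weylVec : DenseRange G.weylVec := by
  refine Metric.denseRange_iff.2 fun ξ ε hε => ?_
  obtain ⟨_, hball, ⟨a, rfl⟩⟩ := Metric.dense_iff.1 G.cyclic ξ (ε / 2) (by positivity)
  obtain ⟨u, hu⟩ := G.exists_norm_π_sub_lt a (ε := ε / (2 * (‖G.Ω‖ + 1))) (by positivity)
  refine ⟨u, ?_⟩
  rw [Metric.mem_ball, dist_eq_norm] at hball
  have h1 : ‖G.π a G.Ω - G.weylVec u‖ ≤ ε / (2 * (‖G.Ω‖ + 1)) * ‖G.Ω‖ := by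
    rw [weylVec_eq, ← sub_apply]
    exact (ContinuousLinearMap.le_opNorm _ _).trans (by gcongr)
  have h2 : ε / (2 * (‖G.Ω‖ + 1)) * ‖G.Ω‖ ≤ ε / 2 := by
    rw [div_mul_eq_mul_div, div_le_div_iff₀ (by positivity) (by positivity)]
    nlinarith [norm_nonneg G.Ω]
  rw [dist_eq_norm, ← sub_add_sub_cancel ξ (G.π a G.Ω)]
  rw [norm_sub_rev] at hball
  linarith [norm_add_le (ξ - G.π a G.Ω) (G.π a G.Ω - G.weylVec u)]

theorem norm_Ω : ‖G.Ω‖ = 1 := by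
  have h := G.inner_eq 1
  rw [ω.map_one, map_one, one_apply_eq_self, inner_self_eq_norm_sq_to_K] at h
  have h2 : ‖G.Ω‖ ^ 2 = 1 := by simpa using (congrArg norm h).symm
  nlinarith [norm_nonneg G.Ω]

/-- The generating function `φ(f) = ⟨Ω, W(f) Ω⟩` of the state. -/
def genFun (f : D) : ℂ := ⟪G.Ω, G.W f G.Ω⟫_ℂ

theorem toLin_weyl (f : D) : ω.toLin (weyl f) = G.genFun f := G.inner_eq _

theorem genFun_zero : G.genFun 0 = 1 := by
  rw [← toLin_weyl, weyl_zero, ω.map_one]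

theorem norm_genFun_le (f : D) : ‖G.genFun f‖ ≤ 1 := by
  refine (norm_inner_le_norm _ _).trans ?_
  rw [norm_W_apply, norm_Ω, one_mul]

theorem inner_W_W (f g : D) : ⟪G.W f G.Ω, G.W g G.Ω⟫_ℂ = G.genFun (g - f) := by
  rw [inner_W_left, ← W_add_apply, genFun, neg_add_eq_sub]

end GNSTriple
end GNS

/-! ### Consequences of the weak KMS condition for the generating function. -/

section KMS

variable {𝓗 : Type u} [NormedAddCommGroup 𝓗] [InnerProductSpace ℂ 𝓗] {D : Submodule ℂ 𝓗}
  {ω : WeylState D} {K : Type v} [NormedAddCommGroup K] [InnerProductSpace ℂ K] [CompleteSpace K]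
  {H : 𝓗 →ₗ.[ℂ] 𝓗} {hD : IsTestSpace H D} {β : ℝ} {G : GNSTriple ω K}

/-- The vector `i Φ(h) Ω`. -/
def GNSTriple.fieldVec (G : GNSTriple ω K) (h : D) : K :=
  deriv (fun t : ℝ => G.W ((t : ℂ) • h) G.Ω) 0

theorem GNSTriple.IsC2.hasDerivAt (hG : G.IsC2) (h : D) :
    HasDerivAt (fun t : ℝ => G.W ((t : ℂ) • h) G.Ω) (G.fieldVec h) 0 :=
  (hG.mem_domain h).hasDerivAt

/-- Differentiability of W(tk)Ω at t = 0 propagates to every point s, because W(h + tk) = W(h + sk)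
W((t − s)k) and the bounded left factor does not depend on t. -/
theorem GNSTriple.IsC2.hasDerivAt_genFun (hG : G.IsC2) (h k : D) (s : ℝ) :
    HasDerivAt (fun t : ℝ => G.genFun (h + (t : ℂ) • k))
      ⟪G.Ω, G.W (h + (s : ℂ) • k) (G.fieldVec k)⟫_ℂ s := by
  have h1 : HasDerivAt (fun t : ℝ => G.W ((t : ℂ) • k) G.Ω) (G.fieldVec k) (s - s) := by
    rw [sub_self]
    exact hG.hasDerivAt k
  have h2 := h1.comp_sub_const s s
  have h3 := (((innerSL ℂ G.Ω) ∘L G.W (h + (s : ℂ) • k)).restrictScalars ℝ).hasFDerivAt.comp_hasDerivAt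
    s h2
  refine h3.congr_of_eventuallyEq (Eventually.of_forall fun t => ?_)
  change ⟪G.Ω, _⟫_ℂ = ⟪G.Ω, G.W (h + (s : ℂ) • k) (G.W (((t - s : ℝ) : ℂ) • k) G.Ω)⟫_ℂ
  rw [← G.W_add_apply]
  congr 3
  push_cast
  module

namespace IsWeakKMS

variable (hω : IsWeakKMS hD β ω G)
include hω

/-- The weak KMS condition on Weyl elements. -/
theorem symp_mul_genFun (h f : D) :
    (symp (h : 𝓗) f : ℂ) * G.genFun h = β * ⟪G.Ω, G.W h (G.fieldVec (hD.iH f))⟫_ℂ := by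
  -- With a = W⁰(f) and b = W⁰(h − f) the product is W⁰(h), and σ(h − f, f) = σ(h, f).
  have h1 := hω.kms (Finsupp.single f 1) (Finsupp.single (h - f) 1)
  have h2 : deriv (fun t : ℝ => ω.toLin (weyl ((t : ℂ) • hD.iH f) * weyl h)) 0 =
      ⟪G.Ω, G.W h (G.fieldVec (hD.iH f))⟫_ℂ := by
    have h3 := hω.isC2.hasDerivAt_genFun h (hD.iH f) 0
    simp only [Complex.ofReal_zero, zero_smul, add_zero] at h3
    rw [← h3.deriv]
    congr 1
    ext t
    rw [← weyl_add, G.toLin_weyl, add_comm]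
  rw [weylBracket, WeylState.mulDeriv] at h1
  rw [Finsupp.sum_single_index (by simp), Finsupp.sum_single_index (by simp),
    Finsupp.sum_single_index (by simp), Finsupp.sum_single_index (by simp),
    add_sub_cancel, WeylState.field, h2, map_smul, G.toLin_weyl, Submodule.coe_sub, symp_sub_left,
    symp_self, sub_zero] at h1
  simp only [one_mul, smul_eq_mul] at h1
  rw [h1, ← mul_assoc Complex.I, mul_neg, Complex.I_mul_I, neg_neg, one_mul]

/-- For β = 0 all σ(k, f) φ(k) vanish. Since φ is nonzero near 0 on the line through `h`, testing a
small positive multiple of `h` against i`h` gives ‖h‖² = 0. -/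
theorem eq_zero_of_beta_eq_zero (hβ : β = 0) (h : D) : h = 0 := by
  have h1 : ∀ k f : D, (symp (k : 𝓗) f : ℂ) * G.genFun k = 0 := fun k f => by
    rw [hω.symp_mul_genFun, hβ]
    simp
  have hc : ContinuousAt (fun t : ℝ => G.genFun (0 + (t : ℂ) • h)) 0 :=
    (hω.isC2.hasDerivAt_genFun 0 h 0).continuousAt
  have hne : ∀ᶠ t : ℝ in 𝓝 0, G.genFun (0 + (t : ℂ) • h) ≠ 0 := by
    refine hc.eventually_ne ?_
    simp [G.genFun_zero]
  obtain ⟨ε, hε, hball⟩ := Metric.eventually_nhds_iff.1 hne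
  have h2 := hball (y := ε / 2) (by
    rw [Real.dist_eq, sub_zero, abs_of_pos (by positivity)]; linarith)
  have h3 := (mul_eq_zero.1 (h1 (0 + ((ε / 2 : ℝ) : ℂ) • h) (Complex.I • h))).resolve_right h2
  rw [Complex.ofReal_eq_zero, zero_add, Submodule.coe_smul, symp_real_smul_left] at h3
  have h4 : symp (h : 𝓗) ((Complex.I • h : D) : 𝓗) = ‖(h : 𝓗)‖ ^ 2 := by
    rw [symp, Submodule.coe_smul, inner_smul_right, inner_self_eq_norm_sq_to_K]
    have : ((‖(h : 𝓗)‖ : ℂ)) ^ 2 = ((‖(h : 𝓗)‖ ^ 2 : ℝ) : ℂ) := by push_cast; rfl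
    change (Complex.I * (‖(h : 𝓗)‖ : ℂ) ^ 2).im = _
    rw [this, Complex.I_mul_im, Complex.ofReal_re]
  rw [h4] at h3
  have h5 : ‖(h : 𝓗)‖ = 0 := by
    rcases mul_eq_zero.1 h3 with h5 | h5
    · linarith
    · exact pow_eq_zero_iff (two_ne_zero) |>.1 h5
  exact Subtype.ext (norm_eq_zero.1 h5)

/-- It makes the convention 0⁻¹ = 0 harmless: for β = 0 the test space is trivial. -/
theorem beta_mul_inv_mul_symp (f g : D) : β * (β⁻¹ * symp (f : 𝓗) g) = symp (f : 𝓗) g := by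
  by_cases hβ : β = 0
  · rw [hω.eq_zero_of_beta_eq_zero hβ f]
    simp [symp]
  · rw [mul_inv_cancel_left₀ hβ]

/-- The generating function along the directions `iHf`. -/
theorem genFun_add_iH (h f : D) :
    G.genFun (h + hD.iH f) = G.genFun h *
      Complex.exp ((β⁻¹ * (symp (h : 𝓗) f + symp (hD.iH f : 𝓗) f / 2) : ℝ)) := by
  by_cases hβ : β = 0
  · rw [hω.eq_zero_of_beta_eq_zero hβ (h + hD.iH f), hω.eq_zero_of_beta_eq_zero hβ h]
    simp [hβ]
  set k := hD.iH f with hk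
  -- With k = iHf, the equation is d/ds φ(h + sk) = β⁻¹(σ(h, f) + s σ(k, f)) φ(h + sk). The function
  -- `e` is the primitive of its coefficient vanishing at 0, and exp(−e) is the integrating factor
  -- making `w` constant.
  let e : ℝ → ℝ := fun s => β⁻¹ * (s * symp (h : 𝓗) f + s ^ 2 * symp (k : 𝓗) f / 2)
  have he : ∀ s, HasDerivAt e (β⁻¹ * (symp (h : 𝓗) f + s * symp (k : 𝓗) f)) s := by
    intro s
    have h1 := ((hasDerivAt_id s).mul_const (symp (h : 𝓗) f)).add
      ((((hasDerivAt_id s).pow 2).mul_const (symp (k : 𝓗) f)).div_const 2)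
    refine (h1.const_mul β⁻¹).congr_deriv ?_
    simp only [id_eq, Nat.cast_ofNat, Nat.add_one_sub_one, pow_one]
    ring
  let w : ℝ → ℂ := fun s => G.genFun (h + (s : ℂ) • k) * Complex.exp (-(e s : ℝ))
  have hw : ∀ s, HasDerivAt w 0 s := by
    intro s
    have h1 := hω.isC2.hasDerivAt_genFun h k s
    have h2 : ⟪G.Ω, G.W (h + (s : ℂ) • k) (G.fieldVec k)⟫_ℂ =
        (β⁻¹ * (symp (h : 𝓗) f + s * symp (k : 𝓗) f) : ℝ) * G.genFun (h + (s : ℂ) • k) := by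
      have h3 := hω.symp_mul_genFun (h + (s : ℂ) • k) f
      rw [← hk, Submodule.coe_add, Submodule.coe_smul, symp_add_left, symp_real_smul_left] at h3
      rw [Complex.ofReal_mul, mul_assoc, h3, Complex.ofReal_inv,
        inv_mul_cancel_left₀ (Complex.ofReal_ne_zero.2 hβ)]
    have h4 := ((he s).ofReal_comp.neg).cexp
    refine (h1.mul h4).congr_deriv ?_
    rw [h2]
    push_cast
    ring
  have hconst := is_const_of_deriv_eq_zero (fun s => (hw s).differentiableAt)
    (fun s => (hw s).deriv) 1 0
  simp only [w, e] at hconst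
  norm_num at hconst
  rw [← hconst, mul_assoc, ← Complex.exp_add]
  simp

/-- Strong continuity of the Weyl operators along curves with increments in the range of `iH`. -/
theorem continuous_W_apply {Y : Type*} [TopologicalSpace Y] (F : Y → D) (k : Y → Y → D)
    (hk : ∀ y₀ y, F y - F y₀ = hD.iH (k y₀ y))
    (hlim : ∀ y₀, Tendsto (fun y => symp (hD.iH (k y₀ y) : 𝓗) (k y₀ y)) (𝓝 y₀) (𝓝 0)) (ξ : K) :
    Continuous fun y => G.W (F y) ξ := by
  have h0 : Continuous fun y => G.W (F y) G.Ω := by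
    refine continuous_iff_continuousAt.2 fun y₀ => ?_
    -- The squared distance of two unit vectors is 2 − 2 Re of their inner product, here φ(iH k(y₀,
    -- y)), known in closed form.
    have h1 : ∀ y, ‖G.W (F y) G.Ω - G.W (F y₀) G.Ω‖ ^ 2 =
        2 - 2 * Real.exp (β⁻¹ * (symp (hD.iH (k y₀ y) : 𝓗) (k y₀ y) / 2)) := by
      intro y
      have h2 := hω.genFun_add_iH 0 (k y₀ y)
      rw [zero_add, G.genFun_zero, one_mul, ← hk] at h2
      have h4 : symp ((0 : D) : 𝓗) (k y₀ y) = 0 := by simp [symp]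
      rw [h4, zero_add, ← Complex.ofReal_exp, hk] at h2
      rw [@norm_sub_sq ℂ, G.norm_W_apply, G.norm_W_apply, G.norm_Ω,
        ← inner_conj_symm, G.inner_W_W, hk, h2, RCLike.conj_re]
      change 1 ^ 2 - 2 * (Complex.re _) + 1 ^ 2 = _
      rw [← Complex.ofReal_exp, Complex.ofReal_re]
      ring
    have h3 : Tendsto (fun y => ‖G.W (F y) G.Ω - G.W (F y₀) G.Ω‖ ^ 2) (𝓝 y₀) (𝓝 0) := by
      simp only [h1]
      have := (((hlim y₀).div_const 2).const_mul β⁻¹).rexp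
      simpa using (this.const_mul 2).const_sub 2
    rw [ContinuousAt, tendsto_iff_norm_sub_tendsto_zero]
    simpa using h3.sqrt
  -- From Ω to all vectors: Weyl operators commute, which settles the combinations of the W(g)Ω, and
  -- isometry makes the approximation uniform in y.
  refine continuous_of_uniform_approx_of_continuous fun s hs => ?_
  obtain ⟨ε, hε, hsub⟩ := Metric.mem_uniformity_dist.1 hs
  obtain ⟨u, hu⟩ := Metric.denseRange_iff.1 G.denseRange_weylVec ξ ε hε
  refine ⟨fun y => G.W (F y) (G.weylVec u), ?_, fun y => hsub ?_⟩
  · simp only [GNSTriple.weylVec, Finsupp.linearCombination_apply, Finsupp.sum, map_sum, map_smul,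
      ← G.W_add_apply]
    refine continuous_finsetSum _ fun g _ => Continuous.const_smul ?_ _
    simp only [add_comm _ g, G.W_add_apply]
    exact (G.W g).continuous.comp h0
  · rw [dist_eq_norm, ← map_sub, G.norm_W_apply, ← dist_eq_norm]
    exact hu

variable [CompleteSpace 𝓗] (hsa : IsSelfAdjoint H)
include hsa

/-- The increment formula at h = g + f, with the time integral of `f` in place of f. -/
theorem genFun_add_evol (g f : D) (t : ℝ) :
    G.genFun (g + hD.evol t f) = G.genFun (g + f) *
      Complex.exp ((β⁻¹ * (symp ((g + f : D) : 𝓗) (hD.timeIntegral t f) +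
        symp (hD.iH (hD.timeIntegral t f) : 𝓗) (hD.timeIntegral t f) / 2) : ℝ)) := by
  rw [← hω.genFun_add_iH, hD.iH_timeIntegral hsa]
  congr 1
  abel

/-- The state is invariant under the flow. -/
theorem genFun_evol (f : D) (t : ℝ) : G.genFun (hD.evol t f) = G.genFun f := by
  have h := hω.genFun_add_evol hsa 0 f t
  rw [zero_add, zero_add] at h
  have hint : ∀ g : 𝓗, ∫ s in (0 : ℝ)..t, symp g (hD.evol s f : 𝓗) =
      symp g (hD.timeIntegral t f : 𝓗) := by
    intro g
    let L : 𝓗 →L[ℝ] ℝ := Complex.imCLM ∘L (innerSL ℂ g).restrictScalars ℝ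
    have hc : Continuous fun s => (hD.evol s f : 𝓗) :=
      continuous_subtype_val.comp (hD.continuous_evol hsa f)
    exact L.intervalIntegral_comp_comm (hc.intervalIntegrable 0 t)
  -- With k = ∫₀ᵗ e^{isH}f ds the exponent is β⁻¹(σ(f, k) + σ(e^{itH}f, k))/2. The two terms cancel
  -- by σ(e^{itH}f, e^{isH}f) = −σ(f, e^{i(t−s)H}f) and the substitution s ↦ t − s.
  have h1 : symp (hD.evol t f : 𝓗) (hD.timeIntegral t f : 𝓗) =
      -symp (f : 𝓗) (hD.timeIntegral t f : 𝓗) := by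
    rw [← hint, ← hint, ← intervalIntegral.integral_neg]
    have h2 := intervalIntegral.integral_comp_sub_left (a := 0) (b := t)
      (fun s => -symp (f : 𝓗) (hD.evol s f : 𝓗)) t
    rw [sub_self, sub_zero] at h2
    rw [← h2]
    refine intervalIntegral.integral_congr fun s _ => ?_
    rw [← symp_swap]
    have h3 : hD.evol t f = hD.evol s (hD.evol (t - s) f) := by
      rw [← hD.evol_add_time hsa, add_sub_cancel]
    rw [h3]
    exact congrArg Complex.im (hD.inner_evol hsa s (hD.evol (t - s) f) f)
  rw [h, hD.iH_timeIntegral hsa, Submodule.coe_sub, symp_sub_left, h1]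
  ring_nf
  simp

/-- The increment is iHk with k a sum of time integrals started at t₀. There iHk stays bounded while
k → 0, so σ(iHk, k) → 0. -/
theorem continuous_W_multiEvol {n : ℕ} (f : Fin n → D) (ξ : K) :
    Continuous fun t => G.W (hD.multiEvol f t) ξ := by
  have hadd : ∀ (s : Finset (Fin n)) (g : Fin n → D),
      hD.iH (∑ i ∈ s, g i) = ∑ i ∈ s, hD.iH (g i) := fun s g => by
    simp only [hD.iH_eq, map_sum, Finset.smul_sum]
  refine hω.continuous_W_apply (hD.multiEvol f)
    (fun t₀ t => ∑ i, hD.timeIntegral (t i - t₀ i) (hD.evol (t₀ i) (f i))) (fun t₀ t => ?_)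
    (fun t₀ => ?_) ξ
  · rw [hadd, IsTestSpace.multiEvol, IsTestSpace.multiEvol, ← Finset.sum_sub_distrib]
    refine Finset.sum_congr rfl fun i _ => ?_
    rw [hD.iH_timeIntegral hsa, ← hD.evol_add_time hsa, sub_add_cancel]
  · refine squeeze_zero_norm (a := fun t : EuclideanSpace ℝ (Fin n) =>
      (∑ i, 2 * ‖f i‖) * ∑ i, |t i - t₀ i| * ‖f i‖) (fun t => ?_) ?_
    · refine (abs_symp_le _ _).trans ?_
      rw [hadd]
      have h1 : ‖∑ i, hD.iH (hD.timeIntegral (t i - t₀ i) (hD.evol (t₀ i) (f i)))‖ ≤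
          ∑ i, 2 * ‖f i‖ := (norm_sum_le _ _).trans (Finset.sum_le_sum fun i _ =>
        (hD.norm_iH_timeIntegral_le hsa _ _).trans (by rw [hD.norm_evol hsa]))
      have h2 : ‖∑ i, hD.timeIntegral (t i - t₀ i) (hD.evol (t₀ i) (f i))‖ ≤
          ∑ i, |t i - t₀ i| * ‖f i‖ := (norm_sum_le _ _).trans (Finset.sum_le_sum fun i _ =>
        (hD.norm_timeIntegral_le hsa _ _).trans (by rw [hD.norm_evol hsa]))
      exact mul_le_mul h1 h2 (norm_nonneg _) (Finset.sum_nonneg fun i _ => by positivity)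
    · have hc : Continuous (fun t : EuclideanSpace ℝ (Fin n) =>
          (∑ i, 2 * ‖f i‖) * ∑ i, |t i - t₀ i| * ‖f i‖) := by fun_prop
      have := hc.tendsto t₀
      simpa using this

end IsWeakKMS

end KMS

/-! ### The von Neumann algebra and the dynamics on it. -/

section VN

variable {𝓗 : Type u} [NormedAddCommGroup 𝓗] [InnerProductSpace ℂ 𝓗] {D : Submodule ℂ 𝓗}
  {ω : WeylState D} {K : Type v} [NormedAddCommGroup K] [InnerProductSpace ℂ K] [CompleteSpace K]

namespace GNSTriple

variable {G : GNSTriple ω K}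

theorem mem_vN_iff {A : K →L[ℂ] K} : A ∈ G.vN.toStarSubalgebra ↔
    ∀ X : K →L[ℂ] K, (∀ f, G.W f * X = X * G.W f) → X * A = A * X := by
  refine mem_bicommutant_iff.trans (forall_congr' fun X => imp_congr_left ⟨fun h f => ?_, fun h => ?_⟩)
  · exact h _ ⟨weyl f, rfl⟩
  · rintro _ ⟨a, rfl⟩
    have hcl : IsClosed {B : K →L[ℂ] K | B * X = X * B} :=
      isClosed_eq (by fun_prop) (by fun_prop)
    have hmem : G.π a ∈ closure {B : K →L[ℂ] K | B * X = X * B} := by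
      refine Metric.mem_closure_iff.2 fun ε hε => ?_
      obtain ⟨u, hu⟩ := G.exists_norm_π_sub_lt a hε
      refine ⟨_, ?_, by rwa [dist_eq_norm]⟩
      simp only [Set.mem_ofPred_eq, Finsupp.linearCombination_apply, Finsupp.sum, Finset.sum_mul,
        Finset.mul_sum, smul_mul_assoc, mul_smul_comm, h]
    rwa [hcl.closure_eq] at hmem

theorem commute_W_of_mem_vN {A : K →L[ℂ] K} (hA : A ∈ G.vN.toStarSubalgebra) (f : D) :
    G.W f * A = A * G.W f := mem_vN_iff.1 hA _ fun g => G.W_comm g f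

/-- `A` commutes with the Weyl operators because these commute with each other; so `A` lies in the
commutant, with which `B` commutes. -/
theorem vN_commutative (A B : Elt G.vN) : A * B = B * A :=
  Subtype.ext (mem_vN_iff.1 B.2 _ (commute_W_of_mem_vN A.2))

theorem inner_comm_W {A : K →L[ℂ] K} (hA : A ∈ G.vN.toStarSubalgebra) (f g : D) :
    ⟪G.W f G.Ω, A (G.W g G.Ω)⟫_ℂ = ⟪G.Ω, A (G.W (g - f) G.Ω)⟫_ℂ := by
  rw [inner_W_left, ← mul_apply_eq_comp, commute_W_of_mem_vN hA, mul_apply_eq_comp,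
    ← W_add_apply, neg_add_eq_sub]

/-- An element of the von Neumann algebra is determined by its moments. -/
theorem ext_of_moments {A B : K →L[ℂ] K} (hA : A ∈ G.vN.toStarSubalgebra)
    (hB : B ∈ G.vN.toStarSubalgebra)
    (h : ∀ k, ⟪G.Ω, A (G.W k G.Ω)⟫_ℂ = ⟪G.Ω, B (G.W k G.Ω)⟫_ℂ) : A = B := by
  ext ξ
  refine G.denseRange_weylVec.induction_on (p := fun ξ => A ξ = B ξ) ξ
    (isClosed_eq (by fun_prop) (by fun_prop)) fun u => ?_
  refine ext_inner_left ℂ fun η => ?_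
  refine G.denseRange_weylVec.induction_on
    (p := fun η => ⟪η, A (G.weylVec u)⟫_ℂ = ⟪η, B (G.weylVec u)⟫_ℂ) η
    (isClosed_eq (by fun_prop) (by fun_prop)) fun w => ?_
  simp only [weylVec, Finsupp.linearCombination_apply, Finsupp.sum, map_sum, map_smul, sum_inner,
    inner_sum, inner_smul_left, inner_smul_right, inner_comm_W hA, inner_comm_W hB, h]

theorem isClosed_vN : IsClosed (G.vN.toStarSubalgebra : Set (K →L[ℂ] K)) := by
  have : (G.vN.toStarSubalgebra : Set (K →L[ℂ] K)) =
      ⋂ X ∈ {X : K →L[ℂ] K | ∀ f, G.W f * X = X * G.W f}, {A | X * A = A * X} := by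
    ext A
    simp only [SetLike.mem_coe, mem_vN_iff, Set.mem_iInter, Set.mem_ofPred_eq]
  rw [this]
  exact isClosed_biInter fun X _ => isClosed_eq (by fun_prop) (by fun_prop)

end GNSTriple

variable {H : 𝓗 →ₗ.[ℂ] 𝓗}

/-- The unitary implementation of the flow on the GNS space. -/
def GNSTriple.flowOp (G : GNSTriple ω K) (hD : IsTestSpace H D) (t : ℝ) : K →L[ℂ] K :=
  (G.weylVec ∘ₗ Finsupp.lmapDomain ℂ ℂ (hD.evol t)).extendOfNorm G.weylVec

theorem IsTestSpace.evol_sub [CompleteSpace 𝓗] (hD : IsTestSpace H D) (hsa : IsSelfAdjoint H)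
    (t : ℝ) (f g : D) : hD.evol t (f - g) = hD.evol t f - hD.evol t g := by
  rw [eq_sub_iff_add_eq, ← hD.evol_add hsa, sub_add_cancel]

theorem IsTestSpace.evol_zero_right [CompleteSpace 𝓗] (hD : IsTestSpace H D)
    (hsa : IsSelfAdjoint H) (t : ℝ) : hD.evol t 0 = 0 := by
  rw [← sub_self 0, hD.evol_sub hsa, sub_self, sub_self]

namespace IsWeakKMS

variable [CompleteSpace 𝓗] {hD : IsTestSpace H D} {β : ℝ} {G : GNSTriple ω K}
  (hω : IsWeakKMS hD β ω G) (hsa : IsSelfAdjoint H)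
include hω hsa

/-- Inner products of Weyl vectors are values of φ at differences, and φ is invariant. This supplies
the bound without which the extension defining `flowOp` would be a default value. -/
theorem inner_weylVec_mapDomain (t : ℝ) (u w : D →₀ ℂ) :
    ⟪G.weylVec (u.mapDomain (hD.evol t)), G.weylVec (w.mapDomain (hD.evol t))⟫_ℂ =
      ⟪G.weylVec u, G.weylVec w⟫_ℂ := by
  induction u using Finsupp.induction_linear with
  | zero => simp
  | add u u' hu hu' => simp only [Finsupp.mapDomain_add, map_add, inner_add_left, hu, hu']
  | single f c =>
    induction w using Finsupp.induction_linear with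
    | zero => simp
    | add w w' hw hw' => simp only [Finsupp.mapDomain_add, map_add, inner_add_right, hw, hw']
    | single g d =>
      simp only [Finsupp.mapDomain_single, G.weylVec_single, inner_smul_left, inner_smul_right,
        G.inner_W_W]
      rw [← hD.evol_sub hsa, hω.genFun_evol hsa]

theorem norm_weylVec_mapDomain (t : ℝ) (u : D →₀ ℂ) :
    ‖G.weylVec (u.mapDomain (hD.evol t))‖ = ‖G.weylVec u‖ := by
  rw [@norm_eq_sqrt_re_inner ℂ, hω.inner_weylVec_mapDomain hsa, ← @norm_eq_sqrt_re_inner ℂ]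

theorem flowOp_weylVec (t : ℝ) (u : D →₀ ℂ) :
    G.flowOp hD t (G.weylVec u) = G.weylVec (u.mapDomain (hD.evol t)) :=
  LinearMap.extendOfNorm_eq G.denseRange_weylVec
    ⟨1, fun u => by rw [one_mul]; exact (hω.norm_weylVec_mapDomain hsa t u).le⟩ u

theorem flowOp_W_Ω (t : ℝ) (f : D) :
    G.flowOp hD t (G.W f G.Ω) = G.W (hD.evol t f) G.Ω := by
  have := hω.flowOp_weylVec hsa t (Finsupp.single f 1)
  simpa [G.weylVec_single] using this

omit [CompleteSpace 𝓗] hω hsa in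
theorem ext_weylVec {A B : K →L[ℂ] K} (h : ∀ f, A (G.W f G.Ω) = B (G.W f G.Ω)) : A = B := by
  ext ξ
  refine G.denseRange_weylVec.induction_on (p := fun ξ => A ξ = B ξ) ξ
    (isClosed_eq (by fun_prop) (by fun_prop)) fun u => ?_
  simp only [GNSTriple.weylVec, Finsupp.linearCombination_apply, Finsupp.sum, map_sum, map_smul, h]

theorem flowOp_zero : G.flowOp hD 0 = 1 := ext_weylVec fun f => by
  rw [hω.flowOp_W_Ω hsa, hD.evol_zero hsa]; rfl

theorem flowOp_add (s t : ℝ) : G.flowOp hD (s + t) = G.flowOp hD s * G.flowOp hD t :=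
  ext_weylVec fun f => by
    rw [mul_apply_eq_comp, hω.flowOp_W_Ω hsa, hω.flowOp_W_Ω hsa, hω.flowOp_W_Ω hsa,
      hD.evol_add_time hsa]

theorem flowOp_W (t : ℝ) (f : D) :
    G.flowOp hD t * G.W f = G.W (hD.evol t f) * G.flowOp hD t := ext_weylVec fun g => by
  rw [mul_apply_eq_comp, mul_apply_eq_comp, ← G.W_add_apply, hω.flowOp_W_Ω hsa, hω.flowOp_W_Ω hsa,
    ← G.W_add_apply, hD.evol_add hsa]

theorem flowOp_mul_neg (t : ℝ) : G.flowOp hD t * G.flowOp hD (-t) = 1 := by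
  rw [← hω.flowOp_add hsa, add_neg_cancel, hω.flowOp_zero hsa]

theorem flowOp_neg_mul (t : ℝ) : G.flowOp hD (-t) * G.flowOp hD t = 1 := by
  rw [← hω.flowOp_add hsa, neg_add_cancel, hω.flowOp_zero hsa]

theorem inner_flowOp (t : ℝ) (ξ η : K) :
    ⟪G.flowOp hD t ξ, G.flowOp hD t η⟫_ℂ = ⟪ξ, η⟫_ℂ := by
  refine G.denseRange_weylVec.induction_on
    (p := fun ξ => ⟪G.flowOp hD t ξ, G.flowOp hD t η⟫_ℂ = ⟪ξ, η⟫_ℂ) ξ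
    (isClosed_eq (by fun_prop) (by fun_prop)) fun u => ?_
  refine G.denseRange_weylVec.induction_on
    (p := fun η => ⟪G.flowOp hD t (G.weylVec u), G.flowOp hD t η⟫_ℂ = ⟪G.weylVec u, η⟫_ℂ) η
    (isClosed_eq (by fun_prop) (by fun_prop)) fun w => ?_
  rw [hω.flowOp_weylVec hsa, hω.flowOp_weylVec hsa, hω.inner_weylVec_mapDomain hsa]

theorem norm_flowOp (t : ℝ) (ξ : K) : ‖G.flowOp hD t ξ‖ = ‖ξ‖ := by
  rw [@norm_eq_sqrt_re_inner ℂ, hω.inner_flowOp hsa, ← @norm_eq_sqrt_re_inner ℂ]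

theorem star_flowOp (t : ℝ) : star (G.flowOp hD t) = G.flowOp hD (-t) := by
  ext ξ
  refine ext_inner_left ℂ fun η => ?_
  rw [ContinuousLinearMap.star_eq_adjoint, ContinuousLinearMap.adjoint_inner_right,
    ← hω.inner_flowOp hsa t η, ← mul_apply_eq_comp, hω.flowOp_mul_neg hsa]
  rfl

theorem inner_flowOp_left (t : ℝ) (ξ η : K) :
    ⟪ξ, G.flowOp hD t η⟫_ℂ = ⟪G.flowOp hD (-t) ξ, η⟫_ℂ := by
  rw [← hω.star_flowOp hsa, ContinuousLinearMap.star_eq_adjoint,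
    ContinuousLinearMap.adjoint_inner_left]

theorem continuous_flowOp_apply (ξ : K) : Continuous fun t => G.flowOp hD t ξ := by
  refine continuous_of_uniform_approx_of_continuous fun s hs => ?_
  obtain ⟨ε, hε, hsub⟩ := Metric.mem_uniformity_dist.1 hs
  obtain ⟨u, hu⟩ := Metric.denseRange_iff.1 G.denseRange_weylVec ξ ε hε
  refine ⟨fun t => G.flowOp hD t (G.weylVec u), ?_, fun t => hsub ?_⟩
  · simp only [GNSTriple.weylVec, Finsupp.linearCombination_apply, Finsupp.sum, map_sum, map_smul,
      hω.flowOp_W_Ω hsa]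
    refine continuous_finsetSum _ fun g _ => Continuous.const_smul ?_ _
    have hc : Continuous fun t : ℝ => (WithLp.toLp 2 fun _ => t : EuclideanSpace ℝ (Fin 1)) := by
      fun_prop
    refine ((hω.continuous_W_multiEvol hsa (n := 1) (fun _ => g) G.Ω).comp hc).congr fun t => ?_
    simp [IsTestSpace.multiEvol]
  · rw [dist_eq_norm, ← map_sub, hω.norm_flowOp hsa, ← dist_eq_norm]
    exact hu

/-- If X commutes with all Weyl operators, so does U₋ₜ X Uₜ, since Uₜ permutes the Weyl operators by
conjugation. Hence `A` commutes with U₋ₜ X Uₜ, which is the assertion conjugated back. -/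
theorem conj_flowOp_mem_vN (t : ℝ) {A : K →L[ℂ] K} (hA : A ∈ G.vN.toStarSubalgebra) :
    G.flowOp hD t * A * G.flowOp hD (-t) ∈ G.vN.toStarSubalgebra := by
  rw [GNSTriple.mem_vN_iff]
  intro X hX
  have h1 : G.flowOp hD (-t) * X * G.flowOp hD t * A = A * (G.flowOp hD (-t) * X * G.flowOp hD t) := by
    refine GNSTriple.mem_vN_iff.1 hA _ fun f => ?_
    have h2 : G.W f * G.flowOp hD (-t) = G.flowOp hD (-t) * G.W (hD.evol t f) := by
      rw [hω.flowOp_W hsa, ← hD.evol_add_time hsa, neg_add_cancel, hD.evol_zero hsa]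
    rw [← mul_assoc, ← mul_assoc, h2, mul_assoc _ (G.W _) X, hX, mul_assoc _ (G.flowOp hD t),
      hω.flowOp_W hsa]
    simp only [mul_assoc]
  have h3 := hω.flowOp_mul_neg hsa t
  have h4 : X * (G.flowOp hD t * A * G.flowOp hD (-t)) =
      (G.flowOp hD t * G.flowOp hD (-t)) * X * (G.flowOp hD t * A * G.flowOp hD (-t)) := by
    rw [h3, one_mul]
  rw [h4]
  calc _ = G.flowOp hD t * (G.flowOp hD (-t) * X * G.flowOp hD t * A) * G.flowOp hD (-t) := by
        simp only [mul_assoc]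
    _ = G.flowOp hD t * A * G.flowOp hD (-t) * X * (G.flowOp hD t * G.flowOp hD (-t)) := by
        rw [h1]
        simp only [mul_assoc]
    _ = _ := by rw [h3, mul_one]

/-- The automorphism `A ↦ U_t A U_{-t}`. -/
def conjEquiv (t : ℝ) : Elt G.vN ≃⋆ₐ[ℂ] Elt G.vN where
  toFun A := ⟨G.flowOp hD t * A * G.flowOp hD (-t), hω.conj_flowOp_mem_vN hsa t A.2⟩
  invFun A := ⟨G.flowOp hD (-t) * A * G.flowOp hD t, by
    have := hω.conj_flowOp_mem_vN hsa (-t) A.2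
    rwa [neg_neg] at this⟩
  left_inv A := Subtype.ext <| by
    change G.flowOp hD (-t) * (G.flowOp hD t * A * G.flowOp hD (-t)) * G.flowOp hD t = A
    calc _ = (G.flowOp hD (-t) * G.flowOp hD t) * A * (G.flowOp hD (-t) * G.flowOp hD t) := by
          simp only [mul_assoc]
      _ = A := by rw [hω.flowOp_neg_mul hsa, one_mul, mul_one]
  right_inv A := Subtype.ext <| by
    change G.flowOp hD t * (G.flowOp hD (-t) * A * G.flowOp hD t) * G.flowOp hD (-t) = A
    calc _ = (G.flowOp hD t * G.flowOp hD (-t)) * A * (G.flowOp hD t * G.flowOp hD (-t)) := by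
          simp only [mul_assoc]
      _ = A := by rw [hω.flowOp_mul_neg hsa, one_mul, mul_one]
  map_mul' A B := Subtype.ext <| by
    change G.flowOp hD t * ((A : K →L[ℂ] K) * B) * G.flowOp hD (-t) =
      (G.flowOp hD t * A * G.flowOp hD (-t)) * (G.flowOp hD t * B * G.flowOp hD (-t))
    calc _ = G.flowOp hD t * A * 1 * B * G.flowOp hD (-t) := by simp only [mul_assoc, one_mul]
      _ = _ := by rw [← hω.flowOp_neg_mul hsa t]; simp only [mul_assoc]
  map_add' A B := Subtype.ext <| by
    change G.flowOp hD t * ((A : K →L[ℂ] K) + B) * G.flowOp hD (-t) =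
      G.flowOp hD t * A * G.flowOp hD (-t) + G.flowOp hD t * B * G.flowOp hD (-t)
    rw [mul_add, add_mul]
  map_star' A := Subtype.ext <| by
    change G.flowOp hD t * star (A : K →L[ℂ] K) * G.flowOp hD (-t) =
      star (G.flowOp hD t * A * G.flowOp hD (-t))
    rw [star_mul, star_mul, hω.star_flowOp hsa, hω.star_flowOp hsa, neg_neg, mul_assoc]
  map_smul' c A := Subtype.ext <| by
    change G.flowOp hD t * (c • (A : K →L[ℂ] K)) * G.flowOp hD (-t) =
      c • (G.flowOp hD t * A * G.flowOp hD (-t))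
    rw [mul_smul_comm, smul_mul_assoc]

theorem coe_conjEquiv (t : ℝ) (A : Elt G.vN) :
    (hω.conjEquiv hsa t A : K →L[ℂ] K) = G.flowOp hD t * A * G.flowOp hD (-t) := rfl

theorem eval_conjEquiv (t : ℝ) (A : Elt G.vN) (p : NormalPair K) :
    p.eval (hω.conjEquiv hsa t A : K →L[ℂ] K) =
      ∑' n, ⟪G.flowOp hD (-t) (p.1.1 n), (A : K →L[ℂ] K) (G.flowOp hD (-t) (p.1.2 n))⟫_ℂ := by
  refine tsum_congr fun n => ?_
  rw [coe_conjEquiv, mul_apply_eq_comp, mul_apply_eq_comp, hω.inner_flowOp_left hsa]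

/-- The W⋆-dynamics implemented by the flow. -/
def dynamics : WStarDynamics G.vN where
  τ := hω.conjEquiv hsa
  map_zero A := Subtype.ext <| by
    rw [coe_conjEquiv, neg_zero, hω.flowOp_zero hsa, one_mul, mul_one]
  map_add s t A := Subtype.ext <| by
    simp only [coe_conjEquiv]
    rw [neg_add_rev, hω.flowOp_add hsa, hω.flowOp_add hsa]
    simp only [mul_assoc]
  normal t := by
    let _ : TopologicalSpace (Elt G.vN) := sigmaWeakOn G.vN
    refine continuous_sigmaWeakOn.2 fun p => ?_
    -- The unitaries act on the sequences instead of the operator, preserving square-summability: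
    -- the pulled-back functional is again normal.
    let q : NormalPair K := ⟨(fun n => G.flowOp hD (-t) (p.1.1 n), fun n => G.flowOp hD (-t) (p.1.2 n)), by
      simpa only [hω.norm_flowOp hsa] using p.2⟩
    simp only [hω.eval_conjEquiv hsa]
    exact continuous_sigmaWeakOn.1 continuous_id q
  continuous_orbit A := by
    refine continuous_sigmaWeakOn.2 fun p => ?_
    simp only [hω.eval_conjEquiv hsa]
    refine continuous_tsum (u := fun n => ‖(A : K →L[ℂ] K)‖ * (‖p.1.1 n‖ ^ 2 + ‖p.1.2 n‖ ^ 2))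
      (fun n => ?_) (p.summable_bound.mul_left _) fun n t => ?_
    · exact ((hω.continuous_flowOp_apply hsa _).comp continuous_neg).inner
        ((A : K →L[ℂ] K).continuous.comp ((hω.continuous_flowOp_apply hsa _).comp continuous_neg))
    · let q : NormalPair K :=
        ⟨(fun n => G.flowOp hD (-t) (p.1.1 n), fun n => G.flowOp hD (-t) (p.1.2 n)), by
          simpa only [hω.norm_flowOp hsa] using p.2⟩
      have := q.norm_term_le (A : K →L[ℂ] K) n
      simpa only [q, hω.norm_flowOp hsa] using this

theorem dynamics_rep_weyl (t : ℝ) (f : D) :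
    (hω.dynamics hsa).τ t (G.rep (weyl f)) = G.rep (weyl (hD.evol t f)) := Subtype.ext <| by
  change G.flowOp hD t * G.W f * G.flowOp hD (-t) = G.W (hD.evol t f)
  rw [hω.flowOp_W hsa, mul_assoc, hω.flowOp_mul_neg hsa, mul_one]

end IsWeakKMS
end VN

/-! ### Integrals of Weyl operators, their products and Poisson brackets. -/

section Smearing

variable {𝓗 : Type u} [NormedAddCommGroup 𝓗] [InnerProductSpace ℂ 𝓗] {D : Submodule ℂ 𝓗}
  {ω : WeylState D} {K : Type v} [NormedAddCommGroup K] [InnerProductSpace ℂ K] [CompleteSpace K]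

/-- The data of an integral `∫ w(y) π(W⁰(F(y))) dμ(y)` of Weyl operators. -/
structure Smearing (G : GNSTriple ω K) where
  Y : Type
  [topologicalSpace : TopologicalSpace Y]
  [measurableSpace : MeasurableSpace Y]
  [borelSpace : BorelSpace Y]
  [secondCountable : SecondCountableTopology Y]
  μ : Measure Y
  [sFinite : SFinite μ]
  w : Y → ℂ
  F : Y → D
  bound : ℝ
  integrable_w : Integrable w μ
  norm_le : ∀ y, ‖F y‖ ≤ bound
  continuous_F : Continuous F
  continuous_W : ∀ ξ, Continuous fun y => G.W (F y) ξ

namespace Smearing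

attribute [instance] topologicalSpace measurableSpace borelSpace secondCountable sFinite

variable {G : GNSTriple ω K} (r s q : Smearing G)

theorem integrable_W {w : r.Y → ℂ} (hw : Integrable w r.μ) (ξ : K) :
    Integrable (fun y => w y • G.W (r.F y) ξ) r.μ := by
  refine hw.norm.mul_const ‖ξ‖ |>.mono'
    (hw.1.smul (r.continuous_W ξ).aestronglyMeasurable) (.of_forall fun y => ?_)
  rw [norm_smul, G.norm_W_apply]

/-- The integral of Weyl operators. -/
def op : K →L[ℂ] K :=
  LinearMap.mkContinuous
    { toFun := fun ξ => ∫ y, r.w y • G.W (r.F y) ξ ∂r.μ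
      map_add' := fun ξ η => by
        simp only [map_add, smul_add]
        exact integral_add (r.integrable_W r.integrable_w ξ) (r.integrable_W r.integrable_w η)
      map_smul' := fun c ξ => by
        simp only [map_smul, smul_comm _ c]
        exact integral_smul c _ }
    (∫ y, ‖r.w y‖ ∂r.μ) fun ξ => by
      refine (norm_integral_le_integral_norm _).trans_eq ?_
      simp only [norm_smul, G.norm_W_apply]
      exact integral_mul_const _ _

theorem op_apply (ξ : K) : r.op ξ = ∫ y, r.w y • G.W (r.F y) ξ ∂r.μ := rfl

theorem norm_op_le : ‖r.op‖ ≤ ∫ y, ‖r.w y‖ ∂r.μ :=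
  LinearMap.mkContinuous_norm_le _ (integral_nonneg fun _ => norm_nonneg _) _

theorem inner_op (ξ η : K) : ⟪ξ, r.op η⟫_ℂ = ∫ y, r.w y * ⟪ξ, G.W (r.F y) η⟫_ℂ ∂r.μ := by
  rw [op_apply, ← integral_inner (r.integrable_W r.integrable_w η)]
  simp only [inner_smul_right]

theorem integrable_inner {w : r.Y → ℂ} (hw : Integrable w r.μ) (ξ η : K) :
    Integrable (fun y => w y * ⟪ξ, G.W (r.F y) η⟫_ℂ) r.μ := by
  simpa only [inner_smul_right] using (r.integrable_W hw η).const_inner (𝕜 := ℂ) ξ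

theorem inner_op_W (k : D) : ⟪G.Ω, r.op (G.W k G.Ω)⟫_ℂ =
    ∫ y, r.w y * G.genFun (r.F y + k) ∂r.μ := by
  rw [inner_op]
  simp only [← G.W_add_apply]
  rfl

theorem integrable_genFun {w : r.Y → ℂ} (hw : Integrable w r.μ) (k : D) :
    Integrable (fun y => w y * G.genFun (r.F y + k)) r.μ := by
  have := r.integrable_inner hw G.Ω (G.W k G.Ω)
  simp only [← G.W_add_apply] at this
  exact this

theorem op_mem_vN : r.op ∈ G.vN.toStarSubalgebra := by
  refine G.mem_vN_iff.2 fun X hX => ?_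
  ext ξ
  rw [mul_apply_eq_comp, mul_apply_eq_comp, op_apply, op_apply,
    ← X.integral_comp_comm (r.integrable_W r.integrable_w ξ)]
  refine integral_congr_ae (.of_forall fun y => ?_)
  have := congrArg (fun A : K →L[ℂ] K => A ξ) (hX (r.F y))
  simp only [mul_apply_eq_comp] at this
  simp only [map_smul, this]

/-- The integral of Weyl operators, as an element of the von Neumann algebra. -/
def elt : Elt G.vN := ⟨r.op, r.op_mem_vN⟩

/-- Uniform in `f`, this bound is summable in n; it carries the interchanges of sum and integral
below. -/
theorem norm_term_W_le (p : NormalPair K) (f : D) (n : ℕ) :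
    ‖⟪p.1.1 n, G.W f (p.1.2 n)⟫_ℂ‖ ≤ ‖p.1.1 n‖ ^ 2 + ‖p.1.2 n‖ ^ 2 := by
  refine (norm_inner_le_norm _ _).trans ?_
  rw [G.norm_W_apply]
  nlinarith [sq_nonneg (‖p.1.1 n‖ - ‖p.1.2 n‖), sq_nonneg (‖p.1.1 n‖), sq_nonneg (‖p.1.2 n‖)]

omit [CompleteSpace K] in
theorem eval_smul (p : NormalPair K) (c : ℂ) (A : K →L[ℂ] K) : p.eval (c • A) = c * p.eval A :=
  map_smul p.evalCLM c A

theorem norm_eval_W_le (p : NormalPair K) (f : D) :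
    ‖p.eval (G.W f)‖ ≤ ∑' n, (‖p.1.1 n‖ ^ 2 + ‖p.1.2 n‖ ^ 2) :=
  tsum_of_norm_bounded p.summable_bound.hasSum (norm_term_W_le p f)

theorem continuous_eval_W (p : NormalPair K) : Continuous fun y => p.eval (G.W (r.F y)) :=
  continuous_tsum (fun _ => continuous_const.inner (r.continuous_W _)) p.summable_bound
    fun n y => norm_term_W_le p (r.F y) n

theorem integrable_eval (p : NormalPair K) :
    Integrable (fun y => p.eval (r.w y • G.W (r.F y))) r.μ := by
  simp only [eval_smul]
  exact r.integrable_w.mul_bdd (r.continuous_eval_W p).aestronglyMeasurable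
    (.of_forall fun y => norm_eval_W_le p _)

theorem eval_op (p : NormalPair K) :
    ∫ y, p.eval (r.w y • G.W (r.F y)) ∂r.μ = p.eval r.op := by
  have hle : ∀ n, ∫ y, ‖r.w y * ⟪p.1.1 n, G.W (r.F y) (p.1.2 n)⟫_ℂ‖ ∂r.μ ≤
      (∫ y, ‖r.w y‖ ∂r.μ) * (‖p.1.1 n‖ ^ 2 + ‖p.1.2 n‖ ^ 2) := fun n => by
    rw [← integral_mul_const]
    refine integral_mono (r.integrable_inner r.integrable_w _ _).norm
      (r.integrable_w.norm.mul_const _) fun y => ?_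
    simp only [norm_mul]
    exact mul_le_mul_of_nonneg_left (norm_term_W_le p _ n) (norm_nonneg _)
  have h := hasSum_integral_of_summable_integral_norm
    (F := fun n y => r.w y * ⟪p.1.1 n, G.W (r.F y) (p.1.2 n)⟫_ℂ) (μ := r.μ)
    (fun n => r.integrable_inner r.integrable_w _ _)
    (Summable.of_nonneg_of_le (fun n => integral_nonneg fun _ => norm_nonneg _) hle
      (p.summable_bound.mul_left _))
  simp only [← r.inner_op] at h
  rw [NormalPair.eval, h.tsum_eq]
  refine integral_congr_ae (.of_forall fun y => ?_)
  simp only [eval_smul, tsum_mul_left]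
  rfl

/-! #### Products and brackets -/

/-- Joint continuity: by isometry, moving the vector changes the value by exactly ‖u x − u x₀‖,
whatever the Weyl operator. -/
theorem continuous_W_apply_apply {X : Type*} [TopologicalSpace X] {F : X → D}
    (hF : ∀ ξ, Continuous fun x => G.W (F x) ξ) {u : X → K} (hu : Continuous u) :
    Continuous fun x => G.W (F x) (u x) := by
  refine continuous_iff_continuousAt.2 fun x₀ => ?_
  have h1 : Tendsto (fun x => G.W (F x) (u x - u x₀)) (𝓝 x₀) (𝓝 0) := by
    rw [tendsto_zero_iff_norm_tendsto_zero]
    simp only [G.norm_W_apply]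
    exact tendsto_iff_norm_sub_tendsto_zero.1 (hu.tendsto x₀)
  have h2 := ((hF (u x₀)).tendsto x₀).add h1
  simpa only [ContinuousAt, ← map_add, add_sub_cancel, add_zero] using h2

/-- The integral over a product of parameter spaces of the Weyl operators `W⁰(F(y) + G(z))`. -/
abbrev prodWith (w : r.Y × s.Y → ℂ) (hw : Integrable w (r.μ.prod s.μ)) : Smearing G where
  Y := r.Y × s.Y
  μ := r.μ.prod s.μ
  w := w
  F x := r.F x.1 + s.F x.2
  bound := r.bound + s.bound
  integrable_w := hw
  norm_le x := (norm_add_le _ _).trans (add_le_add (r.norm_le _) (s.norm_le _))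
  continuous_F := (r.continuous_F.comp continuous_fst).add (s.continuous_F.comp continuous_snd)
  continuous_W ξ := by
    simp only [G.W_add_apply]
    exact continuous_W_apply_apply (F := fun x : r.Y × s.Y => r.F x.1)
      (fun ξ => (r.continuous_W ξ).comp continuous_fst) ((s.continuous_W ξ).comp continuous_snd)

theorem continuous_symp : Continuous fun x : r.Y × s.Y =>
    (symp (s.F x.2 : 𝓗) (r.F x.1 : 𝓗) : ℂ) := by
  have h1 : Continuous fun x : r.Y × s.Y => (s.F x.2 : 𝓗) :=
    continuous_subtype_val.comp (s.continuous_F.comp continuous_snd)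
  have h2 : Continuous fun x : r.Y × s.Y => (r.F x.1 : 𝓗) :=
    continuous_subtype_val.comp (r.continuous_F.comp continuous_fst)
  exact Complex.continuous_ofReal.comp (Complex.continuous_im.comp (h1.inner h2))

theorem norm_symp_le (y : r.Y) (z : s.Y) :
    ‖(symp (s.F z : 𝓗) (r.F y : 𝓗) : ℂ)‖ ≤ s.bound * r.bound := by
  rw [Complex.norm_real]
  refine (abs_symp_le _ _).trans ?_
  exact mul_le_mul (s.norm_le z) (r.norm_le y) (norm_nonneg _) ((norm_nonneg _).trans (s.norm_le z))

/-- The product. -/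
abbrev mul : Smearing G :=
  prodWith r s (fun x => r.w x.1 * s.w x.2) (r.integrable_w.mul_prod s.integrable_w)

/-- The Poisson bracket. -/
abbrev bracket : Smearing G :=
  prodWith r s (fun x => r.w x.1 * s.w x.2 * (symp (s.F x.2 : 𝓗) (r.F x.1 : 𝓗) : ℂ))
    ((r.integrable_w.mul_prod s.integrable_w).mul_bdd (r.continuous_symp s).aestronglyMeasurable
      (.of_forall fun x => r.norm_symp_le s x.1 x.2))

/-- The adjoint. -/
abbrev adjoint : Smearing G where
  Y := r.Y
  μ := r.μ
  w y := starRingEnd ℂ (r.w y)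
  F y := -r.F y
  bound := r.bound
  integrable_w := (RCLike.conjLIE (K := ℂ)).toContinuousLinearEquiv.toContinuousLinearMap.integrable_comp
    r.integrable_w
  norm_le y := by rw [norm_neg]; exact r.norm_le y
  continuous_F := r.continuous_F.neg
  continuous_W ξ := by
    refine continuous_iff_continuousAt.2 fun y₀ => ?_
    rw [ContinuousAt, tendsto_iff_norm_sub_tendsto_zero]
    -- Applying the isometry W(F y) turns ‖W(−F y)ξ − W(−F y₀)ξ‖ into ‖ξ − W(F y)W(−F y₀)ξ‖, so
    -- continuity of W(F ·) at the single vector W(−F y₀)ξ suffices.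
    have h := tendsto_iff_norm_sub_tendsto_zero.1
      ((r.continuous_W (G.W (-r.F y₀) ξ)).tendsto y₀)
    refine h.congr fun y => ?_
    rw [← G.norm_W_apply (-r.F y), map_sub, ← G.W_add_apply, ← G.W_add_apply, ← G.W_add_apply,
      neg_add_cancel, zero_add, ← G.W_add_apply, add_neg_cancel_right, norm_sub_rev]

theorem op_adjoint : r.adjoint.op = star r.op := by
  ext ξ
  refine ext_inner_left ℂ fun η => ?_
  rw [ContinuousLinearMap.star_eq_adjoint, ContinuousLinearMap.adjoint_inner_right,
    inner_op, ← inner_conj_symm (r.op η), inner_op, ← integral_conj]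
  refine integral_congr_ae (.of_forall fun y => ?_)
  simp only [map_mul, inner_conj_symm, G.inner_W_left]

theorem op_mul : (r.mul s).op = r.op * s.op := by
  ext ξ
  rw [mul_apply_eq_comp, op_apply, op_apply]
  rw [integral_prod _ ((r.mul s).integrable_W (r.mul s).integrable_w ξ)]
  refine integral_congr_ae (.of_forall fun y => ?_)
  simp only [G.W_add_apply, mul_smul]
  rw [integral_smul, s.op_apply, ← (G.W (r.F y)).integral_comp_comm
    (s.integrable_W s.integrable_w ξ)]
  simp only [map_smul]

theorem op_eq_integral_comp {X : Type*} [MeasurableSpace X] {ν : Measure X} (e : X ≃ᵐ r.Y)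
    (he : MeasurePreserving e ν r.μ) (ξ : K) :
    r.op ξ = ∫ x, r.w (e x) • G.W (r.F (e x)) ξ ∂ν :=
  (he.integral_comp' (g := fun y => r.w y • G.W (r.F y) ξ)).symm

theorem integrable_comp {X : Type*} [MeasurableSpace X] {ν : Measure X} (e : X ≃ᵐ r.Y)
    (he : MeasurePreserving e ν r.μ) (ξ : K) :
    Integrable (fun x => r.w (e x) • G.W (r.F (e x)) ξ) ν :=
  (he.integrable_comp_emb e.measurableEmbedding).2 (r.integrable_W r.integrable_w ξ)

theorem op_bracket_swap : (s.bracket r).op = -(r.bracket s).op := by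
  ext ξ
  rw [neg_apply, (s.bracket r).op_eq_integral_comp (X := r.Y × s.Y) .prodComm Measure.measurePreserving_swap,
    op_apply, ← integral_neg]
  refine integral_congr_ae (.of_forall fun x => ?_)
  change (s.w x.2 * r.w x.1 * (symp (r.F x.1 : 𝓗) (s.F x.2 : 𝓗) : ℂ)) •
    G.W (s.F x.2 + r.F x.1) ξ = _
  rw [symp_swap, add_comm]
  refine (congrArg (· • _) ?_).trans (neg_smul _ _)
  push_cast
  ring

theorem op_bracket_adjoint : (r.adjoint.bracket s.adjoint).op = star (r.bracket s).op := by
  rw [← op_adjoint]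
  ext ξ
  refine integral_congr_ae (.of_forall fun x => ?_)
  simp [symp_neg_left, symp_neg_right, add_comm]

/-- The cyclic permutation of three parameter spaces. -/
abbrev cyc (X Y Z : Type*) [MeasurableSpace X] [MeasurableSpace Y] [MeasurableSpace Z] :
    X × Y × Z ≃ᵐ Y × Z × X :=
  MeasurableEquiv.prodComm.trans .prodAssoc

theorem measurePreserving_cyc {X Y Z : Type*} [MeasurableSpace X] [MeasurableSpace Y]
    [MeasurableSpace Z] (μ : Measure X) (ν : Measure Y) (ρ : Measure Z) [SFinite μ] [SFinite ν]
    [SFinite ρ] : MeasurePreserving (cyc X Y Z) (μ.prod (ν.prod ρ)) (ν.prod (ρ.prod μ)) :=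
  (measurePreserving_prodAssoc ν ρ μ).comp Measure.measurePreserving_swap

/-- After the parameter spaces are brought into one order, the Leibniz rule is additivity of σ in
its first slot. -/
theorem op_bracket_mul :
    (r.bracket (s.mul q)).op = ((r.bracket s).mul q).op + (s.mul (r.bracket q)).op := by
  ext ξ
  let e₁ : r.Y × s.Y × q.Y ≃ᵐ (r.Y × s.Y) × q.Y := MeasurableEquiv.prodAssoc.symm
  let e₂ : r.Y × s.Y × q.Y ≃ᵐ s.Y × r.Y × q.Y :=
    (cyc _ _ _).trans (.prodCongr (.refl _) .prodComm)
  have h₁ : MeasurePreserving e₁ (r.μ.prod (s.μ.prod q.μ)) ((r.bracket s).mul q).μ :=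
    (measurePreserving_prodAssoc r.μ s.μ q.μ).symm _
  have h₂ : MeasurePreserving e₂ (r.μ.prod (s.μ.prod q.μ)) (s.mul (r.bracket q)).μ :=
    ((MeasurePreserving.id s.μ).prod Measure.measurePreserving_swap).comp
      (measurePreserving_cyc r.μ s.μ q.μ)
  rw [add_apply, ((r.bracket s).mul q).op_eq_integral_comp e₁ h₁, (s.mul (r.bracket q)).op_eq_integral_comp e₂ h₂,
    ← integral_add (((r.bracket s).mul q).integrable_comp e₁ h₁ ξ) ((s.mul (r.bracket q)).integrable_comp e₂ h₂ ξ), op_apply]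
  refine integral_congr_ae (.of_forall fun x => ?_)
  obtain ⟨y, z, v⟩ := x
  change (r.w y * (s.w z * q.w v) * (symp ((s.F z + q.F v : D) : 𝓗) (r.F y : 𝓗) : ℂ)) •
      G.W (r.F y + (s.F z + q.F v)) ξ =
    (r.w y * s.w z * (symp (s.F z : 𝓗) (r.F y : 𝓗) : ℂ) * q.w v) •
      G.W (r.F y + s.F z + q.F v) ξ +
    (s.w z * (r.w y * q.w v * (symp (q.F v : 𝓗) (r.F y : 𝓗) : ℂ))) •
      G.W (s.F z + (r.F y + q.F v)) ξ
  rw [add_assoc, add_left_comm (s.F z), ← add_smul, Submodule.coe_add, symp_add_left]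
  congr 1
  push_cast
  ring

/-- All three terms carry the same Weyl operator; their weights expand into six products of two
values of σ, cancelling in pairs by antisymmetry. -/
theorem op_bracket_jacobi : (r.bracket (s.bracket q)).op + (s.bracket (q.bracket r)).op +
    (q.bracket (r.bracket s)).op = 0 := by
  ext ξ
  let e₁ : r.Y × s.Y × q.Y ≃ᵐ s.Y × q.Y × r.Y := cyc _ _ _
  let e₂ : r.Y × s.Y × q.Y ≃ᵐ q.Y × r.Y × s.Y := (cyc _ _ _).trans (cyc _ _ _)
  have h₁ : MeasurePreserving e₁ (r.μ.prod (s.μ.prod q.μ)) (s.bracket (q.bracket r)).μ :=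
    measurePreserving_cyc r.μ s.μ q.μ
  have h₂ : MeasurePreserving e₂ (r.μ.prod (s.μ.prod q.μ)) (q.bracket (r.bracket s)).μ :=
    (measurePreserving_cyc s.μ q.μ r.μ).comp (measurePreserving_cyc r.μ s.μ q.μ)
  have h₀ := (r.bracket (s.bracket q)).integrable_W (r.bracket (s.bracket q)).integrable_w ξ
  rw [add_apply, add_apply, (s.bracket (q.bracket r)).op_eq_integral_comp e₁ h₁, (q.bracket (r.bracket s)).op_eq_integral_comp e₂ h₂, op_apply,
    ← integral_add h₀ ((s.bracket (q.bracket r)).integrable_comp e₁ h₁ ξ)]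
  refine (integral_add (h₀.add ((s.bracket (q.bracket r)).integrable_comp e₁ h₁ ξ))
    ((q.bracket (r.bracket s)).integrable_comp e₂ h₂ ξ)).symm.trans ?_
  refine (integral_congr_ae (.of_forall fun x => ?_)).trans (integral_zero _ _)
  obtain ⟨y, z, v⟩ := x
  change (r.w y * (s.w z * q.w v * (symp (q.F v : 𝓗) (s.F z : 𝓗) : ℂ)) *
        (symp ((s.F z + q.F v : D) : 𝓗) (r.F y : 𝓗) : ℂ)) • G.W (r.F y + (s.F z + q.F v)) ξ +
      (s.w z * (q.w v * r.w y * (symp (r.F y : 𝓗) (q.F v : 𝓗) : ℂ)) *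
        (symp ((q.F v + r.F y : D) : 𝓗) (s.F z : 𝓗) : ℂ)) • G.W (s.F z + (q.F v + r.F y)) ξ +
      (q.w v * (r.w y * s.w z * (symp (s.F z : 𝓗) (r.F y : 𝓗) : ℂ)) *
        (symp ((r.F y + s.F z : D) : 𝓗) (q.F v : 𝓗) : ℂ)) • G.W (q.F v + (r.F y + s.F z)) ξ = 0
  have a₁ : s.F z + (q.F v + r.F y) = r.F y + (s.F z + q.F v) := by abel
  have a₂ : q.F v + (r.F y + s.F z) = r.F y + (s.F z + q.F v) := by abel
  rw [a₁, a₂, ← add_smul, ← add_smul]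
  refine (congrArg (· • _) ?_).trans (zero_smul ℂ _)
  simp only [Submodule.coe_add, symp_add_left]
  rw [symp_swap (r.F y : 𝓗) (q.F v : 𝓗), symp_swap (s.F z : 𝓗) (q.F v : 𝓗),
    symp_swap (r.F y : 𝓗) (s.F z : 𝓗)]
  push_cast
  ring

end Smearing

namespace IsWeakKMS

variable {H : 𝓗 →ₗ.[ℂ] 𝓗} {hD : IsTestSpace H D} {β : ℝ} {G : GNSTriple ω K}

/-- The functional `A ↦ -β ⟨Ω, A W(k) i Φ(iHg) Ω⟩ + σ(k, g) ⟨Ω, A W(k) Ω⟩` through which the weak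
KMS condition expresses the bracket with `W⁰(g)`. -/
def bracketFunctional (G : GNSTriple ω K) (hD : IsTestSpace H D) (β : ℝ) (g k : D) :
    (K →L[ℂ] K) →L[ℂ] ℂ :=
  (-β : ℂ) • (innerSL ℂ G.Ω ∘L ContinuousLinearMap.apply ℂ K (G.W k (G.fieldVec (hD.iH g)))) +
    (symp (k : 𝓗) (g : 𝓗) : ℂ) • (innerSL ℂ G.Ω ∘L ContinuousLinearMap.apply ℂ K (G.W k G.Ω))

variable (hω : IsWeakKMS hD β ω G)
include hω

/-- The left side depends on the representation F, w of the operator, the right side only on the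
operator. The weak KMS condition at F(y) + k in the direction iHg trades the factor σ(g, F(y)) for
the field vector of iHg, which no longer involves y. -/
theorem integral_symp_mul_genFun (r : Smearing G) (g k : D) :
    ∫ y, r.w y * (symp (g : 𝓗) (r.F y : 𝓗) : ℂ) * G.genFun (r.F y + k) ∂r.μ =
      bracketFunctional G hD β g k r.op := by
  have h1 : ∀ y, r.w y * (symp (g : 𝓗) (r.F y : 𝓗) : ℂ) * G.genFun (r.F y + k) =
      (-β : ℂ) * (r.w y * ⟪G.Ω, G.W (r.F y) (G.W k (G.fieldVec (hD.iH g)))⟫_ℂ) +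
        (symp (k : 𝓗) (g : 𝓗) : ℂ) * (r.w y * ⟪G.Ω, G.W (r.F y) (G.W k G.Ω)⟫_ℂ) := fun y => by
    have h2 := hω.symp_mul_genFun (r.F y + k) g
    rw [G.W_add_apply, Submodule.coe_add, symp_add_left, symp_swap (g : 𝓗)] at h2
    have h3 : ⟪G.Ω, G.W (r.F y) (G.W k G.Ω)⟫_ℂ = G.genFun (r.F y + k) := by
      rw [← G.W_add_apply]; rfl
    rw [h3]
    push_cast at h2
    linear_combination (-r.w y) * h2
  simp only [h1]
  rw [integral_add ((r.integrable_inner r.integrable_w _ _).const_mul _)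
    ((r.integrable_inner r.integrable_w _ _).const_mul _), integral_const_mul, integral_const_mul,
    ← r.inner_op, ← r.inner_op]
  rfl

/-- Fubini with the variable of `r` integrated first, so that `r` enters only through its operator.
-/
theorem inner_op_bracket_W (r s : Smearing G) (k : D) :
    Integrable (fun z => s.w z * bracketFunctional G hD β (s.F z) (s.F z + k) r.op) s.μ ∧
    ⟪G.Ω, (r.bracket s).op (G.W k G.Ω)⟫_ℂ =
      ∫ z, s.w z * bracketFunctional G hD β (s.F z) (s.F z + k) r.op ∂s.μ := by
  have hi := (r.bracket s).integrable_genFun (r.bracket s).integrable_w k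
  have h1 : ∀ z, ∫ y, (r.bracket s).w (y, z) * G.genFun ((r.bracket s).F (y, z) + k) ∂r.μ =
      s.w z * bracketFunctional G hD β (s.F z) (s.F z + k) r.op := fun z => by
    rw [← hω.integral_symp_mul_genFun, ← integral_const_mul]
    refine integral_congr_ae (.of_forall fun y => ?_)
    simp only [add_assoc]
    ring
  refine ⟨?_, ?_⟩
  · simpa only [h1] using hi.integral_prod_right
  · rw [Smearing.inner_op_W, integral_prod_symm _ hi]
    exact integral_congr_ae (.of_forall h1)

/-- The bracket depends on the first factor only through the operator, in a linear way. -/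
theorem sum_smul_op_bracket {ι : Type*} (I : Finset ι) (c : ι → ℂ) (r : ι → Smearing G)
    (h : ∑ i ∈ I, c i • (r i).op = 0) (s : Smearing G) :
    ∑ i ∈ I, c i • ((r i).bracket s).op = 0 := by
  -- By linearity of the functional, every moment of the combination vanishes.
  refine G.ext_of_moments (sum_mem fun i _ => G.vN.toStarSubalgebra.smul_mem (Smearing.op_mem_vN _) _)
    (zero_mem _) fun k => ?_
  simp only [sum_apply, smul_apply, inner_sum, inner_smul_right, hω.inner_op_bracket_W, zero_apply,
    inner_zero_right]
  simp only [← integral_const_mul]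
  rw [← integral_finsetSum _ fun i _ => (hω.inner_op_bracket_W (r i) s k).1.const_mul _]
  refine (integral_congr_ae (.of_forall fun z => ?_)).trans (integral_zero _ _)
  have h2 := congrArg (bracketFunctional G hD β (s.F z) (s.F z + k)) h
  simp only [map_sum, map_smul, map_zero, smul_eq_mul] at h2
  simp only [mul_left_comm _ (s.w z), ← Finset.mul_sum, h2, mul_zero]

theorem op_bracket_congr_left {r r' : Smearing G} (h : r.op = r'.op) (s : Smearing G) :
    (r.bracket s).op = (r'.bracket s).op := by
  have := hω.sum_smul_op_bracket (Finset.univ : Finset (Fin 2)) ![1, -1] ![r, r'] (by simp [h]) s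
  simp only [Fin.sum_univ_two, Matrix.cons_val_zero, Matrix.cons_val_one, one_smul, neg_smul] at this
  exact add_neg_eq_zero.1 this

/-- The second slot follows from the first by antisymmetry. -/
theorem op_bracket_congr {r r' s s' : Smearing G} (h : r.op = r'.op) (h' : s.op = s'.op) :
    (r.bracket s).op = (r'.bracket s').op := by
  rw [hω.op_bracket_congr_left h, ← neg_inj, ← Smearing.op_bracket_swap,
    ← Smearing.op_bracket_swap, hω.op_bracket_congr_left h']

end IsWeakKMS
end Smearing

/-! ### Differentiating the state along the flow of smeared elements. -/

section FlowOfSmearing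

variable {𝓗 : Type u} [NormedAddCommGroup 𝓗] [InnerProductSpace ℂ 𝓗] [CompleteSpace 𝓗]
  {D : Submodule ℂ 𝓗}
  {ω : WeylState D} {K : Type v} [NormedAddCommGroup K] [InnerProductSpace ℂ K] [CompleteSpace K]
  {H : 𝓗 →ₗ.[ℂ] 𝓗} {hD : IsTestSpace H D} {β : ℝ} {G : GNSTriple ω K}

namespace IsTestSpace

variable (hD) (hsa : IsSelfAdjoint H)
include hsa

theorem isometry_evol (t : ℝ) : Isometry (hD.evol t) := by
  refine Isometry.of_dist_eq fun f g => ?_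
  rw [dist_eq_norm, dist_eq_norm, ← hD.evol_sub hsa, hD.norm_evol hsa]

theorem hasDerivAt_timeIntegral (f : D) :
    HasDerivAt (fun t => (hD.timeIntegral t f : 𝓗)) (f : 𝓗) 0 := by
  have hc : Continuous fun s => (hD.evol s f : 𝓗) :=
    continuous_subtype_val.comp (hD.continuous_evol hsa f)
  have h := intervalIntegral.integral_hasDerivAt_right (hc.intervalIntegrable 0 0)
    hc.aestronglyMeasurable.stronglyMeasurableAtFilter hc.continuousAt
  rw [hD.evol_zero hsa] at h
  exact h

end IsTestSpace

namespace IsWeakKMS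

variable (hω : IsWeakKMS hD β ω G) (hsa : IsSelfAdjoint H)

/-- The smearing moved along the flow. -/
abbrev evolve (t : ℝ) (r : Smearing G) : Smearing G where
  Y := r.Y
  μ := r.μ
  w := r.w
  F y := hD.evol t (r.F y)
  bound := r.bound
  integrable_w := r.integrable_w
  norm_le y := (hD.norm_evol hsa t _).trans_le (r.norm_le y)
  continuous_F := (hD.isometry_evol hsa t).continuous.comp r.continuous_F
  continuous_W ξ := by
    -- The moved Weyl operator is the conjugate of the old one by the unitary of the flow, so strong
    -- continuity is inherited.
    have h : ∀ y, G.W (hD.evol t (r.F y)) ξ =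
        G.flowOp hD t (G.W (r.F y) (G.flowOp hD (-t) ξ)) := fun y => by
      rw [← mul_apply_eq_comp, hω.flowOp_W hsa, mul_apply_eq_comp, ← mul_apply_eq_comp _ _ ξ,
        hω.flowOp_mul_neg hsa, one_apply_eq_self]
    simp only [h]
    exact (G.flowOp hD t).continuous.comp (r.continuous_W _)

theorem op_evolve (t : ℝ) (r : Smearing G) :
    (hω.evolve hsa t r).op = G.flowOp hD t * r.op * G.flowOp hD (-t) := by
  ext ξ
  rw [mul_apply_eq_comp, mul_apply_eq_comp, r.op_apply,
    ← (G.flowOp hD t).integral_comp_comm (r.integrable_W r.integrable_w _)]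
  refine integral_congr_ae (.of_forall fun y => ?_)
  simp only [map_smul]
  rw [← mul_apply_eq_comp (G.flowOp hD t), hω.flowOp_W hsa, mul_apply_eq_comp,
    ← mul_apply_eq_comp _ _ ξ, hω.flowOp_mul_neg hsa, one_apply_eq_self]

/-- The exponent in the change of the generating function along the flow. -/
def flowExponent (hD : IsTestSpace H D) (β : ℝ) (g f : D) (t : ℝ) : ℝ :=
  β⁻¹ * (symp ((g + f : D) : 𝓗) (hD.timeIntegral t f) +
    symp (hD.iH (hD.timeIntegral t f) : 𝓗) (hD.timeIntegral t f) / 2)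

-- Linear in |t| and uniform on bounded sets of vectors: this provides the dominating function for
-- the difference quotients.
include hsa in
omit [CompleteSpace K] in
theorem abs_flowExponent_le (g f : D) (t : ℝ) :
    |flowExponent hD β g f t| ≤ |β⁻¹| * (((‖g‖ + 2 * ‖f‖) * ‖f‖) * |t|) := by
  rw [flowExponent, abs_mul]
  refine mul_le_mul_of_nonneg_left ((abs_add_le _ _).trans ?_) (abs_nonneg _)
  have h1 : |symp ((g + f : D) : 𝓗) (hD.timeIntegral t f : 𝓗)| ≤ (‖g‖ + ‖f‖) * (|t| * ‖f‖) :=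
    (abs_symp_le _ _).trans (mul_le_mul (norm_add_le g f) (hD.norm_timeIntegral_le hsa t f)
      (norm_nonneg _) (by positivity))
  have h2 : |symp (hD.iH (hD.timeIntegral t f) : 𝓗) (hD.timeIntegral t f : 𝓗)| ≤
      (2 * ‖f‖) * (|t| * ‖f‖) :=
    (abs_symp_le _ _).trans (mul_le_mul (hD.norm_iH_timeIntegral_le hsa t f)
      (hD.norm_timeIntegral_le hsa t f) (norm_nonneg _) (by positivity))
  rw [abs_div, abs_two]
  linarith

-- As t → 0 the time integral divided by t tends to `f`, while iH of the time integral, e^{itH}f −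
-- f, tends to 0. Only σ(g + f, f) = σ(g, f) survives.
include hsa in
theorem hasDerivAt_flowExponent (g f : D) :
    HasDerivAt (flowExponent hD β g f) (β⁻¹ * symp (g : 𝓗) f) 0 := by
  have h0 : ∀ f : D, hD.timeIntegral 0 f = 0 := fun f => Subtype.ext intervalIntegral.integral_same
  have hz : flowExponent hD β g f 0 = 0 := by
    simp [flowExponent, h0, symp]
  have hI : Tendsto (fun t : ℝ => t⁻¹ • (hD.timeIntegral t f : 𝓗)) (𝓝[≠] 0) (𝓝 (f : 𝓗)) := by
    have := hasDerivAt_iff_tendsto_slope_zero.1 (hD.hasDerivAt_timeIntegral hsa f)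
    simpa [h0] using this
  have hs : ∀ a b : 𝓗, ∀ t : ℝ, symp a (t⁻¹ • b) = t⁻¹ * symp a b := fun a b t => by
    simp [symp]
  have hcs : Continuous fun x : 𝓗 × 𝓗 => symp x.1 x.2 :=
    Complex.continuous_im.comp (continuous_fst.inner continuous_snd)
  have he : Tendsto (fun t => (hD.evol t f : 𝓗) - f) (𝓝[≠] 0) (𝓝 0) := by
    have h1 : Continuous fun s => (hD.evol s f : 𝓗) - f :=
      (continuous_subtype_val.comp (hD.continuous_evol hsa f)).sub continuous_const
    have := h1.tendsto 0
    rw [hD.evol_zero hsa, sub_self] at this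
    exact this.mono_left nhdsWithin_le_nhds
  have h1 := (hcs.tendsto (((g + f : D) : 𝓗), (f : 𝓗))).comp
    ((tendsto_const_nhds (x := ((g + f : D) : 𝓗)) (f := 𝓝[≠] (0 : ℝ))).prodMk_nhds hI)
  have h2 := (hcs.tendsto ((0 : 𝓗), (f : 𝓗))).comp (he.prodMk_nhds hI)
  rw [hasDerivAt_iff_tendsto_slope_zero]
  have h3 := (h1.add (h2.div_const 2)).const_mul β⁻¹
  have h4 : symp (0 : 𝓗) (f : 𝓗) = 0 := by simp [symp]
  simp only [Submodule.coe_add, symp_add_left, symp_self, h4, zero_div, add_zero] at h3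
  refine h3.congr fun t => ?_
  rw [hz, sub_zero]
  simp only [zero_add, Function.comp, hs, flowExponent, hD.iH_timeIntegral hsa,
    smul_eq_mul, Submodule.coe_sub, Submodule.coe_add, symp_add_left]
  ring

include hω hsa

/-- The prefactor β cancels the β⁻¹ of the exponent; keeping it inside the limit lets β = 0 pass as
well. -/
theorem tendsto_genFun_add_evol (g f : D) :
    Tendsto (fun t : ℝ => (β : ℂ) * ((t : ℂ)⁻¹ * (G.genFun (g + hD.evol t f) - G.genFun (g + f))))
      (𝓝[≠] 0) (𝓝 ((symp (g : 𝓗) (f : 𝓗) : ℂ) * G.genFun (g + f))) := by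
  have hz : flowExponent hD β g f 0 = 0 := by
    have := abs_flowExponent_le (β := β) (hD := hD) hsa g f 0
    rw [abs_zero, mul_zero, mul_zero] at this
    exact abs_nonpos_iff.1 this
  have h1 := (hasDerivAt_flowExponent (β := β) (hD := hD) hsa g f).ofReal_comp.cexp
  have h2 := hasDerivAt_iff_tendsto_slope_zero.1 h1
  simp only [hz, Complex.ofReal_zero, Complex.exp_zero, one_mul, zero_add] at h2
  have h3 := (h2.mul_const (G.genFun (g + f))).const_mul (β : ℂ)
  have h4 : (β : ℂ) * ((β⁻¹ * symp (g : 𝓗) (f : 𝓗) : ℝ) * G.genFun (g + f)) =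
      (symp (g : 𝓗) (f : 𝓗) : ℂ) * G.genFun (g + f) := by
    rw [← mul_assoc, ← Complex.ofReal_mul, hω.beta_mul_inv_mul_symp]
  rw [h4] at h3
  refine h3.congr fun t => ?_
  rw [hω.genFun_add_evol hsa, ← flowExponent, Complex.real_smul, Complex.ofReal_inv]
  ring

theorem norm_genFun_add_evol_sub_le (g f : D) {t B : ℝ} (ht : t ≠ 0)
    (hB : |β⁻¹| * ((‖g‖ + 2 * ‖f‖) * ‖f‖) ≤ B) (hBt : B * |t| ≤ 1) :
    ‖(β : ℂ) * ((t : ℂ)⁻¹ * (G.genFun (g + hD.evol t f) - G.genFun (g + f)))‖ ≤ |β| * (2 * B) := by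
  have h1 : |flowExponent hD β g f t| ≤ B * |t| :=
    (abs_flowExponent_le hsa g f t).trans (by
      rw [← mul_assoc]; exact mul_le_mul_of_nonneg_right hB (abs_nonneg _))
  rw [hω.genFun_add_evol hsa, ← flowExponent, ← mul_sub_one, norm_mul, norm_mul, norm_mul, norm_inv,
    Complex.norm_real, Complex.norm_real, ← Complex.ofReal_exp, ← Complex.ofReal_one,
    ← Complex.ofReal_sub, Complex.norm_real, Real.norm_eq_abs, Real.norm_eq_abs, Real.norm_eq_abs]
  refine mul_le_mul_of_nonneg_left ?_ (abs_nonneg _)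
  have h2 := (Real.abs_exp_sub_one_le (h1.trans hBt)).trans (mul_le_mul_of_nonneg_left h1 zero_le_two)
  have ht' : 0 < |t| := abs_pos.2 ht
  rw [inv_mul_le_iff₀ ht']
  calc _ ≤ 1 * (2 * (B * |t|)) := mul_le_mul (G.norm_genFun_le _) h2 (abs_nonneg _) zero_le_one
    _ = _ := by ring

/-- The derivative at `t = 0` of `β ω(τ_t(A) B)` is `ω({A, B})`. -/
theorem tendsto_inner_evolve_mul (r s : Smearing G) :
    Tendsto (fun t : ℝ => (β : ℂ) * ((t : ℂ)⁻¹ *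
        (⟪G.Ω, (G.flowOp hD t * r.op * G.flowOp hD (-t) * s.op) G.Ω⟫_ℂ -
          ⟪G.Ω, (r.op * s.op) G.Ω⟫_ℂ)))
      (𝓝[≠] 0) (𝓝 ⟪G.Ω, (r.bracket s).op G.Ω⟫_ℂ) := by
  have hΩ : ∀ q : Smearing G, ⟪G.Ω, q.op G.Ω⟫_ℂ = ∫ y, q.w y * G.genFun (q.F y) ∂q.μ := fun q => by
    have := q.inner_op_W 0
    simpa only [G.W_zero, one_apply_eq_self, add_zero] using this
  have hi : ∀ q : Smearing G, Integrable (fun y => q.w y * G.genFun (q.F y)) q.μ := fun q => by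
    simpa only [add_zero] using q.integrable_genFun q.integrable_w 0
  have h1 : ∀ t : ℝ, (β : ℂ) * ((t : ℂ)⁻¹ *
      (⟪G.Ω, (G.flowOp hD t * r.op * G.flowOp hD (-t) * s.op) G.Ω⟫_ℂ -
        ⟪G.Ω, (r.op * s.op) G.Ω⟫_ℂ)) =
      ∫ x : r.Y × s.Y, (r.w x.1 * s.w x.2) * ((β : ℂ) * ((t : ℂ)⁻¹ *
        (G.genFun (s.F x.2 + hD.evol t (r.F x.1)) - G.genFun (s.F x.2 + r.F x.1))))
          ∂(r.μ.prod s.μ) := fun t => by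
    rw [← hω.op_evolve hsa, ← Smearing.op_mul, ← Smearing.op_mul, hΩ, hΩ,
      ← integral_sub (hi ((hω.evolve hsa t r).mul s)) (hi (r.mul s)), ← integral_const_mul,
      ← integral_const_mul]
    refine integral_congr_ae (.of_forall fun x => ?_)
    simp only [add_comm (s.F x.2)]
    ring
  simp only [h1]
  rw [hΩ]
  -- Both families F are bounded, so one constant serves all parameters. For B|t| ≤ 1, the
  -- inequality |eˣ − 1| ≤ 2|x| bounds the quotients by 2|β|B.
  set B : ℝ := |β⁻¹| * ((s.bound + 2 * r.bound) * r.bound) with hBdef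
  have hbd : ∀ x : r.Y × s.Y,
      |β⁻¹| * ((‖s.F x.2‖ + 2 * ‖r.F x.1‖) * ‖r.F x.1‖) ≤ B := fun x => by
    have a1 := s.norm_le x.2
    have a2 := r.norm_le x.1
    have a3 := norm_nonneg (s.F x.2)
    have a4 := norm_nonneg (r.F x.1)
    rw [hBdef]
    gcongr
    linarith
  have hsmall : ∀ᶠ t : ℝ in 𝓝[≠] 0, t ≠ 0 ∧ B * |t| ≤ 1 := by
    refine eventually_mem_nhdsWithin.and (eventually_nhdsWithin_of_eventually_nhds ?_)
    have hc : Continuous fun t : ℝ => B * |t| := by fun_prop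
    have := hc.tendsto 0
    simp only [abs_zero, mul_zero] at this
    exact this.eventually_le_const one_pos
  have hw := r.integrable_w.mul_prod s.integrable_w
  refine tendsto_integral_filter_of_dominated_convergence
    (fun x => ‖r.w x.1 * s.w x.2‖ * (|β| * (2 * B))) (.of_forall fun t => ?_) ?_
    (hw.norm.mul_const _) (.of_forall fun x => ?_)
  · have a1 := (hi ((hω.evolve hsa t r).mul s)).1
    have a2 := (hi (r.mul s)).1
    refine (((a1.sub a2).const_mul (t : ℂ)⁻¹).const_mul (β : ℂ)).congr (.of_forall fun x => ?_)
    simp only [add_comm (s.F x.2), Pi.sub_apply]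
    ring
  · filter_upwards [hsmall] with t ht
    refine .of_forall fun x => ?_
    rw [norm_mul]
    exact mul_le_mul_of_nonneg_left
      (hω.norm_genFun_add_evol_sub_le hsa _ _ ht.1 (hbd x) ht.2) (norm_nonneg _)
  · have := (hω.tendsto_genFun_add_evol hsa (s.F x.2) (r.F x.1)).const_mul (r.w x.1 * s.w x.2)
    simp only [mul_assoc, add_comm (s.F x.2)] at this ⊢
    exact this

end IsWeakKMS
end FlowOfSmearing

/-! ### The generating smearings over ℝⁿ and their closure properties. -/

section Generators

variable {𝓗 : Type u} [NormedAddCommGroup 𝓗] [InnerProductSpace ℂ 𝓗] [CompleteSpace 𝓗]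
  {D : Submodule ℂ 𝓗} {H : 𝓗 →ₗ.[ℂ] 𝓗} {n m : ℕ}

namespace IsTestSpace

variable (hD : IsTestSpace H D) (hsa : IsSelfAdjoint H)
include hsa

theorem evol_sum {ι : Type*} (s : Finset ι) (t : ℝ) (f : ι → D) :
    hD.evol t (∑ i ∈ s, f i) = ∑ i ∈ s, hD.evol t (f i) :=
  map_sum (AddMonoidHom.mk' (hD.evol t) (hD.evol_add hsa t)) f s

theorem multiEvol_evol (t : ℝ) (f : Fin n → D) (s : EuclideanSpace ℝ (Fin n)) :
    hD.multiEvol (fun i => hD.evol t (f i)) s = hD.evol t (hD.multiEvol f s) := by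
  rw [multiEvol, multiEvol, hD.evol_sum hsa]
  simp only [← hD.evol_add_time hsa, add_comm]

theorem evol_multiEvol (t : ℝ) (f : Fin n → D) (s : EuclideanSpace ℝ (Fin n)) :
    hD.evol t (hD.multiEvol f s) = hD.multiEvol f (s + WithLp.toLp 2 fun _ => t) := by
  rw [multiEvol, multiEvol, hD.evol_sum hsa]
  refine Finset.sum_congr rfl fun i _ => ?_
  rw [← hD.evol_add_time hsa, add_comm]
  rfl

omit [CompleteSpace 𝓗] hsa in
theorem multiEvol_append (f : Fin n → D) (g : Fin m → D) (x : EuclideanSpace ℝ (Fin (n + m))) :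
    hD.multiEvol (Fin.append f g) x =
      hD.multiEvol f (splitEquiv n m x).1 + hD.multiEvol g (splitEquiv n m x).2 := by
  simp only [multiEvol, Fin.sum_univ_add, Fin.append_left, Fin.append_right, splitEquiv_fst,
    splitEquiv_snd]

theorem norm_multiEvol_le (f : Fin n → D) (s : EuclideanSpace ℝ (Fin n)) :
    ‖hD.multiEvol f s‖ ≤ ∑ i, ‖f i‖ :=
  (norm_sum_le _ _).trans (Finset.sum_le_sum fun _ _ => (hD.norm_evol hsa _ _).le)

theorem continuous_multiEvol (f : Fin n → D) : Continuous (hD.multiEvol f) := by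
  refine continuous_finsetSum _ fun _ _ => (hD.continuous_evol hsa _).comp ?_
  fun_prop

theorem mul_inner_evol_self_mem_fourierClass {χ : EuclideanSpace ℝ (Fin n) → ℂ}
    (h : χ ∈ fourierClass n) (c : EuclideanSpace ℝ (Fin n)) (f : D) :
    (fun t => χ t * ⟪f, hD.evol (inner ℝ c t) f⟫_ℂ) ∈ fourierClass n := by
  classical
  obtain ⟨T, hT, hm⟩ := hD.exists_model hsa {f}
  obtain ⟨μ, hμ, ⟨R, hR⟩, hmom⟩ := exists_spectral_measure hT (f : 𝓗)
  have h1 : ∀ s : ℝ, ⟪f, hD.evol s f⟫_ℂ = ∫ x : ℝ, Complex.exp ((s * x : ℝ) * Complex.I) ∂μ :=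
    fun s => by
      rw [← inner_flow_eq_integral hR hmom, ← expI_eq_flow (hm f (by simp))]
      rfl
  simp only [h1]
  exact mul_charFun_mem_fourierClass h c hR

theorem inner_evol_polarization (t : ℝ) (f g : D) : ⟪g, hD.evol t f⟫_ℂ =
    (1 / 4 : ℂ) * (⟪f + g, hD.evol t (f + g)⟫_ℂ - ⟪f - g, hD.evol t (f - g)⟫_ℂ +
      Complex.I * (⟪f + Complex.I • g, hD.evol t (f + Complex.I • g)⟫_ℂ -
        ⟪f - Complex.I • g, hD.evol t (f - Complex.I • g)⟫_ℂ)) := by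
  simp only [hD.evol_add hsa, hD.evol_sub hsa, hD.evol_smul hsa, inner_add_left, inner_add_right,
    inner_sub_left, inner_sub_right, inner_smul_left, inner_smul_right, Complex.conj_I]
  ring_nf
  simp only [Complex.I_sq]
  ring

theorem mul_inner_evol_mem_fourierClass {χ : EuclideanSpace ℝ (Fin n) → ℂ}
    (h : χ ∈ fourierClass n) (c : EuclideanSpace ℝ (Fin n)) (f g : D) :
    (fun t => χ t * ⟪g, hD.evol (inner ℝ c t) f⟫_ℂ) ∈ fourierClass n := by
  have hv := hD.mul_inner_evol_self_mem_fourierClass hsa h c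
  convert (fourierClass n).smul_mem (1 / 4 : ℂ) ((fourierClass n).add_mem
    ((fourierClass n).sub_mem (hv (f + g)) (hv (f - g)))
    ((fourierClass n).smul_mem Complex.I ((fourierClass n).sub_mem (hv (f + Complex.I • g))
      (hv (f - Complex.I • g))))) using 1
  ext t
  rw [hD.inner_evol_polarization hsa]
  simp only [Pi.smul_apply, Pi.add_apply, Pi.sub_apply, smul_eq_mul]
  ring

/-- σ is the imaginary part of the inner product, and χ·z̄ is the conjugate of χ̄·z; the class is
closed under conjugation. -/
theorem mul_symp_evol_mem_fourierClass {χ : EuclideanSpace ℝ (Fin n) → ℂ}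
    (h : χ ∈ fourierClass n) (c : EuclideanSpace ℝ (Fin n)) (f g : D) :
    (fun t => χ t * (symp (g : 𝓗) (hD.evol (inner ℝ c t) f : 𝓗) : ℂ)) ∈ fourierClass n := by
  convert (fourierClass n).smul_mem (1 / (2 * Complex.I) : ℂ) ((fourierClass n).sub_mem
    (hD.mul_inner_evol_mem_fourierClass hsa h c f g) (conj_mem_fourierClass
      (hD.mul_inner_evol_mem_fourierClass hsa (conj_mem_fourierClass h) c f g))) using 1
  ext t
  have h1 : (symp (g : 𝓗) (hD.evol (inner ℝ c t) f : 𝓗) : ℂ) =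
      (⟪g, hD.evol (inner ℝ c t) f⟫_ℂ - starRingEnd ℂ ⟪g, hD.evol (inner ℝ c t) f⟫_ℂ) /
        (2 * Complex.I) := Complex.im_eq_sub_conj _
  rw [h1]
  simp only [Pi.smul_apply, Pi.sub_apply, smul_eq_mul, map_mul, Complex.conj_conj]
  ring

omit [CompleteSpace 𝓗] hsa in
theorem symp_sum_sum {ι κ : Type*} (s : Finset ι) (t : Finset κ) (f : ι → 𝓗) (g : κ → 𝓗) :
    symp (∑ i ∈ s, f i) (∑ j ∈ t, g j) = ∑ i ∈ s, ∑ j ∈ t, symp (f i) (g j) := by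
  simp only [symp, sum_inner, inner_sum, Complex.im_sum]
  exact Finset.sum_comm

theorem symp_evol_evol (s t : ℝ) (f g : D) :
    symp (hD.evol s g : 𝓗) (hD.evol t f : 𝓗) = symp (g : 𝓗) (hD.evol (t - s) f : 𝓗) := by
  have h : hD.evol t f = hD.evol s (hD.evol (t - s) f) := by
    rw [← hD.evol_add_time hsa, add_sub_cancel]
  rw [h]
  exact congrArg Complex.im (hD.inner_evol hsa s g (hD.evol (t - s) f))

/-- Invariance gives σ(e^{isH}g, e^{itH}f) = σ(g, e^{i(t−s)H}f), so each term is a function of a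
difference of two coordinates; the vector `c i j` selects tᵢ − sⱼ. -/
theorem bracketWeight_mem_fourierClass {χ₁ : EuclideanSpace ℝ (Fin n) → ℂ}
    {χ₂ : EuclideanSpace ℝ (Fin m) → ℂ} (h : χ₁ ∈ fourierClass n) (h' : χ₂ ∈ fourierClass m)
    (f : Fin n → D) (g : Fin m → D) :
    (fun x => χ₁ (splitEquiv n m x).1 * χ₂ (splitEquiv n m x).2 *
      (symp (hD.multiEvol g (splitEquiv n m x).2 : 𝓗) (hD.multiEvol f (splitEquiv n m x).1 : 𝓗) : ℂ))
      ∈ fourierClass (n + m) := by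
  let c : Fin n → Fin m → EuclideanSpace ℝ (Fin (n + m)) := fun i j =>
    EuclideanSpace.single (Fin.castAdd m i) 1 - EuclideanSpace.single (Fin.natAdd n j) 1
  convert Submodule.sum_mem (fourierClass (n + m)) (t := Finset.univ) fun j _ =>
    Submodule.sum_mem (fourierClass (n + m)) (t := Finset.univ) fun i _ =>
      hD.mul_symp_evol_mem_fourierClass hsa (prod_mem_fourierClass h h') (c i j) (f i) (g j) using 1
  ext x
  simp only [multiEvol, Submodule.coe_sum, symp_sum_sum, hD.symp_evol_evol hsa, Finset.sum_apply]
  push_cast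
  simp only [Finset.mul_sum]
  refine Finset.sum_congr rfl fun j _ => Finset.sum_congr rfl fun i _ => ?_
  have hc : inner ℝ (c i j) x = (splitEquiv n m x).1 i - (splitEquiv n m x).2 j := by
    simp [c, inner_sub_left, EuclideanSpace.inner_single_left, splitEquiv_fst, splitEquiv_snd]
  rw [hc]

end IsTestSpace

variable {ω : WeylState D} {K : Type v} [NormedAddCommGroup K] [InnerProductSpace ℂ K]
  [CompleteSpace K] {hD : IsTestSpace H D} {β : ℝ} {G : GNSTriple ω K}

namespace IsWeakKMS

variable (hω : IsWeakKMS hD β ω G) (hsa : IsSelfAdjoint H)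

/-- The smearing `∫ χ(t) W⁰(∑ᵢ e^{i tᵢ H} fᵢ) dt`. -/
abbrev weylSmearing (f : Fin n → D) {χ : EuclideanSpace ℝ (Fin n) → ℂ} (hχ : χ ∈ fourierClass n) :
    Smearing G where
  Y := EuclideanSpace ℝ (Fin n)
  μ := volume
  w := χ
  F := hD.multiEvol f
  bound := ∑ i, ‖f i‖
  integrable_w := integrable_of_mem_fourierClass hχ
  norm_le := hD.norm_multiEvol_le hsa f
  continuous_F := hD.continuous_multiEvol hsa f
  continuous_W := hω.continuous_W_multiEvol hsa f

/-- This brings integrals over ℝⁿ × ℝᵐ back to generators over ℝⁿ⁺ᵐ; with the weights of `mul` and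
`bracket` it shows that the span is closed under both. -/
theorem op_weylSmearing_split (f : Fin n → D) (g : Fin m → D) {χ₁ : EuclideanSpace ℝ (Fin n) → ℂ}
    {χ₂ : EuclideanSpace ℝ (Fin m) → ℂ} (h₁ : χ₁ ∈ fourierClass n) (h₂ : χ₂ ∈ fourierClass m)
    {w : EuclideanSpace ℝ (Fin n) × EuclideanSpace ℝ (Fin m) → ℂ}
    (hw : Integrable w) (hw' : (fun x => w (splitEquiv n m x)) ∈ fourierClass (n + m)) :
    ((hω.weylSmearing hsa f h₁).prodWith (hω.weylSmearing hsa g h₂) w hw).op =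
      (hω.weylSmearing hsa (Fin.append f g) hw').op := by
  ext ξ
  refine (integral_splitEquiv (n := n) (m := m) _).symm.trans ?_
  refine integral_congr_ae (.of_forall fun x => ?_)
  simp only [hD.multiEvol_append]

/-- The property of being one of the generating smearings. -/
def IsWeylSmearing (r : Smearing G) : Prop :=
  ∃ (n : ℕ) (_ : 0 < n) (f : Fin n → D) (χ : EuclideanSpace ℝ (Fin n) → ℂ) (hχ : χ ∈ fourierClass n),
    r = hω.weylSmearing hsa f hχ

theorem isSmeared_weylSmearing (f : Fin n → D) {χ : EuclideanSpace ℝ (Fin n) → ℝ}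
    (hχ : χ ∈ smearClass n) :
    G.IsSmeared hD f χ (hω.weylSmearing hsa f (mem_smearClass_iff.1 hχ)).elt := fun p =>
  ⟨(hω.weylSmearing hsa f (mem_smearClass_iff.1 hχ)).integrable_eval p,
    (hω.weylSmearing hsa f (mem_smearClass_iff.1 hχ)).eval_op p⟩

theorem eq_elt_of_isSmeared {f : Fin n → D} {χ : EuclideanSpace ℝ (Fin n) → ℝ}
    (hχ : χ ∈ smearClass n) {A : Elt G.vN} (hA : G.IsSmeared hD f χ A) :
    A = (hω.weylSmearing hsa f (mem_smearClass_iff.1 hχ)).elt := by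
  refine Subtype.ext (ContinuousLinearMap.ext fun η => ext_inner_left ℂ fun ξ => ?_)
  rw [← NormalPair.eval_single, ← NormalPair.eval_single, ← (hA _).2,
    ← (hω.isSmeared_weylSmearing hsa f hχ _).2]

/-- Complex weights, convenient for brackets and Taylor coefficients, add nothing to the span: real
and imaginary parts of a transform are again in the real class. -/
theorem elt_mem_smearedSpan {r : Smearing G} (hr : hω.IsWeylSmearing hsa r) :
    r.elt ∈ G.smearedSpan hD := by
  obtain ⟨n, hn, f, χ, hχ, rfl⟩ := hr
  have h1 := hω.isSmeared_weylSmearing hsa f (re_mem_smearClass hχ)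
  have h2 := hω.isSmeared_weylSmearing hsa f (im_mem_smearClass hχ)
  set r₁ := hω.weylSmearing hsa f (mem_smearClass_iff.1 (re_mem_smearClass hχ)) with hr₁
  set r₂ := hω.weylSmearing hsa f (mem_smearClass_iff.1 (im_mem_smearClass hχ)) with hr₂
  have h3 : (hω.weylSmearing hsa f hχ).elt = r₁.elt + Complex.I • r₂.elt := by
    refine Subtype.ext (ContinuousLinearMap.ext fun ξ => ?_)
    change (hω.weylSmearing hsa f hχ).op ξ = r₁.op ξ + Complex.I • r₂.op ξ
    rw [r₁.op_apply, r₂.op_apply, ← integral_smul]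
    refine Eq.trans ?_ (integral_add (r₁.integrable_W r₁.integrable_w ξ)
      ((r₂.integrable_W r₂.integrable_w ξ).smul Complex.I))
    refine integral_congr_ae (.of_forall fun t => ?_)
    change χ t • G.W (hD.multiEvol f t) ξ = ((χ t).re : ℂ) • G.W (hD.multiEvol f t) ξ +
      Complex.I • ((χ t).im : ℂ) • G.W (hD.multiEvol f t) ξ
    rw [smul_smul, ← add_smul, mul_comm Complex.I, Complex.re_add_im]
  rw [h3]
  exact (G.smearedSpan hD).add_mem (Submodule.subset_span ⟨n, hn, f, _, re_mem_smearClass hχ, h1⟩)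
    ((G.smearedSpan hD).smul_mem _
      (Submodule.subset_span ⟨n, hn, f, _, im_mem_smearClass hχ, h2⟩))

theorem smearedSpan_eq :
    G.smearedSpan hD = Submodule.span ℂ (Smearing.elt '' {r | hω.IsWeylSmearing hsa r}) := by
  refine le_antisymm (Submodule.span_mono ?_) (Submodule.span_le.2 ?_)
  · rintro A ⟨n, hn, f, χ, hχ, hA⟩
    exact ⟨_, ⟨n, hn, f, _, mem_smearClass_iff.1 hχ, rfl⟩, (hω.eq_elt_of_isSmeared hsa hχ hA).symm⟩
  · rintro _ ⟨r, hr, rfl⟩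
    exact hω.elt_mem_smearedSpan hsa hr

theorem smearedSpan_induction {p : Elt G.vN → Prop}
    (hgen : ∀ r, hω.IsWeylSmearing hsa r → p r.elt) (hzero : p 0)
    (hadd : ∀ A B, p A → p B → p (A + B)) (hsmul : ∀ (c : ℂ) A, p A → p (c • A))
    {A : Elt G.vN} (hA : A ∈ G.smearedSpan hD) : p A := by
  rw [hω.smearedSpan_eq hsa] at hA
  refine Submodule.span_induction (p := fun A _ => p A) ?_ hzero (fun A B _ _ => hadd A B)
    (fun c A _ => hsmul c A) hA
  rintro _ ⟨r, hr, rfl⟩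
  exact hgen r hr

theorem IsWeylSmearing.exists_mul {r s : Smearing G} (hr : hω.IsWeylSmearing hsa r)
    (hs : hω.IsWeylSmearing hsa s) : ∃ q, hω.IsWeylSmearing hsa q ∧ q.op = (r.mul s).op := by
  obtain ⟨n, hn, f, χ₁, h₁, rfl⟩ := hr
  obtain ⟨m, hm, g, χ₂, h₂, rfl⟩ := hs
  exact ⟨_, ⟨n + m, by omega, Fin.append f g, _, prod_mem_fourierClass h₁ h₂, rfl⟩,
    (hω.op_weylSmearing_split hsa f g h₁ h₂ (w := fun x => χ₁ x.1 * χ₂ x.2) _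
      (prod_mem_fourierClass h₁ h₂)).symm⟩

theorem IsWeylSmearing.exists_bracket {r s : Smearing G} (hr : hω.IsWeylSmearing hsa r)
    (hs : hω.IsWeylSmearing hsa s) : ∃ q, hω.IsWeylSmearing hsa q ∧ q.op = (r.bracket s).op := by
  obtain ⟨n, hn, f, χ₁, h₁, rfl⟩ := hr
  obtain ⟨m, hm, g, χ₂, h₂, rfl⟩ := hs
  exact ⟨_, ⟨n + m, by omega, Fin.append f g, _, hD.bracketWeight_mem_fourierClass hsa h₁ h₂ f g, rfl⟩,
    (hω.op_weylSmearing_split hsa f g h₁ h₂ (w := fun x => χ₁ x.1 * χ₂ x.2 *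
      (symp (hD.multiEvol g x.2 : 𝓗) (hD.multiEvol f x.1 : 𝓗) : ℂ)) _
      (hD.bracketWeight_mem_fourierClass hsa h₁ h₂ f g)).symm⟩

theorem IsWeylSmearing.exists_adjoint {r : Smearing G} (hr : hω.IsWeylSmearing hsa r) :
    ∃ q, hω.IsWeylSmearing hsa q ∧ q.op = r.adjoint.op := by
  obtain ⟨n, hn, f, χ, hχ, rfl⟩ := hr
  refine ⟨_, ⟨n, hn, fun i => -f i, _, conj_mem_fourierClass hχ, rfl⟩, ?_⟩
  ext ξ
  refine integral_congr_ae (.of_forall fun t => ?_)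
  have h : hD.multiEvol (fun i => -f i) t = -hD.multiEvol f t := by
    simp only [IsTestSpace.multiEvol, ← Finset.sum_neg_distrib]
    refine Finset.sum_congr rfl fun i _ => ?_
    rw [← zero_sub, hD.evol_sub hsa, hD.evol_zero_right hsa, zero_sub]
  simp only [h]

theorem IsWeylSmearing.exists_evolve {r : Smearing G} (hr : hω.IsWeylSmearing hsa r) (t : ℝ) :
    ∃ q, hω.IsWeylSmearing hsa q ∧ q.op = (hω.evolve hsa t r).op := by
  obtain ⟨n, hn, f, χ, hχ, rfl⟩ := hr
  refine ⟨_, ⟨n, hn, fun i => hD.evol t (f i), _, hχ, rfl⟩, ?_⟩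
  ext ξ
  refine integral_congr_ae (.of_forall fun s => ?_)
  simp only [hD.multiEvol_evol hsa]

end IsWeakKMS
end Generators

/-! ### σ-weak density of the smeared elements. -/

section Density

variable {𝓗 : Type u} [NormedAddCommGroup 𝓗] [InnerProductSpace ℂ 𝓗] [CompleteSpace 𝓗]
  {D : Submodule ℂ 𝓗} {H : 𝓗 →ₗ.[ℂ] 𝓗}
  {ω : WeylState D} {K : Type v} [NormedAddCommGroup K] [InnerProductSpace ℂ K]
  [CompleteSpace K] {hD : IsTestSpace H D} {β : ℝ} {G : GNSTriple ω K}

/-- The closure of a submodule in the σ-weak topology. -/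
theorem exists_sigmaWeak_closure (M : VonNeumannAlgebra K) (S : Submodule ℂ (Elt M)) :
    ∃ T : Submodule ℂ (Elt M), (T : Set (Elt M)) = @closure _ (sigmaWeakOn M) S := by
  let L : Elt M →ₗ[ℂ] (NormalPair K → ℂ) :=
    LinearMap.pi fun p => p.evalCLM.toLinearMap ∘ₗ M.toStarSubalgebra.toSubalgebra.toSubmodule.subtype
  let τ : TopologicalSpace (Elt M) := TopologicalSpace.induced L inferInstance
  have hτ : sigmaWeakOn M = τ := sigmaWeakOn_eq M
  rw [hτ]
  have h1 : @ContinuousAdd (Elt M) τ _ := continuousAdd_induced L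
  have h2 : @ContinuousSMul ℂ (Elt M) _ _ τ := continuousSMul_induced L
  exact ⟨S.topologicalClosure, S.topologicalClosure_coe⟩

namespace IsWeakKMS

variable (hω : IsWeakKMS hD β ω G) (hsa : IsSelfAdjoint H)
include hω hsa

/-- The averages ∫ ε⁻¹χ(t/ε) W(e^{itH}f) dt with ∫χ = 1 converge σ-weakly to W(f) as ε → 0, by
continuity along the orbit and dominated convergence. -/
theorem rep_weyl_mem_closure (f : D) :
    G.rep (weyl f) ∈ @closure _ (sigmaWeakOn G.vN) (G.smearedSpan hD : Set (Elt G.vN)) := by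
  obtain ⟨χ, hχ, hone, hscale⟩ := exists_approxIdentity
  let u : ℝ → Elt G.vN := fun ε =>
    if hε : 0 < ε then (hω.weylSmearing hsa (fun _ : Fin 1 => f) (hscale ε hε)).elt else 0
  refine mem_closure_sigmaWeakOn_of_tendsto (l := 𝓝[>] (0 : ℝ)) (u := u) ?_ fun p => ?_
  · filter_upwards [self_mem_nhdsWithin] with ε hε
    have : u ε = (hω.weylSmearing hsa (fun _ : Fin 1 => f) (hscale ε hε)).elt := dif_pos hε
    rw [this]
    exact hω.elt_mem_smearedSpan hsa ⟨1, one_pos, _, _, _, rfl⟩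
  · let φ : EuclideanSpace ℝ (Fin 1) → ℂ := fun t => p.eval (G.W (hD.multiEvol (fun _ => f) t))
    have hφ : Continuous φ := (hω.weylSmearing hsa (fun _ : Fin 1 => f) hχ).continuous_eval_W p
    have hφ0 : φ 0 = p.eval (G.rep (weyl f) : K →L[ℂ] K) := by
      have : hD.multiEvol (fun _ : Fin 1 => f) 0 = f := by
        simp [IsTestSpace.multiEvol, hD.evol_zero hsa]
      simp only [φ, this]
      rfl
    have h1 : ∀ᶠ ε in 𝓝[>] (0 : ℝ), ∫ t, χ t * φ (ε • t) = p.eval (u ε : K →L[ℂ] K) := by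
      filter_upwards [self_mem_nhdsWithin] with ε hε
      have hε' : 0 < ε := hε
      have h2 : u ε = (hω.weylSmearing hsa (fun _ : Fin 1 => f) (hscale ε hε)).elt := dif_pos hε
      have h3 := (hω.weylSmearing hsa (fun _ : Fin 1 => f) (hscale ε hε)).eval_op p
      have h4 := Measure.integral_comp_inv_smul_of_nonneg (volume : Measure (EuclideanSpace ℝ (Fin 1)))
        (fun t => χ t * φ (ε • t)) hε'.le
      rw [h2]
      refine Eq.trans ?_ h3
      simp only [Smearing.eval_smul, smul_inv_smul₀ hε'.ne', finrank_euclideanSpace_fin, pow_one] at h4 ⊢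
      simp only [mul_assoc]
      rw [integral_const_mul]
      change _ = ((ε⁻¹ : ℝ) : ℂ) * ∫ t, χ (ε⁻¹ • t) * φ t
      rw [h4, Complex.real_smul, ← mul_assoc, ← Complex.ofReal_mul, inv_mul_cancel₀ hε'.ne',
        Complex.ofReal_one, one_mul]
    refine Tendsto.congr' h1 ?_
    have h5 : ∫ t, χ t * φ 0 = p.eval (G.rep (weyl f) : K →L[ℂ] K) := by
      rw [integral_mul_const, hone, one_mul, hφ0]
    rw [← h5]
    refine tendsto_integral_filter_of_dominated_convergence
      (fun t => ‖χ t‖ * ∑' n, (‖p.1.1 n‖ ^ 2 + ‖p.1.2 n‖ ^ 2)) (.of_forall fun ε => ?_)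
      (.of_forall fun ε => .of_forall fun t => ?_)
      ((integrable_of_mem_fourierClass hχ).norm.mul_const _) (.of_forall fun t => ?_)
    · exact ((continuous_of_mem_fourierClass hχ).mul
        (hφ.comp (continuous_const_smul ε))).aestronglyMeasurable
    · rw [norm_mul]
      exact mul_le_mul_of_nonneg_left (Smearing.norm_eval_W_le p _) (norm_nonneg _)
    · have hc : Continuous fun ε : ℝ => χ t * φ (ε • t) :=
        continuous_const.mul (hφ.comp (continuous_id.smul continuous_const))
      have := hc.tendsto 0
      simp only [zero_smul] at this
      exact this.mono_left nhdsWithin_le_nhds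

/-- The σ-weak closure is a closed subspace. It contains the Weyl operators, hence their norm
limits, hence by the density theorem the bicommutant. -/
theorem mem_closure_smearedSpan (A : Elt G.vN) :
    A ∈ @closure _ (sigmaWeakOn G.vN) (G.smearedSpan hD : Set (Elt G.vN)) := by
  obtain ⟨T, hT⟩ := exists_sigmaWeak_closure G.vN (G.smearedSpan hD)
  have hcl : ∀ B : Elt G.vN, B ∈ @closure _ (sigmaWeakOn G.vN) (T : Set (Elt G.vN)) → B ∈ T := by
    intro B hB
    rw [hT, @closure_closure _ (sigmaWeakOn G.vN), ← hT] at hB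
    exact hB
  have hW : ∀ f, G.rep (weyl f) ∈ T := fun f => by
    rw [← SetLike.mem_coe, hT]
    exact hω.rep_weyl_mem_closure hsa f
  have hrep : ∀ a : weylAlgebra D, G.rep a ∈ T := fun a => by
    refine hcl _ ?_
    choose u hu using fun n : ℕ => G.exists_norm_π_sub_lt a (ε := 1 / ((n : ℝ) + 1)) (by positivity)
    refine mem_closure_sigmaWeakOn_of_tendsto (l := atTop)
      (u := fun n => Finsupp.linearCombination ℂ (fun f => G.rep (weyl f)) (u n))
      (.of_forall fun n => ?_) fun p => ?_
    · rw [Finsupp.linearCombination_apply]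
      exact T.sum_mem fun f _ => T.smul_mem _ (hW f)
    · have h1 : ∀ n, ((Finsupp.linearCombination ℂ (fun f => G.rep (weyl f)) (u n) : Elt G.vN) :
          K →L[ℂ] K) = Finsupp.linearCombination ℂ G.W (u n) := fun n => by
        simp only [Finsupp.linearCombination_apply, Finsupp.sum, AddSubmonoidClass.coe_finsetSum]
        rfl
      simp only [h1]
      refine (p.evalCLM.continuous.tendsto (G.π a)).comp ?_
      rw [tendsto_iff_norm_sub_tendsto_zero]
      refine squeeze_zero (fun _ => norm_nonneg _) (fun n => ?_) tendsto_one_div_add_atTop_nhds_zero_nat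
      rw [norm_sub_rev]
      exact (hu n).le
  rw [← hT]
  refine hcl A ?_
  refine Set.mem_of_subset_of_mem (@closure_mono _ (sigmaWeakOn G.vN) _ _ ?_)
    (mem_closure_bicommutant G.π.range A)
  rintro B ⟨a, ha⟩
  have : B = G.rep a := Subtype.ext ha.symm
  rw [this]
  exact hrep a

end IsWeakKMS
end Density

/-! ### Entire analyticity of the orbits. -/

section Entire

variable {n : ℕ}

/-- The Taylor expansion of the translates of a function of the Fourier class. -/
theorem hasSum_fourier_translate {ψ : EuclideanSpace ℝ (Fin n) → ℂ} (h1 : Continuous ψ)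
    (h2 : HasCompactSupport ψ) (v s : EuclideanSpace ℝ (Fin n)) (t : ℝ) :
    HasSum (fun k : ℕ => ((t : ℂ) ^ k / (k.factorial : ℂ)) *
      𝓕 (fun x => (((2 * Real.pi * inner ℝ x v : ℝ) : ℂ) * Complex.I) ^ k * ψ x) s)
      (𝓕 ψ (s - t • v)) := by
  let p : EuclideanSpace ℝ (Fin n) → ℂ := fun x => ((2 * Real.pi * inner ℝ x v : ℝ) : ℂ) * Complex.I
  have hp : Continuous p := by fun_prop
  let e : EuclideanSpace ℝ (Fin n) → ℂ := fun x =>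
    Complex.exp ((-2 * Real.pi * inner ℝ x s : ℝ) * Complex.I)
  have he : Continuous e := by fun_prop
  have hen : ∀ x, ‖e x‖ = 1 := fun x => Complex.norm_exp_ofReal_mul_I _
  -- The expansion is that of e^{2πit⟨x,v⟩} under the Fourier integral; compact support of ψ bounds
  -- the exponent, which justifies termwise integration.
  obtain ⟨M, hM⟩ := h2.isCompact.exists_bound_of_continuousOn hp.continuousOn
  have hbd : ∀ k x, ‖p x ^ k * ψ x‖ ≤ M ^ k * ‖ψ x‖ := fun k x => by
    by_cases hx : ψ x = 0
    · simp [hx]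
    · rw [norm_mul, norm_pow]
      gcongr
      exact hM x (subset_tsupport ψ hx)
  have hint : ∀ k, Integrable (fun x => p x ^ k * ψ x) := fun k =>
    ((hp.pow k).mul h1).integrable_of_hasCompactSupport h2.mul_left
  let F : ℕ → EuclideanSpace ℝ (Fin n) → ℂ := fun k x =>
    ((t : ℂ) ^ k / (k.factorial : ℂ)) * (e x * (p x ^ k * ψ x))
  have hFint : ∀ k, Integrable (F k) := fun k =>
    ((hint k).bdd_mul he.aestronglyMeasurable (.of_forall fun x => (hen x).le)).const_mul _
  have hFn : ∀ k, ∫ x, ‖F k x‖ ≤ (|t| * M) ^ k / (k.factorial : ℝ) * ∫ x, ‖ψ x‖ := fun k => by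
    rw [← integral_const_mul]
    refine integral_mono (hFint k).norm
      ((h1.integrable_of_hasCompactSupport h2).norm.const_mul _) fun x => ?_
    simp only [F, norm_mul (_ / _), norm_mul (e x), hen, one_mul, norm_div, norm_pow,
      Complex.norm_real, Real.norm_eq_abs, Complex.norm_natCast]
    calc _ ≤ |t| ^ k / (k.factorial : ℝ) * (M ^ k * ‖ψ x‖) :=
          mul_le_mul_of_nonneg_left (hbd k x) (by positivity)
      _ = _ := by rw [mul_pow]; ring
  have h := hasSum_integral_of_summable_integral_norm hFint
    (Summable.of_nonneg_of_le (fun k => integral_nonneg fun _ => norm_nonneg _) hFn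
      ((Real.summable_pow_div_factorial _).mul_right _))
  have hF : (fun k : ℕ => ((t : ℂ) ^ k / (k.factorial : ℂ)) * 𝓕 (fun x => p x ^ k * ψ x) s) =
      fun k => ∫ x, F k x := by
    ext k
    rw [Real.fourier_eq', ← integral_const_mul]
    refine integral_congr_ae (.of_forall fun x => ?_)
    simp only [F, e, smul_eq_mul]
  have hsum : 𝓕 ψ (s - t • v) = ∫ x, ∑' k, F k x := by
    rw [Real.fourier_eq']
    refine integral_congr_ae (.of_forall fun x => ?_)
    have h3 : HasSum (fun k => F k x) (e x * (Complex.exp (t * p x) * ψ x)) := by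
      refine (((hasSum_cexp (t * p x)).mul_right (ψ x)).mul_left (e x)).congr_fun fun k => ?_
      simp only [F, mul_pow]
      ring
    simp only [h3.tsum_eq, smul_eq_mul]
    rw [← mul_assoc, ← Complex.exp_add]
    congr 2
    simp only [p, inner_sub_right, inner_smul_right]
    push_cast
    ring
  rw [hsum]
  exact hF ▸ h

variable {𝓗 : Type u} [NormedAddCommGroup 𝓗] [InnerProductSpace ℂ 𝓗] [CompleteSpace 𝓗]
  {D : Submodule ℂ 𝓗} {H : 𝓗 →ₗ.[ℂ] 𝓗}
  {ω : WeylState D} {K : Type v} [NormedAddCommGroup K] [InnerProductSpace ℂ K]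
  [CompleteSpace K] {hD : IsTestSpace H D} {β : ℝ} {G : GNSTriple ω K}

/-- The orbit of `A` extends to a norm-entire function with values in the von Neumann algebra. -/
def HasEntireOrbit (G : GNSTriple ω K) (hD : IsTestSpace H D) (A : K →L[ℂ] K) : Prop :=
  ∃ F : ℂ → K →L[ℂ] K, Differentiable ℂ F ∧ (∀ z, F z ∈ G.vN.toStarSubalgebra) ∧
    ∀ t : ℝ, F t = G.flowOp hD t * A * G.flowOp hD (-t)

namespace IsWeakKMS

variable (hω : IsWeakKMS hD β ω G) (hsa : IsSelfAdjoint H)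

/-- Moving along the flow shifts all times by t, so it replaces χ by its translate along v = (1, …,
1). In the Taylor series of the translate the k-th coefficient has L¹ norm at most C·Bᵏ, so tᵏ/k!
makes the operator series converge in norm for every complex t. -/
theorem hasEntireOrbit_weylSmearing (f : Fin n → D) {χ : EuclideanSpace ℝ (Fin n) → ℂ}
    (hχ : χ ∈ fourierClass n) : HasEntireOrbit G hD (hω.weylSmearing hsa f hχ).op := by
  obtain ⟨ψ, h1, h2, rfl⟩ := id hχ
  let v : EuclideanSpace ℝ (Fin n) := WithLp.toLp 2 fun _ => 1
  let p : EuclideanSpace ℝ (Fin n) → ℂ := fun x => ((2 * Real.pi * inner ℝ x v : ℝ) : ℂ) * Complex.I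
  have hp : ContDiff ℝ (⊤ : ℕ∞) p :=
    (Complex.ofRealCLM.contDiff.comp (contDiff_const.mul (contDiff_id.inner ℝ contDiff_const))).mul
      contDiff_const
  obtain ⟨C, B, hB, hCB⟩ := exists_integral_norm_fourier_pow_le h1 h2 hp
  have hk : ∀ k : ℕ, 𝓕 (fun x => p x ^ k * ψ x) ∈ fourierClass n := fun k =>
    ⟨_, (hp.pow k).mul h1, h2.mul_left, rfl⟩
  let A : ℕ → K →L[ℂ] K := fun k => (hω.weylSmearing hsa f (hk k)).op
  have hA : ∀ k, ‖A k‖ ≤ C * B ^ k := fun k =>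
    (hω.weylSmearing hsa f (hk k)).norm_op_le.trans (hCB k)
  have hAz : ∀ (z : ℂ) (R : ℝ), ‖z‖ ≤ R → ∀ k : ℕ, ‖(z ^ k / (k.factorial : ℂ)) • A k‖ ≤
      (R * B) ^ k / (k.factorial : ℝ) * C := fun z R hz k => by
    rw [norm_smul, norm_div, norm_pow, Complex.norm_natCast]
    have hC : 0 ≤ C * B ^ k := (norm_nonneg _).trans (hA k)
    have hR : 0 ≤ R := (norm_nonneg z).trans hz
    calc _ ≤ R ^ k / (k.factorial : ℝ) * (C * B ^ k) := by
          gcongr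
          exact hA k
      _ = _ := by rw [mul_pow]; ring
  have hsumR : ∀ R : ℝ, Summable fun k : ℕ => (R * B) ^ k / (k.factorial : ℝ) * C := fun R =>
    (Real.summable_pow_div_factorial _).mul_right _
  have hsum : ∀ z : ℂ, HasSum (fun k : ℕ => (z ^ k / (k.factorial : ℂ)) • A k)
      (∑' k : ℕ, (z ^ k / (k.factorial : ℂ)) • A k) := fun z =>
    (Summable.of_norm_bounded (hsumR ‖z‖) (hAz z _ le_rfl)).hasSum
  refine ⟨fun z => ∑' k : ℕ, (z ^ k / (k.factorial : ℂ)) • A k, fun z => ?_, fun z => ?_,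
    fun t => ?_⟩
  · have := Complex.differentiableOn_tsum_of_summable_norm (U := Metric.ball (0 : ℂ) (‖z‖ + 1))
      (F := fun (k : ℕ) (z : ℂ) => (z ^ k / (k.factorial : ℂ)) • A k) (hsumR (‖z‖ + 1))
      (fun k => ((differentiable_id.pow k).div_const _ |>.smul_const (A k)).differentiableOn)
      Metric.isOpen_ball (fun k w hw => hAz w _ (by simpa using (mem_ball_zero_iff.1 hw).le) k)
    exact this.differentiableAt (Metric.isOpen_ball.mem_nhds (by simp))
  · exact G.isClosed_vN.mem_of_tendsto (hsum z) (.of_forall fun s =>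
      sum_mem fun k _ => G.vN.toStarSubalgebra.smul_mem (Smearing.op_mem_vN _) _)
  · ext ξ
    rw [← hω.op_evolve hsa]
    have h3 := (hsum t).mapL (ContinuousLinearMap.apply ℂ K ξ)
    simp only [ContinuousLinearMap.apply_apply, smul_apply] at h3
    refine h3.unique ?_
    let r : ℕ → Smearing G := fun k => hω.weylSmearing hsa f (hk k)
    let E : ℕ → EuclideanSpace ℝ (Fin n) → K := fun k s =>
      ((t : ℂ) ^ k / (k.factorial : ℂ)) • 𝓕 (fun x => p x ^ k * ψ x) s • G.W (hD.multiEvol f s) ξ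
    have hEint : ∀ k, Integrable (E k) := fun k =>
      ((r k).integrable_W (r k).integrable_w ξ).smul ((t : ℂ) ^ k / (k.factorial : ℂ))
    have hEn : ∀ k, ∫ s, ‖E k s‖ ≤ (|t| * B) ^ k / (k.factorial : ℝ) * (C * ‖ξ‖) := fun k => by
      simp only [E, norm_smul, G.norm_W_apply, norm_div, norm_pow, Complex.norm_real,
        Real.norm_eq_abs, Complex.norm_natCast]
      rw [integral_const_mul, integral_mul_const]
      calc _ ≤ |t| ^ k / (k.factorial : ℝ) * (C * B ^ k * ‖ξ‖) := by gcongr; exact hCB k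
        _ = _ := by rw [mul_pow]; ring
    have h4 := hasSum_integral_of_summable_integral_norm hEint
      (Summable.of_nonneg_of_le (fun k => integral_nonneg fun _ => norm_nonneg _) hEn
        ((Real.summable_pow_div_factorial _).mul_right _))
    have h5 : ∀ k, ∫ s, E k s = ((t : ℂ) ^ k / (k.factorial : ℂ)) • A k ξ := fun k =>
      integral_smul _ _
    simp only [h5] at h4
    have h6 : ∀ s, ∑' k, E k s = 𝓕 ψ (s - t • v) • G.W (hD.multiEvol f s) ξ := fun s => by
      have := (hasSum_fourier_translate h1.continuous h2 v s t).smul_const (G.W (hD.multiEvol f s) ξ)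
      simp only [mul_smul] at this
      exact this.tsum_eq
    have h7 : (hω.evolve hsa t (hω.weylSmearing hsa f hχ)).op ξ = ∫ s, ∑' k, E k s := by
      simp only [h6]
      rw [← integral_add_right_eq_self _ (t • v)]
      refine integral_congr_ae (.of_forall fun s => ?_)
      have h8 : t • v = WithLp.toLp 2 fun _ => t := by
        ext i
        simp [v]
      simp only [add_sub_cancel_right, hD.evol_multiEvol hsa, h8]
    rw [h7]
    exact h4

end IsWeakKMS

end Entire

/-! ### Extending brackets and their identities from generators. -/

section PoissonOfGenerators

/-- A skew bracket of generators that respects linear relations extends bilinearly. -/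
theorem exists_bilinear_extension {Γ V : Type*} [AddCommGroup V] [Module ℂ V] {gen : Γ → V}
    {gb : Γ → Γ → V} (hspan : Submodule.span ℂ (Set.range gen) = ⊤)
    (hlin : ∀ u : Γ →₀ ℂ, Finsupp.linearCombination ℂ gen u = 0 →
      ∀ s, Finsupp.linearCombination ℂ (fun r => gb r s) u = 0)
    (hskew : ∀ r s, gb s r = -gb r s) :
    ∃ B : V →ₗ[ℂ] V →ₗ[ℂ] V, ∀ r s, B (gen r) (gen s) = gb r s := by
  let L := Finsupp.linearCombination ℂ gen
  let Φ : (Γ →₀ ℂ) →ₗ[ℂ] (Γ →₀ ℂ) →ₗ[ℂ] V :=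
    Finsupp.linearCombination ℂ fun r => Finsupp.linearCombination ℂ (gb r)
  have hΦs : ∀ r s, Φ (Finsupp.single r 1) (Finsupp.single s 1) = gb r s := fun r s => by
    simp [Φ]
  have hΦ : Φ.flip = -Φ := by
    ext r s
    simp [hΦs, hskew r s]
  have hΦ' : ∀ u w, Φ w u = -Φ u w := fun u w => by
    have := LinearMap.congr_fun₂ hΦ u w
    simpa using this
  -- Linear relations are respected in the first slot by hypothesis, and therefore in the second by
  -- antisymmetry. So Φ may be composed with any linear section of L in both slots without changing
  -- its values on generators.
  have hzero : ∀ u, L u = 0 → Φ u = 0 := fun u hu => by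
    ext s
    have := hlin u hu s
    rw [Finsupp.linearCombination_apply] at this
    simp only [Φ, Finsupp.linearCombination_apply, Finsupp.sum] at this ⊢
    simp only [LinearMap.comp_apply, Finsupp.lsingle_apply, LinearMap.sum_apply,
      LinearMap.smul_apply]
    simpa using this
  have hL : LinearMap.range L = ⊤ := by
    rw [← hspan]
    exact Finsupp.range_linearCombination ℂ
  obtain ⟨σ, hσ⟩ := L.exists_rightInverse_of_surjective hL
  have hσ' : ∀ u, Φ (σ (L u)) = Φ u := fun u => by
    rw [← sub_eq_zero, ← map_sub]
    refine hzero _ ?_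
    rw [map_sub, sub_eq_zero]
    exact LinearMap.congr_fun hσ (L u)
  refine ⟨Φ.compl₁₂ σ σ, fun r s => ?_⟩
  have hgen : ∀ r, gen r = L (Finsupp.single r 1) := fun r => by simp [L]
  rw [LinearMap.compl₁₂_apply, hgen, hgen, hσ', hΦ', hσ', ← hΦ', hΦs]

theorem module_generator_induction {Γ V : Type*} [AddCommGroup V] [Module ℂ V] {gen : Γ → V}
    (hspan : Submodule.span ℂ (Set.range gen) = ⊤) {p : V → Prop}
    (hgen : ∀ r, p (gen r)) (hzero : p 0) (hadd : ∀ a b, p a → p b → p (a + b))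
    (hsmul : ∀ (c : ℂ) a, p a → p (c • a)) (a : V) : p a := by
  have ha : a ∈ Submodule.span ℂ (Set.range gen) := hspan ▸ Submodule.mem_top
  refine Submodule.span_induction (p := fun a _ => p a) ?_ hzero (fun a b _ _ => hadd a b)
    (fun c a _ => hsmul c a) ha
  rintro _ ⟨r, rfl⟩
  exact hgen r

theorem tendsto_bilinear_of_generators {Γ V X : Type*} [AddCommGroup V] [Module ℂ V] {gen : Γ → V}
    (hspan : Submodule.span ℂ (Set.range gen) = ⊤) {l : Filter X} {q : X → V →ₗ[ℂ] V →ₗ[ℂ] ℂ}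
    {ψ : V →ₗ[ℂ] V →ₗ[ℂ] ℂ}
    (h : ∀ r s, Tendsto (fun x => q x (gen r) (gen s)) l (𝓝 (ψ (gen r) (gen s)))) (a b : V) :
    Tendsto (fun x => q x a b) l (𝓝 (ψ a b)) := by
  induction a using module_generator_induction hspan with
  | hzero => simp only [map_zero, LinearMap.zero_apply, tendsto_const_nhds]
  | hadd a a' h h' => simpa only [map_add, LinearMap.add_apply] using h.add h'
  | hsmul z a h => simpa only [map_smul, LinearMap.smul_apply, smul_eq_mul] using h.const_mul z
  | hgen r =>
    induction b using module_generator_induction hspan with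
    | hzero => simp only [map_zero, tendsto_const_nhds]
    | hadd a a' h h' => simpa only [map_add] using h.add h'
    | hsmul z a h => simpa only [map_smul, smul_eq_mul] using h.const_mul z
    | hgen s => exact h r s

variable {E Γ : Type*} [Ring E] [StarRing E] [Algebra ℂ E]
  {P : NonUnitalStarSubalgebra ℂ E} {gen : Γ → P} {gb : Γ → Γ → P}

theorem generator_induction (hspan : Submodule.span ℂ (Set.range gen) = ⊤) {p : P → Prop}
    (hgen : ∀ r, p (gen r)) (hzero : p 0) (hadd : ∀ a b, p a → p b → p (a + b))
    (hsmul : ∀ (c : ℂ) a, p a → p (c • a)) (a : P) : p a :=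
  module_generator_induction hspan hgen hzero hadd hsmul a

variable {B : P →ₗ[ℂ] P →ₗ[ℂ] P} (hspan : Submodule.span ℂ (Set.range gen) = ⊤)
  (hB : ∀ r s, B (gen r) (gen s) = gb r s)
include hspan hB

theorem skew_of_generators (h : ∀ r s, gb s r = -gb r s) (a b : P) : B a b = -B b a := by
  induction a using generator_induction hspan with
  | hzero => simp
  | hadd a a' h h' => simp only [map_add, LinearMap.add_apply, h, h', neg_add]
  | hsmul c a h => simp only [map_smul, LinearMap.smul_apply, h, smul_neg]
  | hgen r =>
    induction b using generator_induction hspan with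
    | hzero => simp
    | hadd a a' h h' => simp only [map_add, LinearMap.add_apply, h, h', neg_add]
    | hsmul c a h => simp only [map_smul, LinearMap.smul_apply, h, smul_neg]
    | hgen s => rw [hB, hB, h s r]

theorem leibniz_of_generators
    (h : ∀ r s q, B (gen r) (gen s * gen q) = gb r s * gen q + gen s * gb r q) (a b c : P) :
    B a (b * c) = B a b * c + b * B a c := by
  induction a using generator_induction hspan with
  | hzero => simp
  | hadd a a' h h' => simp only [map_add, LinearMap.add_apply, h, h', add_mul, mul_add]; abel
  | hsmul z a h =>
    simp only [map_smul, LinearMap.smul_apply, h, smul_add, smul_mul_assoc, mul_smul_comm]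
  | hgen r =>
    induction b using generator_induction hspan with
    | hzero => simp
    | hadd a a' h h' => simp only [map_add, h, h', add_mul]; abel
    | hsmul z a h => simp only [map_smul, h, smul_add, smul_mul_assoc]
    | hgen s =>
      induction c using generator_induction hspan with
      | hzero => simp
      | hadd a a' h h' => simp only [map_add, h, h', mul_add]; abel
      | hsmul z a h => simp only [map_smul, h, smul_add, mul_smul_comm]
      | hgen q => rw [h, hB, hB]

omit hB in
theorem jacobi_of_generators
    (h : ∀ r s q, B (gen r) (B (gen s) (gen q)) + B (gen s) (B (gen q) (gen r)) +
      B (gen q) (B (gen r) (gen s)) = 0) (a b c : P) :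
    B a (B b c) + B b (B c a) + B c (B a b) = 0 := by
  have key : ∀ x y z x' y' z' : P, x + y + z = 0 → x' + y' + z' = 0 →
      x + x' + (y + y') + (z + z') = 0 := fun x y z x' y' z' h h' => by
    rw [← add_zero (0 : P)]
    nth_rw 1 [← h]
    rw [← h']
    abel
  induction a using generator_induction hspan with
  | hzero => simp
  | hadd a a' h h' => simp only [map_add, LinearMap.add_apply, key _ _ _ _ _ _ h h']
  | hsmul z a h => simp only [map_smul, LinearMap.smul_apply, ← smul_add, h, smul_zero]
  | hgen r =>
    induction b using generator_induction hspan with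
    | hzero => simp
    | hadd a a' h h' => simp only [map_add, LinearMap.add_apply, key _ _ _ _ _ _ h h']
    | hsmul z a h => simp only [map_smul, LinearMap.smul_apply, ← smul_add, h, smul_zero]
    | hgen s =>
      induction c using generator_induction hspan with
      | hzero => simp
      | hadd a a' h h' => simp only [map_add, LinearMap.add_apply, key _ _ _ _ _ _ h h']
      | hsmul z a h => simp only [map_smul, LinearMap.smul_apply, ← smul_add, h, smul_zero]
      | hgen q => exact h r s q

theorem star_of_generators [StarModule ℂ E]
    (h : ∀ r s, B (star (gen r)) (star (gen s)) = star (gb r s)) (a b : P) :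
    B (star a) (star b) = star (B a b) := by
  induction a using generator_induction hspan with
  | hzero => simp
  | hadd a a' h h' => simp only [star_add, map_add, LinearMap.add_apply, h, h']
  | hsmul z a h => simp only [star_smul, map_smul, LinearMap.smul_apply, h]
  | hgen r =>
    induction b using generator_induction hspan with
    | hzero => simp
    | hadd a a' h h' => simp only [star_add, map_add, h, h']
    | hsmul z a h => simp only [star_smul, map_smul, h]
    | hgen s => rw [h, hB]

end PoissonOfGenerators

/-! ### The Poisson algebra of smeared Weyl elements. -/

section Bracket

variable {𝓗 : Type u} [NormedAddCommGroup 𝓗] [InnerProductSpace ℂ 𝓗] [CompleteSpace 𝓗]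
  {D : Submodule ℂ 𝓗} {H : 𝓗 →ₗ.[ℂ] 𝓗}
  {ω : WeylState D} {K : Type v} [NormedAddCommGroup K] [InnerProductSpace ℂ K]
  [CompleteSpace K] {hD : IsTestSpace H D} {β : ℝ} {G : GNSTriple ω K}

omit [CompleteSpace 𝓗] in
theorem HasEntireOrbit.add {A B : K →L[ℂ] K} (hA : HasEntireOrbit G hD A)
    (hB : HasEntireOrbit G hD B) : HasEntireOrbit G hD (A + B) := by
  obtain ⟨F, h1, h2, h3⟩ := hA
  obtain ⟨F', h1', h2', h3'⟩ := hB
  exact ⟨fun z => F z + F' z, h1.add h1', fun z => add_mem (h2 z) (h2' z), fun t => by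
    simp only [h3, h3', mul_add, add_mul]⟩

omit [CompleteSpace 𝓗] in
theorem HasEntireOrbit.smul (c : ℂ) {A : K →L[ℂ] K} (hA : HasEntireOrbit G hD A) :
    HasEntireOrbit G hD (c • A) := by
  obtain ⟨F, h1, h2, h3⟩ := hA
  exact ⟨fun z => c • F z, h1.const_smul c, fun z => G.vN.toStarSubalgebra.smul_mem (h2 z) c,
    fun t => by simp only [h3, mul_smul_comm, smul_mul_assoc]⟩

omit [CompleteSpace 𝓗] in
theorem HasEntireOrbit.zero : HasEntireOrbit G hD 0 :=
  ⟨fun _ => 0, differentiable_const 0, fun _ => zero_mem _, fun t => by simp⟩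

namespace IsWeakKMS

variable (hω : IsWeakKMS hD β ω G) (hsa : IsSelfAdjoint H)

section
include hω hsa

theorem hasEntireOrbit_of_mem {A : Elt G.vN} (hA : A ∈ G.smearedSpan hD) :
    HasEntireOrbit G hD (A : K →L[ℂ] K) := by
  refine hω.smearedSpan_induction hsa (p := fun A => HasEntireOrbit G hD (A : K →L[ℂ] K))
    ?_ .zero (fun _ _ => .add) (fun c _ => .smul c) hA
  rintro _ ⟨n, hn, f, χ, hχ, rfl⟩
  exact hω.hasEntireOrbit_weylSmearing hsa f hχ

theorem isAnalytic_of_mem {A : Elt G.vN} (hA : A ∈ G.smearedSpan hD) :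
    (hω.dynamics hsa).IsAnalytic A := by
  obtain ⟨F, h1, h2, h3⟩ := hω.hasEntireOrbit_of_mem hsa hA
  exact ⟨fun z => ⟨F z, h2 z⟩, fun t => Subtype.ext (h3 t),
    fun p => p.evalCLM.differentiable.comp h1⟩

/-- The orbit of an element of the span is norm-differentiable, with derivative in the algebra. -/
theorem exists_derivative {A : Elt G.vN} (hA : A ∈ G.smearedSpan hD) : ∃ d : Elt G.vN,
    Tendsto (fun t : ℝ => (t : ℂ)⁻¹ • (G.flowOp hD t * (A : K →L[ℂ] K) * G.flowOp hD (-t) - A))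
      (𝓝[≠] 0) (𝓝 (d : K →L[ℂ] K)) := by
  obtain ⟨F, h1, h2, h3⟩ := hω.hasEntireOrbit_of_mem hsa hA
  have h0 : F 0 = A := by
    have := h3 0
    rwa [neg_zero, hω.flowOp_zero hsa, one_mul, mul_one, Complex.ofReal_zero] at this
  have hd : HasDerivAt (fun t : ℝ => F t) (deriv F 0) 0 := by
    have hF : HasDerivAt F (deriv F 0) (Complex.ofRealCLM 0) := by
      rw [map_zero]
      exact (h1 0).hasDerivAt
    exact (hF.scomp (0 : ℝ) Complex.ofRealCLM.hasDerivAt).congr_deriv (by simp)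
  have hlim := hasDerivAt_iff_tendsto_slope_zero.1 hd
  have hlim' : Tendsto (fun t : ℝ => (t : ℂ)⁻¹ •
      (G.flowOp hD t * (A : K →L[ℂ] K) * G.flowOp hD (-t) - A)) (𝓝[≠] 0) (𝓝 (deriv F 0)) := by
    refine hlim.congr fun t => ?_
    rw [zero_add, Complex.ofReal_zero, h0, h3, ← Complex.ofReal_inv]
    exact (Complex.coe_smul t⁻¹ _).symm
  refine ⟨⟨deriv F 0, G.isClosed_vN.mem_of_tendsto hlim' (.of_forall fun t => ?_)⟩, hlim'⟩
  exact G.vN.toStarSubalgebra.smul_mem (sub_mem (hω.conj_flowOp_mem_vN hsa t A.2) A.2) _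

theorem mul_mem_smearedSpan {A B : Elt G.vN} (hA : A ∈ G.smearedSpan hD)
    (hB : B ∈ G.smearedSpan hD) : A * B ∈ G.smearedSpan hD := by
  refine hω.smearedSpan_induction hsa (p := fun A => A * B ∈ G.smearedSpan hD) (fun r hr => ?_)
    (by simp) (fun A A' h h' => by rw [add_mul]; exact add_mem h h')
    (fun c A h => by rw [smul_mul_assoc]; exact Submodule.smul_mem _ c h) hA
  refine hω.smearedSpan_induction hsa (p := fun B => r.elt * B ∈ G.smearedSpan hD) (fun s hs => ?_)
    (by simp) (fun A A' h h' => by rw [mul_add]; exact add_mem h h')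
    (fun c A h => by rw [mul_smul_comm]; exact Submodule.smul_mem _ c h) hB
  obtain ⟨q, hq, h⟩ := hr.exists_mul hω hsa hs
  have : r.elt * s.elt = q.elt := Subtype.ext (h.trans (r.op_mul s)).symm
  rw [this]
  exact hω.elt_mem_smearedSpan hsa hq

theorem star_mem_smearedSpan {A : Elt G.vN} (hA : A ∈ G.smearedSpan hD) :
    star A ∈ G.smearedSpan hD := by
  refine hω.smearedSpan_induction hsa (p := fun A => star A ∈ G.smearedSpan hD) (fun r hr => ?_)
    (by simp) (fun A A' h h' => by rw [star_add]; exact add_mem h h')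
    (fun c A h => by rw [star_smul]; exact Submodule.smul_mem _ _ h) hA
  obtain ⟨q, hq, h⟩ := hr.exists_adjoint hω hsa
  have : star r.elt = q.elt := Subtype.ext (h.trans r.op_adjoint).symm
  rw [this]
  exact hω.elt_mem_smearedSpan hsa hq

theorem evolve_mem_smearedSpan (t : ℝ) {A : Elt G.vN} (hA : A ∈ G.smearedSpan hD) :
    hω.conjEquiv hsa t A ∈ G.smearedSpan hD := by
  refine hω.smearedSpan_induction hsa (p := fun A => hω.conjEquiv hsa t A ∈ G.smearedSpan hD)
    (fun r hr => ?_) (by simp) (fun A A' h h' => by rw [map_add]; exact add_mem h h')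
    (fun c A h => by rw [map_smul]; exact Submodule.smul_mem _ _ h) hA
  obtain ⟨q, hq, h⟩ := hr.exists_evolve hω hsa t
  have : hω.conjEquiv hsa t r.elt = q.elt := Subtype.ext (h.trans (hω.op_evolve hsa t r)).symm
  rw [this]
  exact hω.elt_mem_smearedSpan hsa hq

end

/-- The ⋆-algebra of smeared Weyl elements. -/
def smearedAlgebra : NonUnitalStarSubalgebra ℂ (Elt G.vN) where
  carrier := G.smearedSpan hD
  add_mem' := add_mem
  zero_mem' := zero_mem _
  mul_mem' := hω.mul_mem_smearedSpan hsa
  smul_mem' c _ h := Submodule.smul_mem _ c h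
  star_mem' := hω.star_mem_smearedSpan hsa

/-- A generating smearing as an element of the algebra of smeared Weyl elements. -/
def generator (r : {r // hω.IsWeylSmearing hsa r}) : hω.smearedAlgebra hsa :=
  ⟨r.1.elt, hω.elt_mem_smearedSpan hsa r.2⟩

/-- The bracket of two generating smearings. -/
def generatorBracket (r s : {r // hω.IsWeylSmearing hsa r}) : hω.smearedAlgebra hsa :=
  ⟨(r.1.bracket s.1).elt, by
    obtain ⟨q, hq, h⟩ := r.2.exists_bracket hω hsa s.2
    have : (r.1.bracket s.1).elt = q.elt := Subtype.ext h.symm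
    rw [this]
    exact hω.elt_mem_smearedSpan hsa hq⟩

theorem span_range_generator : Submodule.span ℂ (Set.range (hω.generator hsa)) = ⊤ := by
  refine eq_top_iff.2 fun A _ => ?_
  have h := hω.smearedSpan_induction hsa
    (p := fun A => ∃ hA : A ∈ hω.smearedAlgebra hsa,
      (⟨A, hA⟩ : hω.smearedAlgebra hsa) ∈ Submodule.span ℂ (Set.range (hω.generator hsa)))
    (fun r hr => ⟨_, Submodule.subset_span ⟨⟨r, hr⟩, rfl⟩⟩) ⟨zero_mem _, zero_mem _⟩
    (fun A B ⟨hA, h⟩ ⟨hB, h'⟩ => ⟨add_mem hA hB, add_mem h h'⟩)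
    (fun c A ⟨hA, h⟩ => ⟨SMulMemClass.smul_mem c hA, Submodule.smul_mem _ c h⟩) A.2
  exact h.2

theorem coe_linearCombination {ι : Type*} (c : ι → hω.smearedAlgebra hsa) (u : ι →₀ ℂ) :
    ((Finsupp.linearCombination ℂ c u : Elt G.vN) : K →L[ℂ] K) =
      ∑ i ∈ u.support, u i • ((c i : Elt G.vN) : K →L[ℂ] K) := by
  rw [Finsupp.linearCombination_apply, Finsupp.sum, AddSubmonoidClass.coe_finsetSum,
    AddSubmonoidClass.coe_finsetSum]
  rfl

/-- The Poisson bracket on the algebra of smeared Weyl elements. -/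
theorem exists_bracket : ∃ B : hω.smearedAlgebra hsa →ₗ[ℂ] hω.smearedAlgebra hsa →ₗ[ℂ]
    hω.smearedAlgebra hsa, ∀ r s, B (hω.generator hsa r) (hω.generator hsa s) =
      hω.generatorBracket hsa r s := by
  refine exists_bilinear_extension (hω.span_range_generator hsa) (fun u hu s => ?_)
    fun r s => Subtype.ext (Subtype.ext (r.1.op_bracket_swap s.1))
  have h1 : ∑ r ∈ u.support, u r • r.1.op = 0 := by
    have := hω.coe_linearCombination hsa (hω.generator hsa) u
    rw [hu] at this
    exact this.symm
  refine Subtype.ext (Subtype.ext ?_)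
  rw [hω.coe_linearCombination hsa]
  exact hω.sum_smul_op_bracket u.support u Subtype.val h1 s.1

section Laws

variable {B : hω.smearedAlgebra hsa →ₗ[ℂ] hω.smearedAlgebra hsa →ₗ[ℂ] hω.smearedAlgebra hsa}
  (hB : ∀ r s, B (hω.generator hsa r) (hω.generator hsa s) = hω.generatorBracket hsa r s)
include hB

/-- The bracket of elements given by smearings with the operators of generators. -/
theorem bracket_of_op {r s : Smearing G} {a b : hω.smearedAlgebra hsa}
    {r' s' : {r // hω.IsWeylSmearing hsa r}} (ha : a = hω.generator hsa r')
    (hb : b = hω.generator hsa s') (hr : r'.1.op = r.op) (hs : s'.1.op = s.op) :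
    ((B a b : Elt G.vN) : K →L[ℂ] K) = (r.bracket s).op := by
  rw [ha, hb, hB]
  exact hω.op_bracket_congr hr hs

theorem bracket_skew (a b : hω.smearedAlgebra hsa) : B a b = -B b a :=
  skew_of_generators (hω.span_range_generator hsa) hB
    (fun r s => Subtype.ext (Subtype.ext (r.1.op_bracket_swap s.1))) a b

/-- A product of generators is a generator only up to equality of operators. Since the bracket sees
only operators, it may be computed with the product smearing instead. -/
theorem bracket_leibniz (a b c : hω.smearedAlgebra hsa) :
    B a (b * c) = B a b * c + b * B a c := by
  refine leibniz_of_generators (hω.span_range_generator hsa) hB (fun r s q => ?_) a b c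
  obtain ⟨q', hq', h⟩ := s.2.exists_mul hω hsa q.2
  have h1 : hω.generator hsa s * hω.generator hsa q = hω.generator hsa ⟨q', hq'⟩ :=
    Subtype.ext (Subtype.ext (h.trans (s.1.op_mul q.1)).symm)
  refine Subtype.ext (Subtype.ext ?_)
  rw [hω.bracket_of_op hsa hB rfl h1 rfl h, Smearing.op_bracket_mul, Smearing.op_mul,
    Smearing.op_mul]
  rfl

theorem bracket_jacobi (a b c : hω.smearedAlgebra hsa) :
    B a (B b c) + B b (B c a) + B c (B a b) = 0 := by
  refine jacobi_of_generators (hω.span_range_generator hsa) (fun r s q => ?_) a b c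
  have key : ∀ r s q : {r // hω.IsWeylSmearing hsa r},
      ((B (hω.generator hsa r) (B (hω.generator hsa s) (hω.generator hsa q)) : Elt G.vN) :
        K →L[ℂ] K) = (r.1.bracket (s.1.bracket q.1)).op := fun r s q => by
    obtain ⟨q', hq', h⟩ := s.2.exists_bracket hω hsa q.2
    have h1 : B (hω.generator hsa s) (hω.generator hsa q) = hω.generator hsa ⟨q', hq'⟩ := by
      rw [hB]
      exact Subtype.ext (Subtype.ext h.symm)
    exact hω.bracket_of_op hsa hB rfl h1 rfl h
  refine Subtype.ext (Subtype.ext ?_)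
  have := Smearing.op_bracket_jacobi r.1 s.1 q.1
  rw [← key, ← key, ← key] at this
  exact this

theorem bracket_star (a b : hω.smearedAlgebra hsa) : B (star a) (star b) = star (B a b) := by
  refine star_of_generators (hω.span_range_generator hsa) hB (fun r s => ?_) a b
  obtain ⟨r', hr', h⟩ := r.2.exists_adjoint hω hsa
  obtain ⟨s', hs', h'⟩ := s.2.exists_adjoint hω hsa
  have h1 : star (hω.generator hsa r) = hω.generator hsa ⟨r', hr'⟩ :=
    Subtype.ext (Subtype.ext (h.trans r.1.op_adjoint).symm)
  have h2 : star (hω.generator hsa s) = hω.generator hsa ⟨s', hs'⟩ :=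
    Subtype.ext (Subtype.ext (h'.trans s.1.op_adjoint).symm)
  refine Subtype.ext (Subtype.ext ?_)
  rw [hω.bracket_of_op hsa hB h1 h2 h h', Smearing.op_bracket_adjoint]
  rfl

end Laws

end IsWeakKMS
end Bracket

/-! ### The classical KMS condition. -/

section KMS

variable {𝓗 : Type u} [NormedAddCommGroup 𝓗] [InnerProductSpace ℂ 𝓗] [CompleteSpace 𝓗]
  {D : Submodule ℂ 𝓗} {H : 𝓗 →ₗ.[ℂ] 𝓗}
  {ω : WeylState D} {K : Type v} [NormedAddCommGroup K] [InnerProductSpace ℂ K]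
  [CompleteSpace K] {hD : IsTestSpace H D} {β : ℝ} {G : GNSTriple ω K}

namespace IsWeakKMS

/-- The difference quotient of `t ↦ β ⟨Ω, τ_t(A) C Ω⟩` at `0`, as a bilinear form in `A` and `C`. -/
def kmsQuotient (G : GNSTriple ω K) (hD : IsTestSpace H D) (β t : ℝ) :
    (K →L[ℂ] K) →ₗ[ℂ] (K →L[ℂ] K) →ₗ[ℂ] ℂ :=
  LinearMap.mk₂ ℂ (fun A C => (β : ℂ) * ((t : ℂ)⁻¹ *
      (⟪G.Ω, (G.flowOp hD t * A * G.flowOp hD (-t) * C) G.Ω⟫_ℂ - ⟪G.Ω, (A * C) G.Ω⟫_ℂ)))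
    (fun A A' C => by
      simp only [mul_add, add_mul, add_apply, inner_add_right]
      ring)
    (fun c A C => by
      simp only [mul_smul_comm, smul_mul_assoc, smul_apply, inner_smul_right, smul_eq_mul]
      ring)
    (fun A C C' => by
      simp only [mul_add, add_apply, inner_add_right]
      ring)
    (fun c A C => by
      simp only [mul_smul_comm, smul_apply, inner_smul_right, smul_eq_mul]
      ring)

variable (hω : IsWeakKMS hD β ω G) (hsa : IsSelfAdjoint H)

/-- The inclusion of the algebra of smeared Weyl elements into the bounded operators. -/
def toOperator : hω.smearedAlgebra hsa →ₗ[ℂ] (K →L[ℂ] K) where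
  toFun a := ((a : Elt G.vN) : K →L[ℂ] K)
  map_add' _ _ := rfl
  map_smul' _ _ := rfl

section Laws

variable {B : hω.smearedAlgebra hsa →ₗ[ℂ] hω.smearedAlgebra hsa →ₗ[ℂ] hω.smearedAlgebra hsa}
  (hB : ∀ r s, B (hω.generator hsa r) (hω.generator hsa s) = hω.generatorBracket hsa r s)
include hB

/-- Quotient and limit are both bilinear, so the differentiation of the state on generators settles
the general case. -/
theorem tendsto_kmsQuotient (b a : hω.smearedAlgebra hsa) :
    Tendsto (fun t => kmsQuotient G hD β t (hω.toOperator hsa b) (hω.toOperator hsa a))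
      (𝓝[≠] 0) (𝓝 ⟪G.Ω, hω.toOperator hsa (B b a) G.Ω⟫_ℂ) := by
  let ι := hω.toOperator hsa
  let φ : (K →L[ℂ] K) →ₗ[ℂ] ℂ :=
    (innerSL ℂ G.Ω ∘L ContinuousLinearMap.apply ℂ K G.Ω : (K →L[ℂ] K) →L[ℂ] ℂ).toLinearMap
  refine tendsto_bilinear_of_generators (hω.span_range_generator hsa)
    (q := fun t => (kmsQuotient G hD β t).compl₁₂ ι ι) (ψ := B.compr₂ (φ ∘ₗ ι)) (fun r s => ?_) b a
  change Tendsto _ _ (𝓝 ⟪G.Ω, ι (B (hω.generator hsa r) (hω.generator hsa s)) G.Ω⟫_ℂ)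
  rw [hB]
  exact hω.tendsto_inner_evolve_mul hsa r.1 s.1

/-- The derivative exists in norm because the orbit is norm-entire. The pairing with `a` is
therefore the limit of the quotients already computed, and commutativity puts the factors in the
required order. -/
theorem exists_hasDerivation (a b : hω.smearedAlgebra hsa) : ∃ d : Elt G.vN,
    (hω.dynamics hsa).HasDerivation b d ∧
      (β : ℂ) * vectorFunctional G.vN G.Ω ((a : Elt G.vN) * d) =
        vectorFunctional G.vN G.Ω (B b a : Elt G.vN) := by
  obtain ⟨d, hd⟩ := hω.exists_derivative hsa b.2
  refine ⟨d, tendsto_sigmaWeakOn.2 fun p => (p.evalCLM.continuous.tendsto _).comp hd, ?_⟩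
  rw [GNSTriple.vN_commutative]
  let φ : (K →L[ℂ] K) →L[ℂ] ℂ := innerSL ℂ G.Ω ∘L ContinuousLinearMap.apply ℂ K
    (hω.toOperator hsa a G.Ω)
  refine tendsto_nhds_unique ?_ (hω.tendsto_kmsQuotient hsa hB b a)
  refine (((φ.continuous.tendsto _).comp hd).const_mul (β : ℂ)).congr fun t => ?_
  simp only [Function.comp_apply, map_smul, map_sub]
  rfl

/-- The Poisson structure of the algebra of smeared Weyl elements. -/
def poissonStructure : PoissonStructure (hω.dynamics hsa) where
  carrier := hω.smearedAlgebra hsa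
  dense := hω.mem_closure_smearedSpan hsa
  invariant t _ := hω.evolve_mem_smearedSpan hsa t
  analytic _ := hω.isAnalytic_of_mem hsa
  bracket := B
  skew := hω.bracket_skew hsa hB
  leibniz := hω.bracket_leibniz hsa hB
  jacobi := hω.bracket_jacobi hsa hB
  bracket_star := hω.bracket_star hsa hB

theorem isClassicalKMS :
    IsClassicalKMS (hω.dynamics hsa) (hω.poissonStructure hsa hB) β
      (vectorFunctional G.vN G.Ω) where
  commutative := GNSTriple.vN_commutative
  nonneg a := by
    have : vectorFunctional G.vN G.Ω (star a * a) =
        ⟪(a : K →L[ℂ] K) G.Ω, (a : K →L[ℂ] K) G.Ω⟫_ℂ := by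
      rw [← ContinuousLinearMap.adjoint_inner_right]
      rfl
    rw [this, inner_self_eq_norm_sq_to_K]
    norm_cast
    exact Complex.zero_le_real.2 (sq_nonneg _)
  map_one := by
    change ⟪G.Ω, G.Ω⟫_ℂ = 1
    rw [inner_self_eq_norm_sq_to_K, G.norm_Ω]
    simp
  normal := ⟨NormalPair.single G.Ω G.Ω, fun a => (NormalPair.eval_single _ _ _).symm⟩
  kms := hω.exists_hasDerivation hsa hB

theorem isSmearedBracket {n m : ℕ} (hn : 0 < n) (hm : 0 < m) (f : Fin n → D) (g : Fin m → D)
    {χ₁ : EuclideanSpace ℝ (Fin n) → ℝ} (h₁ : χ₁ ∈ smearClass n)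
    {χ₂ : EuclideanSpace ℝ (Fin m) → ℝ} (h₂ : χ₂ ∈ smearClass m) (a b : hω.smearedAlgebra hsa)
    (ha : G.IsSmeared hD f χ₁ a) (hb : G.IsSmeared hD g χ₂ b) :
    G.IsSmearedBracket hD f χ₁ g χ₂ (B a b) := by
  let r := hω.weylSmearing hsa f (mem_smearClass_iff.1 h₁)
  let s := hω.weylSmearing hsa g (mem_smearClass_iff.1 h₂)
  have ha' : a = hω.generator hsa ⟨r, n, hn, f, _, _, rfl⟩ :=
    Subtype.ext (hω.eq_elt_of_isSmeared hsa h₁ ha)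
  have hb' : b = hω.generator hsa ⟨s, m, hm, g, _, _, rfl⟩ :=
    Subtype.ext (hω.eq_elt_of_isSmeared hsa h₂ hb)
  have hop : ((B a b : Elt G.vN) : K →L[ℂ] K) = (r.bracket s).op :=
    hω.bracket_of_op hsa hB ha' hb' rfl rfl
  intro p
  rw [hop, ← (r.bracket s).eval_op p]
  have hcast : ∀ x : EuclideanSpace ℝ (Fin n) × EuclideanSpace ℝ (Fin m),
      ((χ₁ x.1 * χ₂ x.2 * symp (hD.multiEvol g x.2 : 𝓗) (hD.multiEvol f x.1 : 𝓗) : ℝ) : ℂ) =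
        (r.bracket s).w x := fun x => by
    push_cast
    rfl
  simp only [hcast]
  exact ⟨(r.bracket s).integrable_eval p, rfl⟩

end Laws

end IsWeakKMS
end KMS
end ClassicalKMS

end

theorem mainTheorem12
    {𝓗 : Type*} [NormedAddCommGroup 𝓗] [InnerProductSpace ℂ 𝓗] [CompleteSpace 𝓗]
    [TopologicalSpace.SeparableSpace 𝓗]
    (H : 𝓗 →ₗ.[ℂ] 𝓗) (hsa : IsSelfAdjoint H)
    (hpos : ∀ x : H.domain, 0 ≤ (⟪(x : 𝓗), H x⟫_ℂ).re)
    (hinj : ∀ x : H.domain, H x = 0 → x = 0)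
    (D : Submodule ℂ 𝓗) (hD : ClassicalKMS.IsTestSpace H D) (β : ℝ)
    (ω : ClassicalKMS.WeylState D)
    {K : Type*} [NormedAddCommGroup K] [InnerProductSpace ℂ K] [CompleteSpace K]
    (G : ClassicalKMS.GNSTriple ω K)
    (hω : ClassicalKMS.IsWeakKMS hD β ω G) :
    ∃ α : ClassicalKMS.WStarDynamics G.vN,
      (∀ (t : ℝ) (f : D),
        α.τ t (G.rep (ClassicalKMS.weyl f)) = G.rep (ClassicalKMS.weyl (hD.evol t f))) ∧
      (∀ (n : ℕ), 0 < n → ∀ (f : Fin n → D), ∀ χ ∈ ClassicalKMS.smearClass n,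
        ∃ A : ClassicalKMS.Elt G.vN, G.IsSmeared hD f χ A) ∧
      ∃ P : ClassicalKMS.PoissonStructure α,
        (P.carrier : Set (ClassicalKMS.Elt G.vN)) = G.smearedSpan hD ∧
        (∀ (n m : ℕ), 0 < n → 0 < m → ∀ (f : Fin n → D) (g : Fin m → D),
          ∀ χ₁ ∈ ClassicalKMS.smearClass n, ∀ χ₂ ∈ ClassicalKMS.smearClass m,
          ∀ A B : P.carrier, G.IsSmeared hD f χ₁ A → G.IsSmeared hD g χ₂ B →
            G.IsSmearedBracket hD f χ₁ g χ₂ (P.bracket A B)) ∧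
        ClassicalKMS.IsClassicalKMS α P β (ClassicalKMS.vectorFunctional G.vN G.Ω) := by
  obtain ⟨B, hB⟩ := hω.exists_bracket hsa
  refine ⟨hω.dynamics hsa, hω.dynamics_rep_weyl hsa, fun n _ f χ hχ =>
    ⟨_, hω.isSmeared_weylSmearing hsa f hχ⟩, hω.poissonStructure hsa hB, rfl, ?_,
    hω.isClassicalKMS hsa hB⟩
  intro n m hn hm f g χ₁ h₁ χ₂ h₂ a b ha hb
  exact hω.isSmearedBracket hsa hB hn hm f g h₁ h₂ a b ha hb
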